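/- A (finite, normal-form) game $\Gamma$ consists of players $1,\dots,N$ ($N \ge 1$), a nonempty finite action set $A^i$ for each player $i$, and payoff functions $u^i : A \to \mathbb{Q}$ on the set $A = A^1 \times \dots \times A^N$ of action profiles. Let $\mathcal{A} = A^1 \sqcup \dots \sqcup A^N$ be the disjoint union of the action sets. A symmetry of $\Gamma$ is a bijection $\phi : \mathcal{A} \to \mathcal{A}$ such that there is a permutation $\pi$ of the players with $\phi(A^i) \subseteq A^{\pi(i)}$ for every player $i$, and $u^i(\mathbf{a}) = u^{\pi(i)}(\phi(\mathbf{a}))$ for all $i$ and all $\mathbf{a} \in A$, where $\phi(\mathbf{a}) = \big(\phi(\mathbf{a}_{\pi^{-1}(j)})\big)_{j}$. It is nontrivial if $\phi \neq \mathrm{id}$. Games are given as inputs in explicit form, that is, by their numbers of actions and the table of all payoffs, written in binary. The graph automorphism problem asks whether a finite simple graph, given by its adjacency matrix, has an automorphism other than the identity. Let $\mathsf{GA}$ be the class of the decision problems that are polynomial-time many-one reducible to the graph automorphism problem. A problem is $\mathsf{GA}$-hard if every problem in $\mathsf{GA}$ is polynomial-time many-one reducible to it, and $\mathsf{GA}$-complete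 if, in addition, it belongs to $\mathsf{GA}$. **Theorem.** Deciding whether a given game has a nontrivial symmetry is $\mathsf{GA}$-complete. It is $\mathsf{GA}$-hard already when restricted to two-player team games ($u^1 = u^2$), and also when restricted to two-player zero-sum games ($u^1 = -u^2$). -/

import Mathlib

/-! ### Decision problems, polynomial-time many-one reductions, completeness -/

/-- A decision problem: a type of instances, an injective encoding of the instances as strings
over a finite alphabet, and the set of yes-instances. -/
structure DecisionProblem where
  Inst : Type
  Alphabet : Type
  [finite_alphabet : Finite Alphabet]
  encode : Inst → List Alphabet
  encode_injective : Function.Injective encode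
  IsYes : Inst → Prop

namespace DecisionProblem

/-- Polynomial-time many-one (Karp) reducibility: some map of instances, computed by a
(multi-stack) Turing machine in time polynomial in the length of the encoded input, preserves
and reflects yes-instances. -/
def PolyReducible (P Q : DecisionProblem) : Prop :=
  ∃ f : P.Inst → Q.Inst,
    Nonempty (Turing.TM2ComputableInPolyTime P.encode Q.encode f) ∧
      ∀ x, P.IsYes x ↔ Q.IsYes (f x)

/-- The problem `P` on those instances only that satisfy `p`, encoded as before. -/
def restrict (P : DecisionProblem) (p : P.Inst → Prop) : DecisionProblem where
  Inst := {x : P.Inst // p x}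
  Alphabet := P.Alphabet
  finite_alphabet := P.finite_alphabet
  encode x := P.encode x.1
  encode_injective := P.encode_injective.comp Subtype.val_injective
  IsYes x := P.IsYes x.1

/-- `P` is hard for the class `C` under polynomial-time many-one reductions. -/
def IsHardFor (C : Set DecisionProblem) (P : DecisionProblem) : Prop :=
  ∀ Q ∈ C, Q.PolyReducible P

/-- `P` is complete for the class `C` under polynomial-time many-one reductions. -/
def IsCompleteFor (C : Set DecisionProblem) (P : DecisionProblem) : Prop :=
  P ∈ C ∧ IsHardFor C P

end DecisionProblem

/-! ### Strings over `{0, 1, #}` -/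

/-- A list of bit strings as one string over the alphabet `{0, 1, #}`, where `none` is the
symbol `#`, which ends each of the bit strings. -/
def encodeWords (L : List (List Bool)) : List (Option Bool) :=
  L.flatMap fun w => w.map some ++ [none]

theorem encodeWords_injective : Function.Injective encodeWords := by
  have key : ∀ (v w : List Bool) (r s : List (Option Bool)),
      v.map some ++ none :: r = w.map some ++ none :: s → v = w ∧ r = s := by
    intro v
    induction v with
    | nil => intro w r s h; cases w <;> simp_all
    | cons x v ih =>
      intro w r s h
      cases w with
      | nil => simp at h
      | cons y w =>
        simp only [List.map_cons, List.cons_append, List.cons.injEq, Option.some.injEq] at h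
        obtain ⟨h1, h2⟩ := ih w r s h.2
        exact ⟨by rw [h.1, h1], h2⟩
  intro L
  induction L with
  | nil => intro M h; cases M <;> simp_all [encodeWords]
  | cons v L ih =>
    intro M h
    cases M with
    | nil => simp [encodeWords] at h
    | cons w M =>
      simp only [encodeWords, List.flatMap_cons, List.append_assoc, List.singleton_append] at h
      obtain ⟨h1, h2⟩ := key v w _ _ h
      rw [h1, ih h2]

/-- A rational number in lowest terms as two bit strings: a sign bit followed by the absolute
value of the numerator in binary, and the denominator in binary. -/
def ratWords (q : ℚ) : List (List Bool) :=
  [decide (q < 0) :: Computability.encodeNat q.num.natAbs, Computability.encodeNat q.den]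

theorem ratWords_injective : Function.Injective ratWords := by
  have henc : Function.Injective Computability.encodeNat :=
    Function.LeftInverse.injective Computability.decode_encodeNat
  intro p q h
  simp only [ratWords, List.cons.injEq, decide_eq_decide, and_true] at h
  obtain ⟨⟨hs, hn⟩, hd⟩ := h
  have hn := henc hn
  refine Rat.ext ?_ (henc hd)
  rw [← Rat.num_neg, ← Rat.num_neg] at hs
  omega

/-! ### Graph automorphism -/

/-- The rows of the adjacency matrix of a graph with vertex set `{0, …, n - 1}`. -/
noncomputable def graphWords (G : Σ n : ℕ, SimpleGraph (Fin n)) : List (List Bool) :=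
  open Classical in
  List.ofFn fun i : Fin G.1 => List.ofFn fun j : Fin G.1 => decide (G.2.Adj i j)

theorem graphWords_injective : Function.Injective graphWords := by
  rintro ⟨n, G⟩ ⟨m, H⟩ h
  have hn : n = m := by simpa [graphWords] using congrArg List.length h
  subst hn
  have h := List.ofFn_injective h
  have : G = H := by
    ext i j
    simpa using congrFun (List.ofFn_injective (congrFun h i)) j
  rw [this]

/-- The graph automorphism problem: given a finite simple graph by its adjacency matrix, does it
have an automorphism other than the identity? -/
noncomputable def graphAutomorphism : DecisionProblem where
  Inst := Σ n : ℕ, SimpleGraph (Fin n)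
  Alphabet := Option Bool
  encode G := encodeWords (graphWords G)
  encode_injective := encodeWords_injective.comp graphWords_injective
  IsYes G := ∃ σ : G.2 ≃g G.2, σ ≠ RelIso.refl G.2.Adj

/-- The complexity class `GA`: the problems that reduce to graph automorphism. -/
def classGA : Set DecisionProblem :=
  {P | P.PolyReducible graphAutomorphism}

/-! ### Games and their symmetries -/

/-- A finite normal-form game, with rational payoffs so that it can be an input of a machine.
Players and the actions of each player are numbered, and each player has an action. -/
structure NormalFormGame where
  numPlayers : ℕ
  numPlayers_pos : 0 < numPlayers
  numActions : Fin numPlayers → ℕ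
  numActions_pos : ∀ i, 0 < numActions i
  payoff : Fin numPlayers → (∀ j, Fin (numActions j)) → ℚ

namespace NormalFormGame

/-- The action profiles. -/
abbrev Profile (Γ : NormalFormGame) : Type := ∀ j, Fin (Γ.numActions j)

/-- The disjoint union of the action sets of all players. -/
abbrev Action (Γ : NormalFormGame) : Type := Σ i, Fin (Γ.numActions i)

/-- The image of an action profile `a` under a bijection `φ` of the actions that maps the actions
of each player `i` to actions of player `π i`: player `j` plays the image of the action that
`a` prescribes to player `π⁻¹ j`. -/
def mapProfile (Γ : NormalFormGame) (φ : Equiv.Perm Γ.Action)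
    (π : Equiv.Perm (Fin Γ.numPlayers)) (h : ∀ x : Γ.Action, (φ x).1 = π x.1)
    (a : Γ.Profile) : Γ.Profile := fun j =>
  Fin.cast (congrArg Γ.numActions ((h ⟨π.symm j, a (π.symm j)⟩).trans (π.apply_symm_apply j)))
    (φ ⟨π.symm j, a (π.symm j)⟩).2

/-- A game symmetry: a bijection of the actions that maps actions of the same player to actions of
the same player (and thus induces a permutation `π` of the players) and preserves payoffs. -/
def IsSymmetry (Γ : NormalFormGame) (φ : Equiv.Perm Γ.Action) : Prop :=
  ∃ (π : Equiv.Perm (Fin Γ.numPlayers)) (h : ∀ x : Γ.Action, (φ x).1 = π x.1),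
    ∀ (i : Fin Γ.numPlayers) (a : Γ.Profile),
      Γ.payoff i a = Γ.payoff (π i) (Γ.mapProfile φ π h a)

/-- All players receive the same payoff under each action profile. -/
def IsTeamGame (Γ : NormalFormGame) : Prop :=
  ∀ (i j : Fin Γ.numPlayers) (a : Γ.Profile), Γ.payoff i a = Γ.payoff j a

/-- The payoffs of all players sum to zero under each action profile. -/
def IsZeroSum (Γ : NormalFormGame) : Prop :=
  ∀ a : Γ.Profile, ∑ i, Γ.payoff i a = 0

/-- The explicit form of a game: the numbers of actions in unary (no longer than the payoff
table), an empty word, and the payoff table, that is, for each action profile (in mixed radix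
order) and then for each player, the payoff in binary. -/
def words (Γ : NormalFormGame) : List (List Bool) :=
  (List.ofFn fun i => List.replicate (Γ.numActions i) true) ++ [] ::
    (List.finRange (∏ i, Γ.numActions i)).flatMap fun k =>
      (List.finRange Γ.numPlayers).flatMap fun i => ratWords (Γ.payoff i (finPiFinEquiv.symm k))

theorem words_injective : Function.Injective words := by
  have hsplit : ∀ (A B R S : List (List Bool)), [] ∉ A → [] ∉ B →
      A ++ [] :: R = B ++ [] :: S → A = B ∧ R = S := by
    intro A
    induction A with
    | nil => intro B R S _ hB h; cases B <;> simp_all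
    | cons x A ih =>
      intro B R S hA hB h
      cases B with
      | nil => simp_all
      | cons y B =>
        simp only [List.cons_append, List.cons.injEq] at h
        obtain ⟨h1, h2⟩ := ih B R S (fun h' => hA (List.mem_cons_of_mem _ h'))
          (fun h' => hB (List.mem_cons_of_mem _ h')) h.2
        exact ⟨by rw [h.1, h1], h2⟩
  have hflat : ∀ {α : Type} (l : List α) (f g : α → List (List Bool)),
      (∀ x, (f x).length = (g x).length) → l.flatMap f = l.flatMap g →
        ∀ x ∈ l, f x = g x := by
    intro α l f g hlen
    induction l with
    | nil => simp
    | cons y l ih =>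
      intro h x hx
      simp only [List.flatMap_cons] at h
      obtain ⟨h1, h2⟩ := List.append_inj h (hlen y)
      rcases List.mem_cons.1 hx with rfl | hx
      · exact h1
      · exact ih h2 x hx
  have hne : ∀ Γ : NormalFormGame,
      [] ∉ List.ofFn fun i => List.replicate (Γ.numActions i) true := by
    intro Γ h
    obtain ⟨i, hi⟩ := (List.mem_ofFn' _ _).1 h
    have := Γ.numActions_pos i
    have := congrArg List.length hi
    simp at this
    omega
  intro Γ Δ h
  obtain ⟨h1, h2⟩ := hsplit _ _ _ _ (hne Γ) (hne Δ) h
  obtain ⟨N, hN, m, hm, u⟩ := Γ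
  obtain ⟨N', hN', m', hm', u'⟩ := Δ
  have hNN : N = N' := by simpa using congrArg List.length h1
  subst hNN
  have hmm : m = m' := by
    funext i
    simpa using congrArg List.length (congrFun (List.ofFn_injective h1) i)
  subst hmm
  have huu : u = u' := by
    funext i a
    have h3 := hflat _ _ _ (fun k => by simp [List.length_flatMap, ratWords]) h2
      (finPiFinEquiv a) (List.mem_finRange _)
    have h4 := hflat _ _ _ (fun k => by simp [ratWords]) h3 i (List.mem_finRange _)
    simpa using ratWords_injective h4
  subst huu
  rfl

end NormalFormGame

/-- The game symmetry problem: given a normal-form game in explicit form, does it have a symmetry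
other than the identity? -/
def gameSymmetry : DecisionProblem where
  Inst := NormalFormGame
  Alphabet := Option Bool
  encode Γ := encodeWords Γ.words
  encode_injective := encodeWords_injective.comp NormalFormGame.words_injective
  IsYes Γ := ∃ φ : Equiv.Perm Γ.Action, Γ.IsSymmetry φ ∧ φ ≠ 1

/-- The game symmetry problem for two-player team games. -/
def twoPlayerTeamGameSymmetry : DecisionProblem :=
  gameSymmetry.restrict fun Γ : NormalFormGame => Γ.numPlayers = 2 ∧ Γ.IsTeamGame

/-- The game symmetry problem for two-player zero-sum games. -/
def twoPlayerZeroSumGameSymmetry : DecisionProblem :=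
  gameSymmetry.restrict fun Γ : NormalFormGame => Γ.numPlayers = 2 ∧ Γ.IsZeroSum

/-! ### Polynomial bounds -/

/-! The combinatorial core is a pair of constructions, each matching nontrivial symmetries with
nontrivial automorphisms.

From games to graphs: take as vertices the actions and the payoff table entries `(i, a)`. Make the
actions of one player a clique, make the entries of one profile a clique, and join `(i, a)` to the
action of player `i` in `a`. An automorphism that respects the kind of vertex and the payoffs
permutes the players through the first cliques and the profiles through the second. The third kind
of edge forces the action on profiles to be the one induced by the action on actions. So such
automorphisms are exactly the symmetries (`isSymmetry_of_tableGraph_iso`,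
`tableGraph_iso_of_isSymmetry`). Kinds and payoffs are expressed by vertex labels, and labels are
removed by attaching a path whose every second vertex is joined to the vertices with one label. The
free end of the path is the only vertex of degree at most one, so automorphisms fix the path
pointwise and thus preserve labels (`labelGraph_iso_path`, `exists_labelGraph_iso_iff`).

From graphs to games: the adjacency matrix, with `2` on the diagonal, is a payoff matrix. A pair of
a row and a column permutation that preserves it is a single permutation, by the diagonal, and then
an automorphism. One additional row of `3`s and two additional columns of `3`s and `4`s are
recognizable by their entries and give the players different numbers of actions, so that the players
cannot be swapped (`exists_iso_of_gameEntry`, `toGame_exists_symmetry_iff`). The second player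
receives `ε` times the entry; `ε = 1` and `ε = -1` give the team and the zero-sum game.

Hardness for the whole class also needs transitivity of reductions, that is, composition of Turing
machines (`TM2ComputableInPolyTime.nonempty_comp`). The first machine's output length is bounded
because each step pushes boundedly many symbols.

That both constructions take polynomial time is shown in a small calculus. Structured stack programs
compile to machines step by step (`Exec.stepsTo`); values are binary trees in prefix code; `PTime`
is closed under composition, pairing, case distinction and size-bounded folds; and `PTime.tm2`
returns to machines on strings. Numbers are unary, which is harmless since only counts and indices
are computed with. Payoffs stay words and are only compared. -/

theorem Polynomial.eval_nat_mono (p : Polynomial ℕ) {m n : ℕ} (h : m ≤ n) :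
    p.eval m ≤ p.eval n := by
  rw [Polynomial.eval_eq_sum_range, Polynomial.eval_eq_sum_range]
  gcongr

/-! ### Composition of Turing machines -/

namespace Turing

/-- `f` is defined `n` times in a row, starting from `a`, and leads to `b`. -/
def StepsTo {C : Type*} (f : C → Option C) : ℕ → C → C → Prop
  | 0, a, b => a = b
  | n + 1, a, b => ∃ c, f a = some c ∧ StepsTo f n c b

theorem StepsTo.trans {C : Type*} {f : C → Option C} {m n : ℕ} {a b c : C}
    (h₁ : StepsTo f m a b) (h₂ : StepsTo f n b c) : StepsTo f (m + n) a c := by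
  induction m generalizing a with
  | zero => rw [Nat.zero_add]; exact h₁ ▸ h₂
  | succ m ih =>
    obtain ⟨d, hd, h⟩ := h₁
    rw [Nat.succ_add]
    exact ⟨d, hd, ih h⟩

theorem iterate_bind_none {C : Type*} (f : C → Option C) (n : ℕ) :
    (flip bind f)^[n] none = none := by
  induction n with
  | zero => rfl
  | succ n ih => rw [Function.iterate_succ_apply]; exact ih

/-- Bridge to the iterated `bind` on `Option` by which machine runs are defined; `StepsTo` peels off
the first step and so suits induction. -/
theorem stepsTo_iff {C : Type*} {f : C → Option C} {n : ℕ} {a b : C} :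
    StepsTo f n a b ↔ (flip bind f)^[n] (some a) = some b := by
  induction n generalizing a with
  | zero => simp [StepsTo]
  | succ n ih =>
    rw [Function.iterate_succ_apply]
    have : flip bind f (some a) = f a := rfl
    rw [this, StepsTo]
    constructor
    · rintro ⟨c, hc, h⟩
      rw [hc]
      exact ih.1 h
    · intro h
      cases hc : f a with
      | none => rw [hc, iterate_bind_none] at h; cases h
      | some c => exact ⟨c, rfl, ih.2 (hc ▸ h)⟩

/-- A step-by-step simulation preserves the exact number of steps. -/
theorem StepsTo.map {C D : Type*} {f : C → Option C} {g : D → Option D} {φ : C → D}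
    (h : ∀ a b, f a = some b → g (φ a) = some (φ b)) {n : ℕ} {a b : C} (hn : StepsTo f n a b) :
    StepsTo g n (φ a) (φ b) := by
  induction n generalizing a with
  | zero => exact congrArg φ hn
  | succ n ih =>
    obtain ⟨c, hc, h'⟩ := hn
    exact ⟨φ c, h _ _ hc, ih h'⟩

/-! ### Stack growth during a run. -/

section Growth

variable {K : Type*} [DecidableEq K] {Γ : K → Type*} {Λ σ : Type*}

/-- The number of symbols that a statement pushes at most. -/
def pushCount : TM2.Stmt Γ Λ σ → ℕ
  | .push _ _ q => pushCount q + 1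
  | .peek _ _ q => pushCount q
  | .pop _ _ q => pushCount q
  | .load _ q => pushCount q
  | .branch _ q₁ q₂ => pushCount q₁ + pushCount q₂
  | .goto _ => 0
  | .halt => 0

theorem length_stepAux_le (q : TM2.Stmt Γ Λ σ) (v : σ) (S : ∀ k, List (Γ k)) (k : K) :
    ((TM2.stepAux q v S).stk k).length ≤ (S k).length + pushCount q := by
  induction q generalizing v S with
  | push k' f q ih =>
    refine (ih _ _).trans ?_
    by_cases hk : k = k'
    · subst hk; simp [pushCount, add_assoc, add_comm 1]
    · simp [pushCount, Function.update_of_ne hk]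
  | peek k' f q ih => exact ih _ _
  | pop k' f q ih =>
    refine (ih _ _).trans ?_
    by_cases hk : k = k'
    · subst hk; simp [pushCount]
    · simp [pushCount, Function.update_of_ne hk]
  | load f q ih => exact ih _ _
  | branch f q₁ q₂ ih₁ ih₂ =>
    simp only [TM2.stepAux, pushCount]
    cases f v
    · exact (ih₂ _ _).trans (by omega)
    · exact (ih₁ _ _).trans (by omega)
  | goto f => simp [pushCount]
  | halt => simp [pushCount]

/-- There are finitely many labels, so one constant bounds the pushes of every single step. -/
theorem exists_growth [Finite Λ] (M : Λ → TM2.Stmt Γ Λ σ) :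
    ∃ d : ℕ, ∀ n c c' k, StepsTo (TM2.step M) n c c' →
      (c'.stk k).length ≤ (c.stk k).length + n * d := by
  obtain ⟨d, hd⟩ := (Set.finite_range fun l => pushCount (M l)).bddAbove
  refine ⟨d, fun n => ?_⟩
  induction n with
  | zero => rintro c c' k rfl; simp
  | succ n ih =>
    rintro ⟨l, v, S⟩ c' k ⟨c, hc, h⟩
    have h1 := ih _ _ k h
    cases l with
    | none => simp at hc
    | some l =>
      simp only [TM2.step, Option.some.injEq] at hc
      have h2 := length_stepAux_le (M l) v S k
      have h3 : pushCount (M l) ≤ d := hd ⟨l, rfl⟩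
      rw [hc] at h2
      simp only [Nat.succ_mul]
      omega

end Growth

/-! ### The composite program and its four phases. -/

section Comp

variable {K₁ K₂ : Type} {Γ₁ : K₁ → Type} {Γ₂ : K₂ → Type} {Λ₁ Λ₂ σ₁ σ₂ β : Type}

/-- The alphabets of the stacks of two machines and of one additional stack. -/
abbrev CompAlphabet (Γ₁ : K₁ → Type) (Γ₂ : K₂ → Type) (β : Type) : Option (K₁ ⊕ K₂) → Type
  | some (.inl k) => Γ₁ k
  | some (.inr k) => Γ₂ k
  | none => β

/-- The contents of the stacks of two machines and of one additional stack. -/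
def compStk (S₁ : ∀ k, List (Γ₁ k)) (S₂ : ∀ k, List (Γ₂ k)) (T : List β) :
    ∀ k, List (CompAlphabet Γ₁ Γ₂ β k)
  | some (.inl k) => S₁ k
  | some (.inr k) => S₂ k
  | none => T

section

variable [DecidableEq K₁] [DecidableEq K₂] (S₁ : ∀ k, List (Γ₁ k)) (S₂ : ∀ k, List (Γ₂ k))
  (T : List β)

theorem update_compStk_left (k : K₁) (x : List (Γ₁ k)) :
    Function.update (compStk S₁ S₂ T) (some (.inl k)) x =
      compStk (Function.update S₁ k x) S₂ T := by
  funext k'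
  rcases k' with _ | k' | k'
  · rfl
  · by_cases h : k' = k
    · subst h; simp [compStk]
    · rw [Function.update_of_ne (by simpa using h)]
      simp [compStk, Function.update_of_ne h]
  · rfl

theorem update_compStk_right (k : K₂) (x : List (Γ₂ k)) :
    Function.update (compStk S₁ S₂ T) (some (.inr k)) x =
      compStk S₁ (Function.update S₂ k x) T := by
  funext k'
  rcases k' with _ | k' | k'
  · rfl
  · rfl
  · by_cases h : k' = k
    · subst h; simp [compStk]
    · rw [Function.update_of_ne (by simpa using h)]
      simp [compStk, Function.update_of_ne h]

theorem update_compStk_none (x : List β) :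
    Function.update (compStk S₁ S₂ T) none x = compStk S₁ S₂ x := by
  funext k'
  rcases k' with _ | k' | k' <;> rfl

end

/-- The labels of a composite machine: those of the two machines, and two loops that move the
output of the first machine to the input stack of the second one, by way of another stack. -/
abbrev CompLabel (Λ₁ Λ₂ : Type) : Type := (Λ₁ ⊕ Λ₂) ⊕ Bool

/-- The registers of a composite machine. -/
abbrev CompVar (σ₁ σ₂ β : Type) : Type := σ₁ × σ₂ × Option β

open TM2.Stmt

/-- A statement of the first machine as one of the composite machine. -/
def liftLeft : TM2.Stmt Γ₁ Λ₁ σ₁ →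
    TM2.Stmt (CompAlphabet Γ₁ Γ₂ β) (CompLabel Λ₁ Λ₂) (CompVar σ₁ σ₂ β)
  | .push k f q => push (some (.inl k)) (fun v => f v.1) (liftLeft q)
  | .peek k f q => peek (some (.inl k)) (fun v o => (f v.1 o, v.2)) (liftLeft q)
  | .pop k f q => pop (some (.inl k)) (fun v o => (f v.1 o, v.2)) (liftLeft q)
  | .load f q => load (fun v => (f v.1, v.2)) (liftLeft q)
  | .branch f q₁ q₂ => branch (fun v => f v.1) (liftLeft q₁) (liftLeft q₂)
  | .goto f => goto fun v => .inl (.inl (f v.1))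
  | .halt => goto fun _ => .inr false

/-- A statement of the second machine as one of the composite machine. -/
def liftRight : TM2.Stmt Γ₂ Λ₂ σ₂ →
    TM2.Stmt (CompAlphabet Γ₁ Γ₂ β) (CompLabel Λ₁ Λ₂) (CompVar σ₁ σ₂ β)
  | .push k f q => push (some (.inr k)) (fun v => f v.2.1) (liftRight q)
  | .peek k f q => peek (some (.inr k)) (fun v o => (v.1, f v.2.1 o, v.2.2)) (liftRight q)
  | .pop k f q => pop (some (.inr k)) (fun v o => (v.1, f v.2.1 o, v.2.2)) (liftRight q)
  | .load f q => load (fun v => (v.1, f v.2.1, v.2.2)) (liftRight q)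
  | .branch f q₁ q₂ => branch (fun v => f v.2.1) (liftRight q₁) (liftRight q₂)
  | .goto f => goto fun v => .inl (.inr (f v.2.1))
  | .halt => halt

/-- The program of a composite machine. -/
def compProg (M₁ : Λ₁ → TM2.Stmt Γ₁ Λ₁ σ₁) (M₂ : Λ₂ → TM2.Stmt Γ₂ Λ₂ σ₂) (k₁ : K₁) (k₂ : K₂)
    (e₁ : Γ₁ k₁ → β) (e₂ : β → Γ₂ k₂) (b : β) (main₂ : Λ₂) :
    CompLabel Λ₁ Λ₂ →
      TM2.Stmt (CompAlphabet Γ₁ Γ₂ β) (CompLabel Λ₁ Λ₂) (CompVar σ₁ σ₂ β)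
  | .inl (.inl l) => liftLeft (M₁ l)
  | .inl (.inr l) => liftRight (M₂ l)
  | .inr false => pop (some (.inl k₁)) (fun v o => (v.1, v.2.1, o.map e₁)) <|
      branch (fun v => v.2.2.isSome)
        (push none (fun v => v.2.2.getD b) <| goto fun _ => .inr false)
        (goto fun _ => .inr true)
  | .inr true => pop none (fun v o => (v.1, v.2.1, o)) <|
      branch (fun v => v.2.2.isSome)
        (push (some (.inr k₂)) (fun v => e₂ (v.2.2.getD b)) <| goto fun _ => .inr true)
        (goto fun _ => .inl (.inr main₂))

variable [DecidableEq K₁] [DecidableEq K₂]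

/-- The second machine's stacks and registers are inert here. The only change of control is that
halting becomes a jump into the transfer loop. -/
theorem stepAux_liftLeft (q : TM2.Stmt Γ₁ Λ₁ σ₁) (v : σ₁) (w : σ₂ × Option β)
    (S₁ : ∀ k, List (Γ₁ k)) (S₂ : ∀ k, List (Γ₂ k)) (T : List β) :
    TM2.stepAux (liftLeft q : TM2.Stmt (CompAlphabet Γ₁ Γ₂ β) (CompLabel Λ₁ Λ₂) _) (v, w)
        (compStk S₁ S₂ T) =
      ⟨some (match (TM2.stepAux q v S₁).l with
          | some l => .inl (.inl l)
          | none => .inr false),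
        ((TM2.stepAux q v S₁).var, w), compStk (TM2.stepAux q v S₁).stk S₂ T⟩ := by
  induction q generalizing v S₁ with
  | push k f q ih => simp only [liftLeft, TM2.stepAux, update_compStk_left]; exact ih _ _
  | peek k f q ih => simp only [liftLeft, TM2.stepAux]; exact ih _ _
  | pop k f q ih => simp only [liftLeft, TM2.stepAux, update_compStk_left]; exact ih _ _
  | load f q ih => simp only [liftLeft, TM2.stepAux]; exact ih _ _
  | branch f q₁ q₂ ih₁ ih₂ =>
    simp only [liftLeft, TM2.stepAux]
    cases f v
    · exact ih₂ _ _
    · exact ih₁ _ _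
  | goto f => rfl
  | halt => rfl

theorem stepAux_liftRight (q : TM2.Stmt Γ₂ Λ₂ σ₂) (u : σ₁) (v : σ₂) (w : Option β)
    (S₁ : ∀ k, List (Γ₁ k)) (S₂ : ∀ k, List (Γ₂ k)) (T : List β) :
    TM2.stepAux (liftRight q : TM2.Stmt (CompAlphabet Γ₁ Γ₂ β) (CompLabel Λ₁ Λ₂) _) (u, v, w)
        (compStk S₁ S₂ T) =
      ⟨(TM2.stepAux q v S₂).l.map fun l => .inl (.inr l),
        (u, (TM2.stepAux q v S₂).var, w), compStk S₁ (TM2.stepAux q v S₂).stk T⟩ := by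
  induction q generalizing v S₂ with
  | push k f q ih => simp only [liftRight, TM2.stepAux, update_compStk_right]; exact ih _ _
  | peek k f q ih => simp only [liftRight, TM2.stepAux]; exact ih _ _
  | pop k f q ih => simp only [liftRight, TM2.stepAux, update_compStk_right]; exact ih _ _
  | load f q ih => simp only [liftRight, TM2.stepAux]; exact ih _ _
  | branch f q₁ q₂ ih₁ ih₂ =>
    simp only [liftRight, TM2.stepAux]
    cases f v
    · exact ih₂ _ _
    · exact ih₁ _ _
  | goto f => rfl
  | halt => rfl

variable (M₁ : Λ₁ → TM2.Stmt Γ₁ Λ₁ σ₁) (M₂ : Λ₂ → TM2.Stmt Γ₂ Λ₂ σ₂) (k₁ : K₁) (k₂ : K₂)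
    (e₁ : Γ₁ k₁ → β) (e₂ : β → Γ₂ k₂) (b : β) (main₂ : Λ₂)

theorem stepsTo_compProg_left (S₂ : ∀ k, List (Γ₂ k)) (T : List β) (w : σ₂ × Option β)
    {n : ℕ} {c c' : TM2.Cfg Γ₁ Λ₁ σ₁} (h : StepsTo (TM2.step M₁) n c c') :
    StepsTo (TM2.step (compProg M₁ M₂ k₁ k₂ e₁ e₂ b main₂)) n
      ⟨some (match c.l with | some l => .inl (.inl l) | none => .inr false), (c.var, w),
        compStk c.stk S₂ T⟩
      ⟨some (match c'.l with | some l => .inl (.inl l) | none => .inr false), (c'.var, w),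
        compStk c'.stk S₂ T⟩ := by
  refine StepsTo.map (φ := fun c : TM2.Cfg Γ₁ Λ₁ σ₁ => (⟨some (match c.l with
    | some l => .inl (.inl l) | none => .inr false), (c.var, w), compStk c.stk S₂ T⟩ :
      TM2.Cfg (CompAlphabet Γ₁ Γ₂ β) (CompLabel Λ₁ Λ₂) (CompVar σ₁ σ₂ β))) ?_ h
  rintro ⟨l, v, S⟩ c' hc
  cases l with
  | none => simp at hc
  | some l =>
    simp only [TM2.step, Option.some.injEq] at hc
    subst hc
    simp only [TM2.step, compProg]
    rw [stepAux_liftLeft]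

theorem stepsTo_compProg_right (u : σ₁) (w : Option β) (S₁ : ∀ k, List (Γ₁ k)) (T : List β)
    {n : ℕ} {c c' : TM2.Cfg Γ₂ Λ₂ σ₂} (h : StepsTo (TM2.step M₂) n c c') :
    StepsTo (TM2.step (compProg M₁ M₂ k₁ k₂ e₁ e₂ b main₂)) n
      ⟨c.l.map fun l => .inl (.inr l), (u, c.var, w), compStk S₁ c.stk T⟩
      ⟨c'.l.map fun l => .inl (.inr l), (u, c'.var, w), compStk S₁ c'.stk T⟩ := by
  refine StepsTo.map (φ := fun c : TM2.Cfg Γ₂ Λ₂ σ₂ => (⟨c.l.map fun l => .inl (.inr l),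
    (u, c.var, w), compStk S₁ c.stk T⟩ :
      TM2.Cfg (CompAlphabet Γ₁ Γ₂ β) (CompLabel Λ₁ Λ₂) (CompVar σ₁ σ₂ β))) ?_ h
  rintro ⟨l, v, S⟩ c' hc
  cases l with
  | none => simp at hc
  | some l =>
    simp only [TM2.step, Option.some.injEq] at hc
    subst hc
    simp only [TM2.step, compProg, Option.map_some]
    rw [stepAux_liftRight]

/-- The output is reversed onto the additional stack; the loading loop reverses it again. The
default `b` in the program is never pushed, since the branch has tested for a symbol. -/
theorem stepsTo_compProg_unload (u : σ₁) (v : σ₂) (w : Option β) (S₁ : ∀ k, List (Γ₁ k))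
    (S₂ : ∀ k, List (Γ₂ k)) (T : List β) (L : List (Γ₁ k₁)) (hL : S₁ k₁ = L) :
    StepsTo (TM2.step (compProg M₁ M₂ k₁ k₂ e₁ e₂ b main₂)) (L.length + 1)
      ⟨some (.inr false), (u, v, w), compStk S₁ S₂ T⟩
      ⟨some (.inr true), (u, v, none),
        compStk (Function.update S₁ k₁ []) S₂ ((L.map e₁).reverse ++ T)⟩ := by
  induction L generalizing S₁ w T with
  | nil =>
    refine ⟨_, rfl, ?_⟩
    simp only [compProg, TM2.stepAux, update_compStk_left]
    simp only [compStk, hL]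
    rfl
  | cons a L ih =>
    refine ⟨_, rfl, ?_⟩
    simp only [compProg, TM2.stepAux, update_compStk_left]
    simp only [compStk, hL]
    have := ih (some (e₁ a)) (Function.update S₁ k₁ L) (e₁ a :: T) (by simp)
    simp only [Function.update_idem] at this
    simpa [update_compStk_none] using this

theorem stepsTo_compProg_load (u : σ₁) (v : σ₂) (w : Option β) (S₁ : ∀ k, List (Γ₁ k))
    (S₂ : ∀ k, List (Γ₂ k)) (T : List β) :
    StepsTo (TM2.step (compProg M₁ M₂ k₁ k₂ e₁ e₂ b main₂)) (T.length + 1)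
      ⟨some (.inr true), (u, v, w), compStk S₁ S₂ T⟩
      ⟨some (.inl (.inr main₂)), (u, v, none),
        compStk S₁ (Function.update S₂ k₂ ((T.map e₂).reverse ++ S₂ k₂)) []⟩ := by
  induction T generalizing S₂ w with
  | nil =>
    refine ⟨_, rfl, ?_⟩
    simp only [compProg, TM2.stepAux, update_compStk_none]
    simp [compStk, StepsTo]
  | cons a T ih =>
    refine ⟨_, rfl, ?_⟩
    simp only [compProg, TM2.stepAux, update_compStk_none]
    simp only [compStk]
    have := ih (some a) (Function.update S₂ k₂ (e₂ a :: S₂ k₂))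
    simp only [Function.update_idem] at this
    simpa [update_compStk_right] using this

end Comp

theorem initList_stk_self (tm : FinTM2) (s : List (tm.Γ tm.k₀)) :
    (initList tm s).stk tm.k₀ = s := by
  simp [initList]

theorem initList_stk_of_ne (tm : FinTM2) (s : List (tm.Γ tm.k₀)) {k : tm.K} (h : k ≠ tm.k₀) :
    (initList tm s).stk k = [] := by
  simp [initList, h]

theorem haltList_stk_self (tm : FinTM2) (s : List (tm.Γ tm.k₁)) :
    (haltList tm s).stk tm.k₁ = s := by
  simp [haltList]

theorem haltList_stk_of_ne (tm : FinTM2) (s : List (tm.Γ tm.k₁)) {k : tm.K} (h : k ≠ tm.k₁) :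
    (haltList tm s).stk k = [] := by
  simp [haltList, h]

theorem initList_eq (tm : FinTM2) (s : List (tm.Γ tm.k₀)) :
    initList tm s = ⟨some tm.main, tm.initialState, Function.update (fun _ => []) tm.k₀ s⟩ := by
  have : (initList tm s).stk = Function.update (fun _ => []) tm.k₀ s := by
    funext k
    by_cases h : k = tm.k₀
    · subst h; rw [initList_stk_self, Function.update_self]
    · rw [initList_stk_of_ne tm s h, Function.update_of_ne h]
  rw [← this]
  rfl

theorem haltList_eq (tm : FinTM2) (s : List (tm.Γ tm.k₁)) :
    haltList tm s = ⟨none, tm.initialState, Function.update (fun _ => []) tm.k₁ s⟩ := by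
  have : (haltList tm s).stk = Function.update (fun _ => []) tm.k₁ s := by
    funext k
    by_cases h : k = tm.k₁
    · subst h; rw [haltList_stk_self, Function.update_self]
    · rw [haltList_stk_of_ne tm s h, Function.update_of_ne h]
  rw [← this]
  rfl

/-- The composite of two machines, where the output alphabet of the first one and the input
alphabet of the second one are equivalent to a nonempty type. -/
noncomputable def compTM (tm₁ tm₂ : FinTM2) {β : Type} (e₁ : tm₁.Γ tm₁.k₁ ≃ β)
    (e₂ : tm₂.Γ tm₂.k₀ ≃ β) (b : β) : FinTM2 :=
  haveI := tm₁.kFin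
  haveI := tm₂.kFin
  haveI := tm₁.ΛFin
  haveI := tm₂.ΛFin
  haveI := tm₁.σFin
  haveI := tm₂.σFin
  haveI := tm₁.Γk₀Fin
  haveI := tm₂.Γk₀Fin
  haveI : Fintype β := Fintype.ofEquiv _ e₂
  { K := Option (tm₁.K ⊕ tm₂.K)
    k₀ := some (.inl tm₁.k₀)
    k₁ := some (.inr tm₂.k₁)
    Γ := CompAlphabet tm₁.Γ tm₂.Γ β
    Λ := CompLabel tm₁.Λ tm₂.Λ
    main := .inl (.inl tm₁.main)
    σ := CompVar tm₁.σ tm₂.σ β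
    initialState := (tm₁.initialState, tm₂.initialState, none)
    Γk₀Fin := tm₁.Γk₀Fin
    m := compProg tm₁.m tm₂.m tm₁.k₁ tm₂.k₀ e₁ e₂.symm b tm₂.main }

theorem stepsTo_compTM (tm₁ tm₂ : FinTM2) {β : Type} (e₁ : tm₁.Γ tm₁.k₁ ≃ β)
    (e₂ : tm₂.Γ tm₂.k₀ ≃ β) (b : β) {n₁ n₂ : ℕ} {x : List (tm₁.Γ tm₁.k₀)} {y : List β}
    {z : List (tm₂.Γ tm₂.k₁)}
    (h₁ : StepsTo tm₁.step n₁ (initList tm₁ x) (haltList tm₁ (y.map e₁.symm)))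
    (h₂ : StepsTo tm₂.step n₂ (initList tm₂ (y.map e₂.symm)) (haltList tm₂ z)) :
    StepsTo (compTM tm₁ tm₂ e₁ e₂ b).step
      (n₁ + (y.length + 1) + (y.length + 1) + n₂)
      (initList (compTM tm₁ tm₂ e₁ e₂ b) x) (haltList (compTM tm₁ tm₂ e₁ e₂ b) z) := by
  rw [initList_eq] at h₁ h₂
  rw [haltList_eq] at h₁ h₂
  have hempty : (fun _ => [] : ∀ k, List (CompAlphabet tm₁.Γ tm₂.Γ β k)) =
      compStk (fun _ => []) (fun _ => []) [] := by
    funext k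
    rcases k with _ | k | k <;> rfl
  have s₁ := stepsTo_compProg_left tm₁.m tm₂.m tm₁.k₁ tm₂.k₀ e₁ e₂.symm b tm₂.main
    (fun _ => []) [] (tm₂.initialState, none) h₁
  have s₂ := stepsTo_compProg_unload tm₁.m tm₂.m tm₁.k₁ tm₂.k₀ e₁ e₂.symm b tm₂.main
    tm₁.initialState tm₂.initialState none (Function.update (fun _ => []) tm₁.k₁ (y.map e₁.symm))
    (fun _ => []) [] (y.map e₁.symm) (by simp)
  have s₃ := stepsTo_compProg_load tm₁.m tm₂.m tm₁.k₁ tm₂.k₀ e₁ e₂.symm b tm₂.main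
    tm₁.initialState tm₂.initialState none (fun _ => []) (fun _ => []) y.reverse
  have s₄ := stepsTo_compProg_right tm₁.m tm₂.m tm₁.k₁ tm₂.k₀ e₁ e₂.symm b tm₂.main
    tm₁.initialState none (fun _ => []) [] h₂
  -- A halting machine leaves only its output stack nonempty, so after unloading all stacks of the
  -- first machine are empty, as the halting configuration of the composite requires.
  have hid : Function.update (fun _ => [] : ∀ k, List (tm₁.Γ k)) tm₁.k₁ [] = fun _ => [] := by
    simp
  have hmap : (y.map e₁.symm).map e₁ = y := by simp
  rw [Function.update_idem, hid, hmap, List.append_nil, List.length_map] at s₂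
  rw [List.length_reverse, List.map_reverse, List.reverse_reverse, List.append_nil] at s₃
  have s := ((s₁.trans s₂).trans s₃).trans s₄
  rw [← update_compStk_left, ← update_compStk_right, ← hempty] at s
  exact (congrArg₂ (StepsTo _ _) (initList_eq (compTM tm₁ tm₂ e₁ e₂ b) x)
    (haltList_eq (compTM tm₁ tm₂ e₁ e₂ b) z)).mpr s

theorem StepsTo.outputsInTime {tm : FinTM2} {n m : ℕ} {x : List (tm.Γ tm.k₀)}
    {y : List (tm.Γ tm.k₁)} (h : StepsTo tm.step n (initList tm x) (haltList tm y))
    (hn : n ≤ m) : Nonempty (TM2OutputsInTime tm x (some y) m) :=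
  ⟨⟨⟨n, stepsTo_iff.1 h⟩, hn⟩⟩

theorem TM2OutputsInTime.stepsTo {tm : FinTM2} {m : ℕ} {x : List (tm.Γ tm.k₀)}
    {y : List (tm.Γ tm.k₁)} (h : TM2OutputsInTime tm x (some y) m) :
    ∃ n ≤ m, StepsTo tm.step n (initList tm x) (haltList tm y) :=
  ⟨h.steps, h.steps_le_m, stepsTo_iff.2 h.evals_in_steps⟩

/-- This bounds the input of the second machine in a composite, so that its running time is a
polynomial of a polynomial. -/
theorem exists_length_le (tm : FinTM2) :
    ∃ d : ℕ, ∀ n x y, StepsTo tm.step n (initList tm x) (haltList tm y) →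
      y.length ≤ x.length + n * d := by
  have := tm.ΛFin
  obtain ⟨d, hd⟩ := exists_growth tm.m
  refine ⟨d, fun n x y h => ?_⟩
  have := hd n _ _ tm.k₁ h
  rw [haltList_stk_self] at this
  refine this.trans (Nat.add_le_add_right ?_ _)
  rw [initList_eq]
  by_cases hk : tm.k₁ = tm.k₀
  · rw [hk]; simp
  · simp [Function.update_of_ne hk]

/-- Functions computable in polynomial time are closed under composition. -/
theorem TM2ComputableInPolyTime.nonempty_comp {A B C ΓA ΓB ΓC : Type} [Nonempty ΓB]
    {eA : A → List ΓA} {eB : B → List ΓB} {eC : C → List ΓC} {f : A → B} {g : B → C}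
    (h₁ : TM2ComputableInPolyTime eA eB f) (h₂ : TM2ComputableInPolyTime eB eC g) :
    Nonempty (TM2ComputableInPolyTime eA eC (g ∘ f)) := by
  obtain ⟨d, hd⟩ := exists_length_le h₁.tm
  -- `Q` bounds the length of the intermediate string.
  let Q : Polynomial ℕ := Polynomial.X + h₁.time * Polynomial.C d
  have key : ∀ a, Nonempty (TM2OutputsInTime
      (compTM h₁.tm h₂.tm h₁.outputAlphabet h₂.inputAlphabet (Classical.arbitrary ΓB))
      ((eA a).map h₁.inputAlphabet.invFun) (some ((eC (g (f a))).map h₂.outputAlphabet.invFun))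
      ((h₁.time + (Q + 1) + (Q + 1) + h₂.time.comp Q).eval (eA a).length)) := by
    intro a
    obtain ⟨n₁, hn₁, s₁⟩ := (h₁.outputsFun a).stepsTo
    obtain ⟨n₂, hn₂, s₂⟩ := (h₂.outputsFun (f a)).stepsTo
    have hlen : (eB (f a)).length ≤ Q.eval (eA a).length := by
      have := hd _ _ _ s₁
      simp only [List.length_map] at this
      refine this.trans ?_
      simp only [Q, Polynomial.eval_add, Polynomial.eval_X, Polynomial.eval_mul,
        Polynomial.eval_C]
      gcongr
    refine (stepsTo_compTM h₁.tm h₂.tm h₁.outputAlphabet h₂.inputAlphabet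
      (Classical.arbitrary ΓB) s₁ s₂).outputsInTime ?_
    simp only [Polynomial.eval_add, Polynomial.eval_one, Polynomial.eval_comp]
    have := hn₂.trans (h₂.time.eval_nat_mono hlen)
    gcongr
  exact ⟨{ tm := compTM h₁.tm h₂.tm h₁.outputAlphabet h₂.inputAlphabet (Classical.arbitrary ΓB)
           inputAlphabet := h₁.inputAlphabet
           outputAlphabet := h₂.outputAlphabet
           time := _
           outputsFun := fun a => (key a).some }⟩

end Turing

theorem DecisionProblem.PolyReducible.trans {P Q R : DecisionProblem} [Nonempty Q.Alphabet]
    (h₁ : P.PolyReducible Q) (h₂ : Q.PolyReducible R) : P.PolyReducible R := by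
  obtain ⟨f, ⟨hf⟩, hf'⟩ := h₁
  obtain ⟨g, ⟨hg⟩, hg'⟩ := h₂
  exact ⟨g ∘ f, hf.nonempty_comp hg, fun x => (hf' x).trans (hg' _)⟩

/-! ### Structured programs on stacks -/

namespace StackProgram

open Turing

/-- Structured programs that work on stacks with a common alphabet. -/
inductive Cmd (K Γ : Type) : Type
  /-- Do nothing. -/
  | skip
  /-- Push a symbol. -/
  | push (k : K) (c : Γ)
  /-- Run two programs one after the other. -/
  | seq (p q : Cmd K Γ)
  /-- Pop a symbol, and branch on it. -/
  | case (k : K) (p : Option Γ → Cmd K Γ)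
  /-- Pop a symbol; end if it fails the test, else run the program for it and start again. -/
  | loop (k : K) (go : Option Γ → Bool) (p : Option Γ → Cmd K Γ)

namespace Cmd

variable {K Γ : Type} [DecidableEq K]

/-- Big-step semantics, with the running time. -/
inductive Exec : Cmd K Γ → (K → List Γ) → (K → List Γ) → ℕ → Prop
  | skip (s) : Exec skip s s 1
  | push (k c s) : Exec (push k c) s (Function.update s k (c :: s k)) 1
  | seq {p q s s' s'' m n} (h₁ : Exec p s s' m) (h₂ : Exec q s' s'' n) :
      Exec (seq p q) s s'' (m + n)
  | case {k p s s' n} (h : Exec (p (s k).head?) (Function.update s k (s k).tail) s' n) :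
      Exec (case k p) s s' (n + 1)
  | loop_end {k go p s} (h : go (s k).head? = false) :
      Exec (loop k go p) s (Function.update s k (s k).tail) 1
  | loop_go {k go p s s' s'' m n} (h : go (s k).head? = true)
      (h₁ : Exec (p (s k).head?) (Function.update s k (s k).tail) s' m)
      (h₂ : Exec (loop k go p) s' s'' n) : Exec (loop k go p) s s'' (m + n + 1)


/-- The control points of a program. -/
def Label : Cmd K Γ → Type
  | .skip => Unit
  | .push _ _ => Unit
  | .seq p q => Label p ⊕ Label q
  | .case _ p => Option (Σ o, Label (p o))
  | .loop _ _ p => Option (Σ o, Label (p o))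

instance finite_label [Finite Γ] (p : Cmd K Γ) : Finite (Label p) := by
  induction p with
  | skip => exact inferInstanceAs (Finite Unit)
  | push k c => exact inferInstanceAs (Finite Unit)
  | seq p q ihp ihq => exact inferInstanceAs (Finite (_ ⊕ _))
  | case k p ih => exact inferInstanceAs (Finite (Option (Σ o, Label (p o))))
  | loop k go p ih => exact inferInstanceAs (Finite (Option (Σ o, Label (p o))))

/-- The control point where a program starts. -/
def entry : (p : Cmd K Γ) → Label p
  | .skip => ()
  | .push _ _ => ()
  | .seq p _ => Sum.inl (entry p)
  | .case _ _ => (none : Option _)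
  | .loop _ _ _ => (none : Option _)

/-- The translation of a program into statements of a stack machine with labels in `Λ`. -/
def code {Λ : Type} : (p : Cmd K Γ) → (Label p → Λ) → Λ → Label p →
    TM2.Stmt (fun _ : K => Γ) Λ (Option Γ)
  | .skip, _, exit, _ => .goto fun _ => exit
  | .push k c, _, exit, _ => .push k (fun _ => c) (.goto fun _ => exit)
  | .seq p q, emb, _, .inl l => code p (fun l => emb (.inl l)) (emb (.inr (entry q))) l
  | .seq _ q, emb, exit, .inr l => code q (fun l => emb (.inr l)) exit l
  | .case k p, emb, _, none =>
    .pop k (fun _ o => o) (.goto fun o => emb (some ⟨o, entry (p o)⟩))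
  | .case _ p, emb, exit, some ⟨o, l⟩ => code (p o) (fun l => emb (some ⟨o, l⟩)) exit l
  | .loop k go p, emb, exit, none =>
    .pop k (fun _ o => o) (.branch go (.goto fun o => emb (some ⟨o, entry (p o)⟩))
      (.goto fun _ => exit))
  | .loop _ _ p, emb, _, some ⟨o, l⟩ => code (p o) (fun l => emb (some ⟨o, l⟩)) (emb none) l

/-- Compilation is exact: each unit of cost in `Exec` is one machine step. The exit of one piece of
code is the entry of the next, and the exit of a loop body is the head of the loop. The initial
register `v` is arbitrary because it is read only right after a pop. -/
theorem Exec.stepsTo {p : Cmd K Γ} {s s' : K → List Γ} {n : ℕ} (h : Exec p s s' n) {Λ : Type}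
    (M : Λ → TM2.Stmt (fun _ : K => Γ) Λ (Option Γ)) (emb : Label p → Λ) (exit : Λ)
    (hM : ∀ l, M (emb l) = code p emb exit l) (v : Option Γ) :
    ∃ v', StepsTo (TM2.step M) n ⟨some (emb (entry p)), v, s⟩ ⟨some exit, v', s'⟩ := by
  induction h generalizing exit v with
  | skip s => exact ⟨v, _, congrArg (fun q => some (TM2.stepAux q v s)) (hM _), rfl⟩
  | push k c s => exact ⟨v, _, congrArg (fun q => some (TM2.stepAux q v s)) (hM _), rfl⟩
  | seq h₁ h₂ ih₁ ih₂ =>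
    obtain ⟨v₁, s₁⟩ := ih₁ (fun l => emb (.inl l)) _ (fun l => hM (.inl l)) v
    obtain ⟨v₂, s₂⟩ := ih₂ (fun l => emb (.inr l)) exit (fun l => hM (.inr l)) v₁
    exact ⟨v₂, s₁.trans s₂⟩
  | @case k p s s' n h ih =>
    obtain ⟨v', h'⟩ := ih (fun l => emb (some ⟨_, l⟩)) exit (fun l => hM (some ⟨_, l⟩)) (s k).head?
    exact ⟨v', _, congrArg (fun q => some (TM2.stepAux q v s)) (hM none), h'⟩
  | @loop_end k go p s h =>
    refine ⟨(s k).head?, _, congrArg (fun q => some (TM2.stepAux q v s)) (hM none), ?_⟩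
    simp [code, h, StepsTo]
  | @loop_go k go p s s' s'' m n h h₁ h₂ ih₁ ih₂ =>
    obtain ⟨v₁, s₁⟩ := ih₁ (fun l => emb (some ⟨_, l⟩)) (emb none)
      (fun l => hM (some ⟨_, l⟩)) (s k).head?
    obtain ⟨v₂, s₂⟩ := ih₂ emb exit hM v₁
    refine ⟨v₂, _, congrArg (fun q => some (TM2.stepAux q v s)) (hM none), ?_⟩
    simp only [code, TM2.stepAux, h, cond_true]
    exact s₁.trans s₂

/-- The machine that runs a program, with input and output on one stack. -/
noncomputable def toTM [Fintype K] [Fintype Γ] (k : K) (p : Cmd K Γ) : FinTM2 :=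
  haveI : Fintype (Label p) := Fintype.ofFinite _
  { K := K
    k₀ := k
    k₁ := k
    Γ := fun _ => Γ
    Λ := Option (Label p)
    main := some (entry p)
    σ := Option Γ
    initialState := none
    Γk₀Fin := inferInstance
    m := fun l => match l with
      | some l => code p some none l
      | none => .load (fun _ => none) .halt }

/-- The additional step resets the register and halts. -/
theorem Exec.stepsTo_toTM [Fintype K] [Fintype Γ] {k : K} {p : Cmd K Γ} {x y : List Γ} {n : ℕ}
    (h : Exec p (Function.update (fun _ => []) k x) (Function.update (fun _ => []) k y) n) :
    StepsTo (toTM k p).step (n + 1) (initList (toTM k p) x) (haltList (toTM k p) y) := by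
  obtain ⟨v, hv⟩ := h.stepsTo (toTM k p).m some none (fun _ => rfl) none
  have : StepsTo (toTM k p).step 1 ⟨some none, v, Function.update (fun _ => []) k y⟩
      ⟨none, none, Function.update (fun _ => []) k y⟩ := ⟨_, rfl, rfl⟩
  exact (congrArg₂ (StepsTo _ _) (initList_eq (toTM k p) x) (haltList_eq (toTM k p) y)).mpr
    (hv.trans this)

/-- A unit of time pushes at most one symbol, so time bounds also bound output sizes. -/
theorem Exec.length_le {p : Cmd K Γ} {s s' : K → List Γ} {n : ℕ} (h : Exec p s s' n) (k : K) :
    (s' k).length ≤ (s k).length + n := by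
  have tail_le : ∀ (s : K → List Γ) (k₀ : K),
      (Function.update s k₀ (s k₀).tail k).length ≤ (s k).length := by
    intro s k₀
    by_cases h : k = k₀
    · subst h; simp
    · simp [Function.update_of_ne h]
  induction h with
  | skip s => exact Nat.le_add_right _ _
  | push k₀ c s =>
    by_cases h : k = k₀
    · subst h; simp
    · simp [Function.update_of_ne h]
  | seq _ _ ih₁ ih₂ => omega
  | @case k₀ _ s _ _ _ ih => have := tail_le s k₀; omega
  | @loop_end k₀ _ _ s _ => have := tail_le s k₀; omega
  | @loop_go k₀ _ _ s _ _ _ _ _ _ _ ih₁ ih₂ => have := tail_le s k₀; omega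

end Cmd

end StackProgram

namespace StackProgram

open Turing

/-! ### Trees as data -/

/-- Binary trees, the data of the programs. -/
inductive Data : Type
  | nil
  | cons (a b : Data)

namespace Data

/-- The prefix code of a tree, as a string on a stack. -/
def code : Data → List (Option Bool)
  | nil => [some false]
  | cons a b => some true :: (code a ++ code b)

/-- The code is prefix-free, so a value can be recognized on top of a stack with anything below it.
-/
theorem code_append_injective {d e : Data} {r s : List (Option Bool)}
    (h : d.code ++ r = e.code ++ s) : d = e ∧ r = s := by
  induction d generalizing e r s with
  | nil => cases e <;> simp_all [code]
  | cons a b iha ihb =>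
    cases e with
    | nil => simp [code] at h
    | cons a' b' =>
      simp only [code, List.cons_append, List.append_assoc, List.cons.injEq, true_and] at h
      obtain ⟨h₁, h⟩ := iha h
      obtain ⟨h₂, h⟩ := ihb h
      exact ⟨by rw [h₁, h₂], h⟩

theorem code_injective : Function.Injective code := fun d e h =>
  (code_append_injective (r := []) (s := []) (by rw [h])).1

end Data

/-- Types whose elements are represented by trees. -/
class Code (α : Type) where
  enc : α → Data
  enc_injective : Function.Injective enc

/-- The string that represents an element. -/
abbrev code {α : Type} [Code α] (a : α) : List (Option Bool) := (Code.enc a).code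

/-- The length of the representation of an element. -/
def size {α : Type} [Code α] (a : α) : ℕ := (code a).length

/-! ### Representations of basic types and their sizes. -/

section Instances

variable {α β : Type} [Code α] [Code β]

instance : Code Unit := ⟨fun _ => .nil, fun _ _ _ => rfl⟩

instance : Code Bool where
  enc b := bif b then .cons .nil .nil else .nil
  enc_injective := by rintro (_ | _) (_ | _) <;> simp

instance : Code (α × β) where
  enc x := .cons (Code.enc x.1) (Code.enc x.2)
  enc_injective := by
    rintro ⟨a, b⟩ ⟨a', b'⟩ h
    simp only [Data.cons.injEq] at h
    rw [Code.enc_injective h.1, Code.enc_injective h.2]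

/-- The representation of a list. -/
def encList : List α → Data
  | [] => .nil
  | a :: l => .cons (Code.enc a) (encList l)

theorem encList_injective : Function.Injective (encList : List α → Data) := by
  intro l
  induction l with
  | nil => rintro (_ | ⟨b, m⟩) h <;> simp_all [encList]
  | cons a l ih =>
    rintro (_ | ⟨b, m⟩) h
    · simp [encList] at h
    · simp only [encList, Data.cons.injEq] at h
      rw [Code.enc_injective h.1, ih h.2]

instance : Code (List α) := ⟨encList, encList_injective⟩

/-- Unary: a number is a list of units, so that list programs serve as arithmetic and loops over
lists as loops over numbers. -/
instance : Code ℕ where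
  enc n := encList (List.replicate n ())
  enc_injective m n h := by simpa using congrArg List.length (encList_injective h)

instance : Code (Option α) where
  enc o := encList o.toList
  enc_injective := by
    rintro (_ | a) (_ | b) h
    · rfl
    · simp [encList] at h
    · simp [encList] at h
    · simpa using encList_injective h

theorem code_prod (x : α × β) : code x = some true :: (code x.1 ++ code x.2) := rfl

theorem code_nil : code ([] : List α) = [some false] := rfl

theorem code_cons (a : α) (l : List α) : code (a :: l) = some true :: (code a ++ code l) := rfl

theorem size_prod (x : α × β) : size x = size x.1 + size x.2 + 1 := by
  simp [size, code_prod]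

theorem size_mk (a : α) (b : β) : size (a, b) = size a + size b + 1 := size_prod _

theorem size_nil : size ([] : List α) = 1 := rfl

theorem size_cons (a : α) (l : List α) : size (a :: l) = size a + size l + 1 := by
  simp [size, code_cons]

theorem size_pos (a : α) : 0 < size a := by
  unfold size code
  cases Code.enc a <;> simp [Data.code]

theorem size_bool_le (b : Bool) : size b ≤ 3 := by
  cases b <;> decide

theorem size_nat (n : ℕ) : size n = 2 * n + 1 := by
  induction n with
  | zero => rfl
  | succ n ih =>
    have : size (n + 1) = size () + size n + 1 := size_cons () (List.replicate n ())
    rw [this, ih]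
    have : size () = 1 := rfl
    omega

theorem length_le_size (l : List α) : l.length ≤ size l := by
  induction l with
  | nil => simp
  | cons a l ih => rw [size_cons, List.length_cons]; omega

theorem size_le_of_mem {a : α} {l : List α} (h : a ∈ l) : size a ≤ size l := by
  induction l with
  | nil => simp at h
  | cons b l ih =>
    rw [size_cons]
    rcases List.mem_cons.1 h with rfl | h
    · omega
    · have := ih h; omega

theorem size_append (l m : List α) : size (l ++ m) + 1 = size l + size m := by
  induction l with
  | nil => simp [size_nil]; omega
  | cons a l ih => simp only [List.cons_append, size_cons]; omega

end Instances

/-! ### Basic programs -/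

open Cmd

/-- Programs on four stacks. -/
abbrev Prog : Type := Cmd (Fin 4) (Option Bool)

/-- `p` leads from the stack contents `s` to `s'` in at most `n` steps. -/
def Runs (p : Prog) (s s' : Fin 4 → List (Option Bool)) (n : ℕ) : Prop := ∃ m ≤ n, Exec p s s' m

namespace Runs

variable {p q : Prog} {s s' s'' : Fin 4 → List (Option Bool)} {m n : ℕ}

theorem mono (h : Runs p s s' m) (hmn : m ≤ n) : Runs p s s' n :=
  let ⟨t, ht, h⟩ := h
  ⟨t, ht.trans hmn, h⟩

theorem seq (h₁ : Runs p s s' m) (h₂ : Runs q s' s'' n) : Runs (seq p q) s s'' (m + n) :=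
  let ⟨_, ht₁, h₁⟩ := h₁
  let ⟨_, ht₂, h₂⟩ := h₂
  ⟨_, add_le_add ht₁ ht₂, .seq h₁ h₂⟩

theorem case {k : Fin 4} {p : Option (Option Bool) → Prog}
    (h : Runs (p (s k).head?) (Function.update s k (s k).tail) s' n) :
    Runs (Cmd.case k p) s s' (n + 1) :=
  let ⟨_, ht, h⟩ := h
  ⟨_, Nat.succ_le_succ ht, .case h⟩

theorem loop_end {k : Fin 4} {go : Option (Option Bool) → Bool} {p : Option (Option Bool) → Prog}
    (h : go (s k).head? = false) :
    Runs (loop k go p) s (Function.update s k (s k).tail) 1 :=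
  ⟨1, le_rfl, .loop_end h⟩

theorem loop_go {k : Fin 4} {go : Option (Option Bool) → Bool} {p : Option (Option Bool) → Prog}
    (h : go (s k).head? = true)
    (h₁ : Runs (p (s k).head?) (Function.update s k (s k).tail) s' m)
    (h₂ : Runs (loop k go p) s' s'' n) : Runs (loop k go p) s s'' (m + n + 1) :=
  let ⟨_, ht₁, h₁⟩ := h₁
  let ⟨_, ht₂, h₂⟩ := h₂
  ⟨_, by omega, .loop_go h h₁ h₂⟩

theorem push (k : Fin 4) (c : Option Bool) :
    Runs (Cmd.push k c) s (Function.update s k (c :: s k)) 1 :=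
  ⟨1, le_rfl, .push k c s⟩

theorem skip : Runs Cmd.skip s s 1 := ⟨1, le_rfl, .skip s⟩

end Runs

/-- The two stacks for values: the main one, and the other one. -/
def valueStack (X : Bool) : Fin 4 := bif X then 1 else 0

/-- Contents `x` of the value stack `X`, `y` of the other value stack, and `a` and `b` of the two
scratch stacks. -/
def mem (X : Bool) (x y a b : List (Option Bool)) : Fin 4 → List (Option Bool) :=
  bif X then ![y, x, a, b] else ![x, y, a, b]

section Mem

variable (X : Bool) (x y a b z : List (Option Bool))

theorem mem_not : mem (!X) x y a b = mem X y x a b := by cases X <;> rfl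

@[simp] theorem mem_self : mem X x y a b (valueStack X) = x := by cases X <;> rfl
@[simp] theorem mem_other : mem X x y a b (valueStack !X) = y := by cases X <;> rfl
@[simp] theorem mem_two : mem X x y a b 2 = a := by cases X <;> rfl
@[simp] theorem mem_three : mem X x y a b 3 = b := by cases X <;> rfl

@[simp] theorem update_mem_self :
    Function.update (mem X x y a b) (valueStack X) z = mem X z y a b := by
  cases X <;> funext k <;> fin_cases k <;> rfl

@[simp] theorem update_mem_other :
    Function.update (mem X x y a b) (valueStack !X) z = mem X x z a b := by
  cases X <;> funext k <;> fin_cases k <;> rfl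

@[simp] theorem update_mem_two : Function.update (mem X x y a b) 2 z = mem X x y z b := by
  cases X <;> funext k <;> fin_cases k <;> rfl

@[simp] theorem update_mem_three : Function.update (mem X x y a b) 3 z = mem X x y a z := by
  cases X <;> funext k <;> fin_cases k <;> rfl

@[simp] theorem mem_false_zero : mem false x y a b 0 = x := rfl

@[simp] theorem update_mem_false_zero :
    Function.update (mem false x y a b) 0 z = mem false z y a b :=
  update_mem_self false x y a b z

@[simp] theorem mem_false_one : mem false x y a b 1 = y := rfl

@[simp] theorem update_mem_false_one :
    Function.update (mem false x y a b) 1 z = mem false x z a b :=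
  update_mem_other false x y a b z

end Mem

/-- The loop of `take`. -/
def takeLoop (X : Bool) : Prog :=
  loop 3 Option.isSome fun _ => case (valueStack X) fun o =>
    match o with
    | some (some true) => seq (push 2 (some true)) (seq (push 3 none) (push 3 none))
    | o => push 2 o.join

/-- Move the reversed code of the top value of the value stack `X` to the first scratch stack. -/
def take (X : Bool) : Prog := seq (push 3 none) (takeLoop X)

/-- The second scratch stack counts the subtrees still to be read: an inner node replaces one token
by two, a leaf uses one up. Stating the claim with an arbitrary continuation `h` lets the induction
chain the two subtrees. A node costs `5` steps, a leaf `3`. -/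
theorem runs_takeLoop (X : Bool) (d : Data) (x y a b : List (Option Bool)) (n : ℕ)
    (s : Fin 4 → List (Option Bool))
    (h : Runs (takeLoop X) (mem X x y (d.code.reverse ++ a) b) s n) :
    Runs (takeLoop X) (mem X (d.code ++ x) y a (none :: b)) s (5 * d.code.length + n) := by
  induction d generalizing x a b n with
  | nil =>
    refine (Runs.loop_go (by simp) (Runs.case ?_) h).mono (m := 1 + 1 + n + 1)
      (by simp [Data.code])
    simpa [Data.code] using Runs.push (s := mem X x y a b) 2 (some false)
  | cons d e ihd ihe =>
    have h' := ihd (e.code ++ x) (some true :: a) (none :: b) _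
      (ihe x (d.code.reverse ++ some true :: a) b n (by simpa [Data.code] using h))
    refine (Runs.loop_go (by simp) (Runs.case ?_) h').mono
      (m := 3 + 1 + (5 * d.code.length + (5 * e.code.length + n)) + 1)
      (by simp [Data.code]; omega)
    simp only [mem_three, List.tail_cons, update_mem_three, Data.code, List.cons_append, mem_self,
      List.head?_cons, update_mem_self, List.append_assoc]
    have h₁ := Runs.push (s := mem X (d.code ++ (e.code ++ x)) y a b) 2 (some true)
    have h₂ := Runs.push (s := mem X (d.code ++ (e.code ++ x)) y (some true :: a) b) 3 none
    have h₃ := Runs.push (s := mem X (d.code ++ (e.code ++ x)) y (some true :: a) (none :: b)) 3 none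
    simp only [mem_two, mem_three, update_mem_two, update_mem_three] at h₁ h₂ h₃
    exact h₁.seq (h₂.seq h₃)

theorem runs_take (X : Bool) (d : Data) (x y : List (Option Bool)) :
    Runs (take X) (mem X (d.code ++ x) y [] []) (mem X x y d.code.reverse [])
      (5 * d.code.length + 2) := by
  have h₀ := Runs.push (s := mem X (d.code ++ x) y [] []) 3 none
  simp only [mem_three, update_mem_three] at h₀
  have h₁ := Runs.loop_end (s := mem X x y d.code.reverse []) (k := 3) (go := Option.isSome)
    (p := fun _ => case (valueStack X) fun o => match o with
      | some (some true) => seq (push 2 (some true)) (seq (push 3 none) (push 3 none))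
      | o => push 2 o.join) (by simp)
  simp only [mem_three, List.tail_nil, update_mem_three] at h₁
  exact (h₀.seq (runs_takeLoop X d x y [] [] 1 _ (by simpa using! h₁))).mono (by omega)

/-- Empty the first scratch stack onto the value stack `X`. -/
def untake (X : Bool) : Prog := loop 2 Option.isSome fun o => push (valueStack X) o.join

/-- Emptying the scratch stack reverses once more and so restores the code. -/
theorem runs_untake (X : Bool) (x y a b : List (Option Bool)) :
    Runs (untake X) (mem X x y a b) (mem X (a.reverse ++ x) y [] b) (2 * a.length + 1) := by
  induction a generalizing x with
  | nil =>
    simpa using! Runs.loop_end (s := mem X x y [] b) (k := 2) (go := Option.isSome)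
      (p := fun o => push (valueStack X) o.join) (by simp)
  | cons c a ih =>
    refine (Runs.loop_go (by simp) (s' := mem X (c :: x) y a b) (m := 1) ?_
      (by simpa using! ih (c :: x))).mono (by simp; omega)
    simpa using Runs.push (s := mem X x y a b) (valueStack X) c

/-- Move the top value of the value stack `X` to the other one. -/
def move (X : Bool) : Prog := seq (take X) (untake !X)

theorem runs_move (X : Bool) (d : Data) (x y : List (Option Bool)) :
    Runs (move X) (mem X (d.code ++ x) y [] []) (mem X x (d.code ++ y) [] [])
      (7 * d.code.length + 3) := by
  have h := runs_untake (!X) y x d.code.reverse []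
  rw [mem_not, mem_not, List.reverse_reverse, List.length_reverse] at h
  exact ((runs_take X d x y).seq h).mono (by omega)

/-- Empty the first scratch stack onto both value stacks. -/
def untakeBoth : Prog :=
  loop 2 Option.isSome fun o => seq (push 0 o.join) (push 1 o.join)

theorem runs_untakeBoth (x y a b : List (Option Bool)) :
    Runs untakeBoth (mem false x y a b) (mem false (a.reverse ++ x) (a.reverse ++ y) [] b)
      (3 * a.length + 1) := by
  induction a generalizing x y with
  | nil =>
    simpa using! Runs.loop_end (s := mem false x y [] b) (k := 2) (go := Option.isSome)
      (p := fun o => seq (push 0 o.join) (push 1 o.join)) (by simp)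
  | cons c a ih =>
    refine (Runs.loop_go (by simp) (s' := mem false (c :: x) (c :: y) a b) (m := 2) ?_
      (by simpa using! ih (c :: x) (c :: y))).mono (by simp; omega)
    have h₁ := Runs.push (s := mem false x y a b) (valueStack false) c
    have h₂ := Runs.push (s := mem false (c :: x) y a b) (valueStack !false) c
    simp only [mem_self, mem_other, update_mem_self, update_mem_other] at h₁ h₂
    simpa using! h₁.seq h₂

/-- Copy the top value of the main stack to the other value stack. -/
def copy : Prog := seq (take false) untakeBoth

theorem runs_copy (d : Data) (x y : List (Option Bool)) :
    Runs copy (mem false (d.code ++ x) y [] []) (mem false (d.code ++ x) (d.code ++ y) [] [])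
      (8 * d.code.length + 3) := by
  have h := runs_untakeBoth x y d.code.reverse []
  rw [List.reverse_reverse, List.length_reverse] at h
  exact ((runs_take false d x y).seq h).mono (by omega)

/-- Delete the top value of the main stack. -/
def drop : Prog := seq (take false) (loop 2 Option.isSome fun _ => skip)

theorem runs_drop (d : Data) (x y : List (Option Bool)) :
    Runs drop (mem false (d.code ++ x) y [] []) (mem false x y [] []) (7 * d.code.length + 3) := by
  have h : ∀ a, Runs (loop 2 Option.isSome fun _ => skip) (mem false x y a [])
      (mem false x y [] []) (2 * a.length + 1) := by
    intro a
    induction a with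
    | nil =>
      simpa using! Runs.loop_end (s := mem false x y [] []) (k := 2) (go := Option.isSome)
        (p := fun _ => skip) (by simp)
    | cons c a ih =>
      refine (Runs.loop_go (by simp) (s' := mem false x y a []) (m := 1) ?_
        (by simpa using! ih)).mono (by simp; omega)
      simpa using Runs.skip
  exact ((runs_take false d x y).seq (h _)).mono (by simp; omega)

/-- Push a value to the main stack. -/
def pushData : Data → Prog
  | .nil => push 0 (some false)
  | .cons a b => seq (pushData b) (seq (pushData a) (push 0 (some true)))

theorem runs_push_main (c : Option Bool) (x y a b : List (Option Bool)) :
    Runs (push 0 c) (mem false x y a b) (mem false (c :: x) y a b) 1 := by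
  simpa using! Runs.push (s := mem false x y a b) (valueStack false) c

theorem runs_case_main {p : Option (Option Bool) → Prog} {c : Option Bool}
    {x y a b : List (Option Bool)} {s : Fin 4 → List (Option Bool)} {n : ℕ}
    (h : Runs (p (some c)) (mem false x y a b) s n) :
    Runs (case 0 p) (mem false (c :: x) y a b) s (n + 1) :=
  Runs.case (by
    have : (0 : Fin 4) = valueStack false := rfl
    rw [this]
    simpa using h)

theorem runs_pushData (d : Data) (x y a b : List (Option Bool)) :
    Runs (pushData d) (mem false x y a b) (mem false (d.code ++ x) y a b) d.code.length := by
  induction d generalizing x with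
  | nil => exact runs_push_main _ _ _ _ _
  | cons d e ihd ihe =>
    have := ((ihe x).seq ((ihd _).seq (runs_push_main (some true) _ _ _ _)))
    refine (by simpa [Data.code] using! this : Runs _ _ _ _).mono (by simp [Data.code]; omega)
  
end StackProgram

namespace StackProgram

open Turing Cmd

variable {α β γ δ τ : Type} [Code α] [Code β] [Code γ] [Code δ] [Code τ]

/-! ### Functions on data that are computable in polynomial time -/

/-- Computability in polynomial time by a program that replaces the value on top of the main
stack, whatever else is on the value stacks. -/
def PTime (f : α → β) : Prop :=
  ∃ (p : Prog) (P : Polynomial ℕ), ∀ a x y,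
    Runs p (mem false (code a ++ x) y [] []) (mem false (code (f a) ++ x) y [] [])
      (P.eval (size a))

namespace PTime

/-- The output cannot exceed the input by more than the running time. -/
theorem size_le {f : α → β} (hf : PTime f) : ∃ P : Polynomial ℕ, ∀ a, size (f a) ≤ P.eval (size a) := by
  obtain ⟨p, P, h⟩ := hf
  refine ⟨.X + P, fun a => ?_⟩
  obtain ⟨t, ht, h⟩ := h a [] []
  have := h.length_le 0
  have e : ∀ u : List (Option Bool), mem false u [] [] [] 0 = u := fun _ => rfl
  simp only [e, List.append_nil] at this
  rw [Polynomial.eval_add, Polynomial.eval_X]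
  exact this.trans (Nat.add_le_add_left ht _)

/-- Two functions with the same representations are computed by the same program. -/
theorem of_enc {f : α → β} (hf : PTime f) {γ δ : Type} [Code γ] [Code δ] {g : γ → δ}
    (e : γ → α) (he : ∀ c, Code.enc (e c) = Code.enc c)
    (h : ∀ c, Code.enc (g c) = Code.enc (f (e c))) : PTime g := by
  obtain ⟨p, P, hp⟩ := hf
  refine ⟨p, P, fun c x y => ?_⟩
  have := hp (e c) x y
  simp only [size, code, he] at this
  simpa only [size, code, h] using this

theorem id : PTime (fun a : α => a) :=
  ⟨skip, 1, fun a x y => Runs.skip.mono (by simp)⟩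

/-- A function that does not change the representation. -/
theorem recode {g : α → β} (h : ∀ a, Code.enc (g a) = Code.enc a) : PTime g :=
  (PTime.id (α := α)).of_enc (fun a => a) (fun _ => rfl) h

theorem comp {g : β → γ} {f : α → β} (hg : PTime g) (hf : PTime f) : PTime fun a => g (f a) := by
  obtain ⟨R, hR⟩ := hf.size_le
  obtain ⟨p, P, hp⟩ := hf
  obtain ⟨q, Q, hq⟩ := hg
  refine ⟨seq p q, P + Q.comp R, fun a x y => ((hp a x y).seq (hq (f a) x y)).mono ?_⟩
  rw [Polynomial.eval_add, Polynomial.eval_comp]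
  exact Nat.add_le_add_left (Q.eval_nat_mono (hR a)) _

theorem const (b : β) : PTime fun _ : α => b := by
  refine ⟨seq drop (pushData (Code.enc b)), 7 * .X + 3 + .C (code b).length, fun a x y => ?_⟩
  refine ((runs_drop (Code.enc a) x y).seq (runs_pushData (Code.enc b) x y [] [])).mono ?_
  simp [size, code]

/-- The argument is saved on the second stack while `g` is computed, then brought back for `f`. With
`g` computed first, the two results lie in the order of the code of a pair, and only the node symbol
is missing. -/
theorem pair {f : α → β} {g : α → γ} (hf : PTime f) (hg : PTime g) :
    PTime fun a => (f a, g a) := by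
  obtain ⟨R, hR⟩ := hg.size_le
  obtain ⟨p, P, hp⟩ := hf
  obtain ⟨q, Q, hq⟩ := hg
  refine ⟨seq copy (seq q (seq (move true) (seq p (push 0 (some true))))),
    8 * .X + 3 + (Q + (7 * .X + 3 + (P + 1))), fun a x y => ?_⟩
  have h₁ := runs_copy (Code.enc a) x y
  have h₂ := hq a x (code a ++ y)
  have h₃ := runs_move true (Code.enc a) y (code (g a) ++ x)
  -- Reading `true` as `!false` restates the move from the second stack with the main stack listed
  -- first.
  rw [← Bool.not_false, mem_not, mem_not] at h₃
  have h₄ := hp a (code (g a) ++ x) y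
  have h₅ := runs_push_main (some true) (code (f a) ++ (code (g a) ++ x)) y [] []
  have := h₁.seq (h₂.seq (h₃.seq (h₄.seq h₅)))
  rw [code_prod, List.cons_append, List.append_assoc]
  refine this.mono ?_
  simp [size, code]

theorem fst' : PTime (Prod.fst : α × β → α) := by
  refine ⟨case 0 fun _ => seq (move false) (seq drop (move true)), 21 * .X + 10,
    fun a x y => ?_⟩
  rw [code_prod, List.cons_append, List.append_assoc]
  have h₁ := runs_move false (Code.enc a.1) (code a.2 ++ x) y
  have h₂ := runs_drop (Code.enc a.2) x (code a.1 ++ y)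
  have h₃ := runs_move true (Code.enc a.1) y x
  rw [← Bool.not_false, mem_not, mem_not] at h₃
  refine (runs_case_main (h₁.seq (h₂.seq h₃))).mono ?_
  rw [size_prod]
  simp [size, code]
  omega

theorem snd' : PTime (Prod.snd : α × β → β) := by
  refine ⟨case 0 fun _ => drop, 7 * .X + 10, fun a x y => ?_⟩
  rw [code_prod, List.cons_append, List.append_assoc]
  refine (runs_case_main (runs_drop (Code.enc a.1) (code a.2 ++ x) y)).mono ?_
  rw [size_prod]
  simp [size, code]
  omega

theorem fst {f : α → β × γ} (hf : PTime f) : PTime fun a => (f a).1 := fst'.comp hf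

theorem snd {f : α → β × γ} (hf : PTime f) : PTime fun a => (f a).2 := snd'.comp hf

theorem comp₂ {g : β × γ → δ} {f₁ : α → β} {f₂ : α → γ} (hg : PTime g) (h₁ : PTime f₁)
    (h₂ : PTime f₂) : PTime fun a => g (f₁ a, f₂ a) := hg.comp (h₁.pair h₂)

theorem cond {c : α → Bool} {f g : α → β} (hc : PTime c) (hf : PTime f) (hg : PTime g) :
    PTime fun a => bif c a then f a else g a := by
  obtain ⟨r, R, hr⟩ := hc.pair PTime.id
  obtain ⟨p, P, hp⟩ := hf
  obtain ⟨q, Q, hq⟩ := hg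
  -- The first pop removes the node symbol of the pair `(c a, a)`, the second reads the Boolean. The
  -- code of `false` is one symbol, that of `true` has three, so two more are popped in that case.
  refine ⟨seq r (case 0 fun _ => case 0 fun o => match o with
    | some (some true) => case 0 fun _ => case 0 fun _ => p
    | _ => q), R + (P + Q + 4), fun a x y => ?_⟩
  refine ((hr a x y).seq (n := P.eval (size a) + Q.eval (size a) + 4) ?_).mono (by simp)
  rw [code_prod, List.cons_append, List.append_assoc]
  change Runs _ (mem false (some true :: (code (c a) ++ (code a ++ x))) y [] [])
    (mem false (code (bif c a then f a else g a) ++ x) y [] []) _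
  cases hca : c a
  · refine (runs_case_main (n := Q.eval (size a) + 1) (runs_case_main ?_)).mono (by omega)
    simpa using hq a x y
  · refine (runs_case_main (n := P.eval (size a) + 3) (runs_case_main
      (x := some false :: some false :: (code a ++ x)) (n := P.eval (size a) + 2)
      (runs_case_main (n := P.eval (size a) + 1) (runs_case_main ?_)))).mono (by omega)
    simpa using hp a x y

theorem ite {c : α → Prop} [DecidablePred c] {f g : α → β} (hc : PTime fun a => decide (c a))
    (hf : PTime f) (hg : PTime g) : PTime fun a => if c a then f a else g a := by
  have := hc.cond hf hg
  simpa only [Bool.cond_decide] using this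

theorem and {c d : α → Bool} (hc : PTime c) (hd : PTime d) : PTime fun a => c a && d a := by
  have := hc.cond hd (const false)
  refine this.of_enc (fun a => a) (fun _ => rfl) fun a => ?_
  cases c a <;> rfl

theorem or {c d : α → Bool} (hc : PTime c) (hd : PTime d) : PTime fun a => c a || d a := by
  have := hc.cond (const true) hd
  refine this.of_enc (fun a => a) (fun _ => rfl) fun a => ?_
  cases c a <;> rfl

theorem not {c : α → Bool} (hc : PTime c) : PTime fun a => !c a := by
  have := hc.cond (const false) (const true)
  refine this.of_enc (fun a => a) (fun _ => rfl) fun a => ?_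
  cases c a <;> rfl

theorem beqBool {c d : α → Bool} (hc : PTime c) (hd : PTime d) : PTime fun a => c a == d a := by
  have := hc.cond hd hd.not
  refine this.of_enc (fun a => a) (fun _ => rfl) fun a => ?_
  cases c a <;> cases d a <;> rfl

/-! ### Lists -/

theorem cons {f : α → β} {l : α → List β} (hf : PTime f) (hl : PTime l) :
    PTime fun a => f a :: l a :=
  (hf.pair hl).of_enc (fun a => a) (fun _ => rfl) fun _ => rfl

theorem tail {l : α → List β} (hl : PTime l) : PTime fun a => (l a).tail := by
  have : PTime (List.tail : List β → List β) := by
    refine ⟨case 0 fun o => match o with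
      | some (some true) => drop
      | _ => push 0 (some false), 7 * .X + 10, fun l x y => ?_⟩
    cases l with
    | nil =>
      refine (runs_case_main (n := 1) ?_).mono (by simp)
      exact runs_push_main _ _ _ _ _
    | cons b l =>
      rw [code_cons, List.cons_append, List.append_assoc]
      refine (runs_case_main (runs_drop (Code.enc b) (code l ++ x) y)).mono ?_
      rw [size_cons]
      simp [size, code]
      omega
  exact this.comp hl

theorem isEmpty {l : α → List β} (hl : PTime l) : PTime fun a => (l a).isEmpty := by
  have : PTime (List.isEmpty : List β → Bool) := by
    refine ⟨case 0 fun o => match o with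
      | some (some true) => seq drop (seq drop (push 0 (some false)))
      | _ => pushData (Code.enc true), 14 * .X + 10, fun l x y => ?_⟩
    cases l with
    | nil =>
      refine (runs_case_main (n := 3) ?_).mono (by simp)
      exact runs_pushData (Code.enc true) x y [] []
    | cons b l =>
      rw [code_cons, List.cons_append, List.append_assoc]
      refine (runs_case_main ((runs_drop (Code.enc b) (code l ++ x) y).seq
        ((runs_drop (Code.enc l) x y).seq (runs_push_main _ _ _ _ _)))).mono ?_
      rw [size_cons]
      simp [size, code]
      omega
  exact this.comp hl

theorem headD {l : α → List β} {d : α → β} (hl : PTime l) (hd : PTime d) :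
    PTime fun a => (l a).headD (d a) := by
  have : PTime fun u : List β × β => u.1.headD u.2 := by
    refine ⟨case 0 fun _ => case 0 fun o => match o with
      | some (some true) => seq (move false) (seq drop (seq drop (move true)))
      | _ => skip, 28 * .X + 20, fun u x y => ?_⟩
    obtain ⟨l, d⟩ := u
    rw [code_prod, List.cons_append, List.append_assoc]
    cases l with
    | nil =>
      exact (runs_case_main (n := 2) (runs_case_main (n := 1) Runs.skip)).mono (by simp)
    | cons b l =>
      simp only [code_cons, List.cons_append, List.append_assoc]
      have h₁ := runs_move false (Code.enc b) (code l ++ (code d ++ x)) y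
      have h₂ := runs_drop (Code.enc l) (code d ++ x) (code b ++ y)
      have h₃ := runs_drop (Code.enc d) x (code b ++ y)
      have h₄ := runs_move true (Code.enc b) y x
      rw [← Bool.not_false, mem_not, mem_not] at h₄
      refine (runs_case_main (runs_case_main (h₁.seq (h₂.seq (h₃.seq h₄))))).mono ?_
      rw [size_prod, size_cons]
      simp [size, code]
      omega
  exact this.comp₂ hl hd

/-- The loop that folds a program over the list on top of the second value stack. -/
def foldLoop (p : Prog) : Prog :=
  loop 1 (· = some (some true)) fun _ => seq (move true) (seq (push 0 (some true)) p)

/-- Per element: `7 * n + 3` for moving it to the main stack, `1` for the pair symbol, `1` for the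
loop, and the program on a pair of size at most `n + n + 1`. The bound `n` must hold for the
accumulators of all prefixes. -/
theorem runs_foldLoop {step : β × τ → τ} {p : Prog} {P : Polynomial ℕ}
    (hp : ∀ a x y, Runs p (mem false (code a ++ x) y [] [])
      (mem false (code (step a) ++ x) y [] []) (P.eval (size a))) (n : ℕ) (l : List β) (t : τ)
    (hl : ∀ b ∈ l, size b ≤ n)
    (ht : ∀ l', l' <+: l → size (l'.foldl (fun t b => step (b, t)) t) ≤ n)
    (x y : List (Option Bool)) :
    Runs (foldLoop p) (mem false (code t ++ x) (code l ++ y) [] [])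
      (mem false (code (l.foldl (fun t b => step (b, t)) t) ++ x) y [] [])
      (l.length * (7 * n + 5 + P.eval (n + n + 1)) + 1) := by
  induction l generalizing t with
  | nil =>
    have := Runs.loop_end (s := mem false (code t ++ x) (code ([] : List β) ++ y) [] [])
      (k := 1) (go := (· = some (some true)))
      (p := fun _ => seq (move true) (seq (push 0 (some true)) p)) (by simp [code_nil])
    simpa [code_nil] using! this
  | cons b l ih =>
    have h₁ := runs_move true (Code.enc b) (code l ++ y) (code t ++ x)
    rw [← Bool.not_false, mem_not, mem_not] at h₁
    have h₂ := runs_push_main (some true) (code b ++ (code t ++ x)) (code l ++ y) [] []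
    have h₃ := hp (b, t) x (code l ++ y)
    rw [code_prod, List.cons_append, List.append_assoc] at h₃
    have h₄ := ih (step (b, t)) (fun c hc => hl c (by simp [hc])) (fun l' hl' => by
      have := ht (b :: l') (by simpa using hl')
      simpa using this)
    refine (Runs.loop_go (k := 1) (by simp [code_cons])
      (by simpa [code_cons] using h₁.seq (h₂.seq h₃)) h₄).mono ?_
    have hb : size b ≤ n := hl b (by simp)
    have ht₀ : size t ≤ n := by simpa using ht [] (by simp)
    have hP : P.eval (size (b, t)) ≤ P.eval (n + n + 1) :=
      P.eval_nat_mono (by rw [size_mk]; omega)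
    have hb' : (Code.enc b).code.length ≤ n := hb
    have hm := Nat.succ_mul l.length (7 * n + 5 + P.eval (n + n + 1))
    rw [Nat.succ_eq_add_one] at hm
    rw [List.length_cons, hm]
    omega

/-- Folds over lists, as long as the intermediate results are of polynomial size. -/
theorem foldl {l : α → List β} {i : α → τ} {step : α × τ × β → τ} (hl : PTime l) (hi : PTime i)
    (hs : PTime step) (Q : Polynomial ℕ)
    (hQ : ∀ a l', l' <+: l a →
      size (l'.foldl (fun t b => step (a, t, b)) (i a)) ≤ Q.eval (size a)) :
    PTime fun a => (l a).foldl (fun t b => step (a, t, b)) (i a) := by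
  obtain ⟨r, R, hr⟩ := hl.pair (PTime.id.pair hi)
  obtain ⟨S, hS⟩ := hl.size_le
  -- The parameter `a` is carried along in the accumulator, where the step function can use it, and
  -- is discarded at the end.
  have hstep : PTime fun u : β × α × τ => (u.2.1, step (u.2.1, u.2.2, u.1)) :=
    PTime.id.snd.fst.pair (hs.comp (PTime.id.snd.fst.pair (PTime.id.snd.snd.pair PTime.id.fst)))
  obtain ⟨p, P, hp⟩ := hstep
  have key : ∀ (a : α) (l : List β) (t : τ),
      l.foldl (fun (t : α × τ) b => (t.1, step (t.1, t.2, b))) (a, t) =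
        (a, l.foldl (fun t b => step (a, t, b)) t) := by
    intro a l
    induction l with
    | nil => simp
    | cons b l ih => intro t; simp [ih]
  let N : Polynomial ℕ := S + .X + Q + 1
  have main : PTime fun a => (a, (l a).foldl (fun t b => step (a, t, b)) (i a)) := by
    refine ⟨seq r (case 0 fun _ => seq (move false) (foldLoop p)),
      R + (7 * S + 3 + (S * (7 * N + 5 + P.comp (N + N + 1)) + 1) + 1), fun a x y => ?_⟩
    have h₁ := hr a x y
    have h₂ := runs_move false (Code.enc (l a)) (code (a, i a) ++ x) y
    have h₃ := runs_foldLoop hp (N.eval (size a)) (l a) (a, i a)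
      (fun b hb => (size_le_of_mem hb).trans ((hS a).trans (by simp [N]; omega)))
      (fun l' hl' => by
        rw [key, size_mk]
        have := hQ a l' hl'
        simp [N]; omega) x y
    rw [key] at h₃
    rw [code_prod (l a, a, i a), List.cons_append, List.append_assoc] at h₁
    refine (h₁.seq (runs_case_main (h₂.seq h₃))).mono ?_
    have h₅ : (Code.enc (l a)).code.length ≤ S.eval (size a) := hS a
    have h₆ := (length_le_size (l a)).trans (hS a)
    simp only [Polynomial.eval_add, Polynomial.eval_mul, Polynomial.eval_comp,
      Polynomial.eval_ofNat, Polynomial.eval_one]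
    gcongr
  exact main.snd

/-- If each step adds an amount that is polynomial in the parameter and the list element, but does
not depend on the accumulator, growth is additive and stays polynomial. -/
theorem foldl_of_size_le {l : α → List β} {i : α → τ} {step : α × τ × β → τ} (hl : PTime l)
    (hi : PTime i) (hs : PTime step) (Q : Polynomial ℕ)
    (hQ : ∀ a t b, b ∈ l a → size (step (a, t, b)) ≤ size t + Q.eval (size a + size b)) :
    PTime fun a => (l a).foldl (fun t b => step (a, t, b)) (i a) := by
  obtain ⟨S, hS⟩ := hl.size_le
  obtain ⟨I, hI⟩ := hi.size_le
  refine foldl hl hi hs (I + S * Q.comp (.X + S)) fun a l' hl' => ?_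
  have key : ∀ (l' : List β) (t : τ), (∀ b ∈ l', b ∈ l a) →
      size (l'.foldl (fun t b => step (a, t, b)) t) ≤
        size t + l'.length * Q.eval (size a + S.eval (size a)) := by
    intro l'
    induction l' with
    | nil => simp
    | cons b l' ih =>
      intro t hb
      have h₁ := ih (step (a, t, b)) fun c hc => hb c (by simp [hc])
      have h₂ := hQ a t b (hb b (by simp))
      have h₃ := Q.eval_nat_mono (Nat.add_le_add_left
        ((size_le_of_mem (hb b (by simp))).trans (hS a)) (size a))
      rw [List.length_cons, Nat.succ_mul, List.foldl_cons]
      omega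
  refine (key l' (i a) fun b hb => hl'.subset hb).trans ?_
  have h₁ : l'.length ≤ S.eval (size a) :=
    hl'.length_le.trans ((length_le_size _).trans (hS a))
  simp only [Polynomial.eval_add, Polynomial.eval_mul, Polynomial.eval_comp, Polynomial.eval_X]
  have := hI a
  gcongr

end PTime

end StackProgram

namespace StackProgram

open Turing Cmd

variable {α β γ δ τ : Type} [Code α] [Code β] [Code γ] [Code δ] [Code τ]

theorem size_tail_le (l : List α) : size l.tail ≤ size l := by
  cases l with
  | nil => exact le_rfl
  | cons a l => rw [List.tail_cons, size_cons]; omega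

theorem size_le_of_forall {l : List α} {n : ℕ} (h : ∀ a ∈ l, size a ≤ n) :
    size l ≤ l.length * (n + 1) + 1 := by
  induction l with
  | nil => simp [size_nil]
  | cons a l ih =>
    have h₁ := h a (by simp)
    have h₂ := ih fun b hb => h b (by simp [hb])
    have h₃ := Nat.succ_mul l.length (n + 1)
    rw [Nat.succ_eq_add_one] at h₃
    rw [size_cons, List.length_cons, h₃]
    omega

namespace PTime

/-! ### Operations on lists -/

theorem reverse {l : α → List β} (hl : PTime l) : PTime fun a => (l a).reverse := by
  have : PTime fun a => (l a).foldl (fun t b => b :: t) [] :=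
    hl.foldl_of_size_le (step := fun u : α × List β × β => u.2.2 :: u.2.1) (const [])
      (PTime.id.snd.snd.cons PTime.id.snd.fst) (.X + 1) fun a t b _ => by
        simp [size_cons]; omega
  simpa using this

theorem append {l m : α → List β} (hl : PTime l) (hm : PTime m) : PTime fun a => l a ++ m a := by
  have : PTime fun a => (l a).reverse.foldl (fun t b => b :: t) (m a) :=
    hl.reverse.foldl_of_size_le (step := fun u : α × List β × β => u.2.2 :: u.2.1) hm
      (PTime.id.snd.snd.cons PTime.id.snd.fst) (.X + 1) fun a t b _ => by
        simp [size_cons]; omega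
  simpa using this

theorem map {l : α → List β} {g : α × β → γ} (hl : PTime l) (hg : PTime g) :
    PTime fun a => (l a).map fun b => g (a, b) := by
  obtain ⟨G, hG⟩ := hg.size_le
  have : PTime fun a => (l a).foldl (fun t b => g (a, b) :: t) [] :=
    hl.foldl_of_size_le (step := fun u : α × List γ × β => g (u.1, u.2.2) :: u.2.1) (const [])
      ((hg.comp (PTime.id.fst.pair PTime.id.snd.snd)).cons PTime.id.snd.fst)
      (G.comp (.X + 1) + 1) fun a t b _ => by
        have := hG (a, b)
        rw [size_mk] at this
        simp [size_cons, Polynomial.eval_comp]; omega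
  have h : ∀ a (l : List β) t, l.foldl (fun t b => g (a, b) :: t) t =
      (l.map fun b => g (a, b)).reverse ++ t := by
    intro a l
    induction l with
    | nil => simp
    | cons b l ih => intro t; simp [ih]
  simp only [h, List.append_nil] at this
  simpa using this.reverse

theorem flatten {l : α → List (List β)} (hl : PTime l) : PTime fun a => (l a).flatten := by
  have : PTime fun a => (l a).foldl (fun t b => t ++ b) [] :=
    hl.foldl_of_size_le (step := fun u : α × List β × List β => u.2.1 ++ u.2.2) (const [])
      (PTime.id.snd.fst.append PTime.id.snd.snd) .X fun a t b _ => by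
        have := size_append t b
        simp; omega
  have h : ∀ (l : List (List β)) t, l.foldl (fun t b => t ++ b) t = t ++ l.flatten := by
    intro l
    induction l with
    | nil => simp
    | cons b l ih => intro t; simp [ih]
  simpa only [h, List.nil_append] using this

theorem flatMap {l : α → List β} {g : α × β → List γ} (hl : PTime l) (hg : PTime g) :
    PTime fun a => (l a).flatMap fun b => g (a, b) := by
  simpa only [List.flatMap] using (hl.map hg).flatten

theorem singleton {f : α → β} (hf : PTime f) : PTime fun a => [f a] := hf.cons (const [])

theorem some {f : α → β} (hf : PTime f) : PTime fun a => Option.some (f a) :=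
  hf.singleton.of_enc (fun a => a) (fun _ => rfl) fun _ => rfl

theorem toList {f : α → Option β} (hf : PTime f) : PTime fun a => (f a).toList :=
  hf.of_enc (fun a => a) (fun _ => rfl) fun _ => rfl

/-! ### Natural numbers -/

theorem units {n : α → ℕ} (hn : PTime n) : PTime fun a => List.replicate (n a) () :=
  hn.of_enc (fun a => a) (fun _ => rfl) fun _ => rfl

theorem succ {n : α → ℕ} (hn : PTime n) : PTime fun a => n a + 1 :=
  ((const ()).cons hn.units).of_enc (fun a => a) (fun _ => rfl)
    fun _ => rfl

theorem add {m n : α → ℕ} (hm : PTime m) (hn : PTime n) : PTime fun a => m a + n a :=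
  (hm.units.append hn.units).of_enc (fun a => a) (fun _ => rfl) fun a => by
    rw [List.replicate_append_replicate]; rfl

theorem length {l : α → List β} (hl : PTime l) : PTime fun a => (l a).length :=
  (hl.map (const ())).of_enc (fun a => a) (fun _ => rfl) fun a => by
    rw [List.map_const']; rfl

theorem drop {n : α → ℕ} {l : α → List β} (hn : PTime n) (hl : PTime l) :
    PTime fun a => (l a).drop (n a) := by
  have : PTime fun a => (List.replicate (n a) ()).foldl (fun t _ => t.tail) (l a) :=
    hn.units.foldl_of_size_le (step := fun u : α × List β × Unit => u.2.1.tail) hl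
      PTime.id.snd.fst.tail 0 fun a t b _ => by simpa using size_tail_le t
  have h : ∀ n (l : List β), (List.replicate n ()).foldl (fun t _ => t.tail) l = l.drop n := by
    intro n
    induction n with
    | zero => simp
    | succ n ih => intro l; simp [List.replicate_succ, ih]
  simpa only [h] using this

theorem getD {l : α → List β} {n : α → ℕ} {d : α → β} (hl : PTime l) (hn : PTime n)
    (hd : PTime d) : PTime fun a => (l a).getD (n a) (d a) := by
  have := (hn.drop hl).headD hd
  refine this.of_enc (fun a => a) (fun _ => rfl) fun a => ?_
  rw [List.headD_eq_head?_getD, List.head?_drop, List.getD_eq_getElem?_getD]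

theorem range {n : α → ℕ} (hn : PTime n) : PTime fun a => List.range (n a) := by
  -- The length of the list built so far is the next number to prepend. The increment depends on the
  -- accumulator, so the size of the intermediate results is bounded directly.
  have h : ∀ l : List Unit, l.foldl (fun (t : List ℕ) _ => t.length :: t) [] =
      (List.range l.length).reverse := by
    intro l
    induction l using List.reverseRecOn with
    | nil => rfl
    | append_singleton l _ ih => simp [List.foldl_append, ih, List.range_succ]
  obtain ⟨S, hS⟩ := hn.size_le
  have : PTime fun a => (List.replicate (n a) ()).foldl (fun (t : List ℕ) _ => t.length :: t) [] :=
    hn.units.foldl (step := fun u : α × List ℕ × Unit => u.2.1.length :: u.2.1) (const [])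
      (PTime.id.snd.fst.length.cons PTime.id.snd.fst) (S * (S + 1) + 1) fun a l' hl' => by
        have hl := hl'.length_le
        have hS := hS a
        rw [size_nat] at hS
        rw [List.length_replicate] at hl
        rw [h]
        refine (size_le_of_forall (n := S.eval (size a)) fun b hb => ?_).trans ?_
        · have : b < l'.length := by simpa using hb
          rw [size_nat]; omega
        · simp only [List.length_reverse, List.length_range, Polynomial.eval_add,
            Polynomial.eval_mul, Polynomial.eval_one]
          gcongr
          omega
  simp only [h, List.length_replicate] at this
  simpa using this.reverse

/-! ### Equality -/

/-- The code of a tree, as a list. -/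
def quote (d : Data) : List Bool := d.code.map (·.getD false)

theorem map_some_quote (d : Data) : (quote d).map Option.some = d.code := by
  induction d with
  | nil => rfl
  | cons a b iha ihb =>
    simp only [quote] at iha ihb ⊢
    simp only [Data.code, List.map_cons, List.map_append, iha, ihb]
    rfl

theorem quote_injective : Function.Injective quote := by
  intro d e h
  exact Data.code_injective (by rw [← map_some_quote d, ← map_some_quote e, h])

/-- Taking a value off the stack reverses its code; prepending the symbols one by one to a list
restores the order. A code as a list makes generic equality tests possible. -/
theorem quote_enc {f : α → β} (hf : PTime f) : PTime fun a => quote (Code.enc (f a)) := by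
  have h : ∀ (d l : List Bool) x y,
      Runs (loop 2 Option.isSome fun o =>
          seq (pushData (Code.enc (o.join.getD false))) (push 0 (Option.some true)))
        (mem false (code l ++ x) y (d.map Option.some) [])
        (mem false (code (d.reverse ++ l) ++ x) y [] []) (5 * d.length + 1) := by
    intro d
    induction d with
    | nil =>
      intro l x y
      simpa using Runs.loop_end (s := mem false (code l ++ x) y [] []) (k := 2)
        (go := Option.isSome) (by simp)
    | cons b d ih =>
      intro l x y
      have h₁ := runs_pushData (Code.enc b) (code l ++ x) y (d.map Option.some) []
      have h₂ := runs_push_main (Option.some true) (code b ++ (code l ++ x)) y (d.map Option.some) []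
      have h₃ : (Code.enc b).code.length ≤ 3 := size_bool_le b
      have h₄ := ih (b :: l) x y
      rw [code_cons, List.cons_append, List.append_assoc] at h₄
      rw [List.reverse_cons, List.append_assoc, List.singleton_append]
      refine (Runs.loop_go (s := mem false (code l ++ x) y ((b :: d).map Option.some) []) (by simp)
        (by simpa using h₁.seq h₂) h₄).mono (by rw [List.length_cons]; omega)
  refine PTime.comp (g := fun b : β => quote (Code.enc b)) ?_ hf
  refine ⟨seq (take false) (seq (push 0 (Option.some false)) (loop 2 Option.isSome fun o =>
    seq (pushData (Code.enc (o.join.getD false))) (push 0 (Option.some true)))), 10 * .X + 4,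
    fun b x y => ?_⟩
  have h₁ := runs_take false (Code.enc b) x y
  have h₂ := runs_push_main (Option.some false) x y (code b).reverse []
  have h₃ := h (quote (Code.enc b)).reverse [] x y
  rw [List.map_reverse, map_some_quote, List.reverse_reverse, List.append_nil] at h₃
  refine (h₁.seq (h₂.seq h₃)).mono ?_
  simp [size, quote, code]
  omega

theorem eqListBool {l m : α → List Bool} (hl : PTime l) (hm : PTime m) :
    PTime fun a => decide (l a = m a) := by
  -- The state is the unmatched rest of the second list and whether all comparisons succeeded. The
  -- lists agree iff the flag survives and the rest is empty.
  let step : List Bool × Bool → Bool → List Bool × Bool := fun t b =>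
    (t.1.tail, t.2 && (!t.1.isEmpty && (t.1.headD false == b)))
  have h : ∀ (l m : List Bool) ok, ((l.foldl step (m, ok)).2 && (l.foldl step (m, ok)).1.isEmpty) =
      (ok && decide (l = m)) := by
    intro l
    induction l with
    | nil => intro m ok; cases m <;> simp
    | cons b l ih =>
      intro m ok
      rw [List.foldl_cons, ih]
      cases m with
      | nil => simp
      | cons c m => cases b <;> cases c <;> cases ok <;> simp <;> congr!
  have : PTime fun a => (l a).foldl step (m a, true) := by
    refine hl.foldl_of_size_le (step := fun u : α × (List Bool × Bool) × Bool => step u.2.1 u.2.2)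
      (hm.pair (const true)) ?_ 3 fun a t b _ => ?_
    · exact PTime.id.snd.fst.fst.tail.pair (PTime.id.snd.fst.snd.and
        (PTime.id.snd.fst.fst.isEmpty.not.and
          ((PTime.id.snd.fst.fst.headD (const false)).beqBool PTime.id.snd.snd)))
    · have h₁ := size_tail_le t.1
      have h₂ := size_bool_le (step t b).2
      have h₃ := size_prod t
      have h₄ := size_prod (step t b)
      have h₅ : (step t b).1 = t.1.tail := rfl
      rw [h₅] at h₄
      simp
      omega
  simpa [h] using this.snd.and this.fst.isEmpty

/-- Representations are injective, so values are equal iff their codes are. -/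
theorem eq [DecidableEq β] {f g : α → β} (hf : PTime f) (hg : PTime g) :
    PTime fun a => decide (f a = g a) := by
  refine (hf.quote_enc.eqListBool hg.quote_enc).of_enc (fun a => a) (fun _ => rfl) fun a => ?_
  have : quote (Code.enc (f a)) = quote (Code.enc (g a)) ↔ f a = g a :=
    ⟨fun h => Code.enc_injective (quote_injective h), fun h => by rw [h]⟩
  simp only [this]

/-! ### Division with remainder -/

/-- One step of counting up the quotient and the remainder of the division by `m`. -/
def divModStep (m : ℕ) (t : ℕ × ℕ) : ℕ × ℕ := if t.2 + 1 = m then (t.1 + 1, 0) else (t.1, t.2 + 1)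

/-- Also right for `m = 0`: the remainder is never reset, which gives quotient `0` and remainder
`n`. -/
theorem foldl_divModStep (m n : ℕ) :
    (List.replicate n ()).foldl (fun t _ => divModStep m t) (0, 0) = (n / m, n % m) := by
  induction n with
  | zero => simp
  | succ n ih =>
    rw [List.replicate_succ', List.foldl_append, ih]
    simp only [List.foldl_cons, List.foldl_nil, divModStep]
    rcases Nat.eq_zero_or_pos m with rfl | hm
    · simp
    have h₁ := Nat.mod_add_div n m
    have h₂ := Nat.mod_lt n hm
    split_ifs with h
    · obtain ⟨h₃, h₄⟩ := (Nat.div_mod_unique (a := n + 1) (c := 0) (d := n / m + 1) hm).2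
        ⟨by rw [Nat.mul_succ]; omega, hm⟩
      rw [h₃, h₄]
    · obtain ⟨h₃, h₄⟩ := (Nat.div_mod_unique (a := n + 1) (c := n % m + 1) (d := n / m) hm).2
        ⟨by omega, by omega⟩
      rw [h₃, h₄]

theorem divMod {m n : α → ℕ} (hn : PTime n) (hm : PTime m) :
    PTime fun a => (n a / m a, n a % m a) := by
  have : PTime fun a => (List.replicate (n a) ()).foldl (fun t _ => divModStep (m a) t) (0, 0) := by
    refine hn.units.foldl_of_size_le (step := fun u : α × (ℕ × ℕ) × Unit => divModStep (m u.1) u.2.1)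
      (const (0, 0)) ?_ 2 fun a t b _ => ?_
    · exact PTime.ite (PTime.id.snd.fst.snd.succ.eq (hm.comp PTime.id.fst))
        (PTime.id.snd.fst.fst.succ.pair (const 0)) (PTime.id.snd.fst.fst.pair PTime.id.snd.fst.snd.succ)
    · simp only [divModStep, size_prod t]
      split_ifs <;> simp only [size_mk, size_nat] <;> simp <;> omega
  simpa only [foldl_divModStep] using this

theorem mod {m n : α → ℕ} (hn : PTime n) (hm : PTime m) : PTime fun a => n a % m a :=
  (hn.divMod hm).snd

theorem div {m n : α → ℕ} (hn : PTime n) (hm : PTime m) : PTime fun a => n a / m a :=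
  (hn.divMod hm).fst

/-! ### From strings to trees and back -/

/-- Replace the string on the main stack by its representation as a list of symbols. -/
def load : Prog :=
  seq (loop 0 Option.isSome fun o => push 2 o.join) <|
    seq (push 0 (Option.some false)) <| loop 2 Option.isSome fun o =>
      seq (pushData (Code.enc o.join)) (push 0 (Option.some true))

theorem runs_load (w : List (Option Bool)) :
    Runs load (mem false w [] [] []) (mem false (code w) [] [] []) (20 * w.length + 5) := by
  have h₁ : ∀ w a, Runs (loop 0 Option.isSome fun o => push 2 o.join) (mem false w [] a [])
      (mem false [] [] (w.reverse ++ a) []) (2 * w.length + 1) := by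
    intro w
    induction w with
    | nil =>
      intro a
      simpa using Runs.loop_end (s := mem false [] [] a []) (k := 0)
        (go := Option.isSome) (p := fun o => push 2 o.join) (by simp)
    | cons c w ih =>
      intro a
      refine (Runs.loop_go (by simp) (s' := mem false w [] (c :: a) []) (m := 1) ?_
        (by simpa using ih (c :: a))).mono (by rw [List.length_cons]; omega)
      simpa using Runs.push (s := mem false w [] a []) 2 c
  have h₂ : ∀ w v : List (Option Bool), Runs (loop 2 Option.isSome fun o =>
        seq (pushData (Code.enc o.join)) (push 0 (Option.some true)))
      (mem false (code v) [] w []) (mem false (code (w.reverse ++ v)) [] [] [])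
      (10 * w.length + 1) := by
    intro w
    induction w with
    | nil =>
      intro v
      simpa using Runs.loop_end (s := mem false (code v) [] [] []) (k := 2)
        (go := Option.isSome) (by simp)
    | cons c w ih =>
      intro v
      have h₁ := runs_pushData (Code.enc c) (code v) [] w []
      have h₂ := runs_push_main (Option.some true) (code c ++ code v) [] w []
      have h₃ : (Code.enc c).code.length ≤ 5 := by rcases c with _ | _ | _ <;> decide
      have h₄ := ih (c :: v)
      rw [code_cons] at h₄
      rw [List.reverse_cons, List.append_assoc, List.singleton_append]
      refine (Runs.loop_go (s := mem false (code v) [] (c :: w) []) (by simp)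
        (by simpa using h₁.seq h₂) h₄).mono (by rw [List.length_cons]; omega)
  have h₃ := h₂ w.reverse []
  rw [List.reverse_reverse, List.append_nil] at h₃
  have h₄ := h₁ w []
  rw [List.append_nil] at h₄
  exact (h₄.seq ((runs_push_main _ _ _ _ _).seq h₃)).mono (by rw [List.length_reverse]; omega)

/-- Replace the representation of a list of symbols on the main stack by the list as a string. -/
def unload : Prog :=
  seq (loop 0 (· = Option.some (Option.some true)) fun _ => case 0 fun o => match o with
    | Option.some (Option.some true) => case 0 fun o => match o with
      | Option.some (Option.some true) => case 0 fun _ => case 0 fun _ => case 0 fun _ =>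
          push 2 (Option.some true)
      | _ => case 0 fun _ => push 2 (Option.some false)
    | _ => push 2 none) (untake false)

theorem runs_unload (w : List (Option Bool)) :
    Runs unload (mem false (code w) [] [] []) (mem false w [] [] []) (20 * w.length + 5) := by
  have h : ∀ (w a : List (Option Bool)), Runs (loop 0 (· = Option.some (Option.some true))
        fun _ => case 0 fun o => match o with
        | Option.some (Option.some true) => case 0 fun o => match o with
          | Option.some (Option.some true) => case 0 fun _ => case 0 fun _ => case 0 fun _ =>
              push 2 (Option.some true)
          | _ => case 0 fun _ => push 2 (Option.some false)
        | _ => push 2 none)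
      (mem false (code w) [] a []) (mem false [] [] (w.reverse ++ a) []) (10 * w.length + 1) := by
    intro w
    induction w with
    | nil =>
      intro a
      simpa [code_nil] using Runs.loop_end (s := mem false (code ([] : List (Option Bool))) [] a [])
        (k := 0) (go := (· = Option.some (Option.some true)))
        (by simp [code_nil])
    | cons c w ih =>
      intro a
      have push2 : ∀ c, Runs (push 2 c) (mem false (code w) [] a []) (mem false (code w) [] (c :: a) []) 1 :=
        fun c => by simpa using Runs.push (s := mem false (code w) [] a []) 2 c
      refine (Runs.loop_go (by simp [code_cons]) (s' := mem false (code w) [] (c :: a) []) (m := 6) ?_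
        (by simpa using ih (c :: a))).mono (by rw [List.length_cons]; omega)
      simp only [mem_false_zero, code_cons, List.tail_cons, update_mem_false_zero]
      rcases c with _ | _ | _
      · exact Runs.mono (m := 2) (runs_case_main (c := Option.some false) (x := code w) (n := 1)
          (push2 none)) (by omega)
      · exact Runs.mono (m := 4) (runs_case_main (c := Option.some true)
          (x := Option.some false :: Option.some false :: code w) (n := 3)
          (runs_case_main (n := 2) (runs_case_main (n := 1) (push2 (Option.some false))))) (by omega)
      · exact runs_case_main (c := Option.some true)
          (x := Option.some true :: Option.some false :: Option.some false :: Option.some false ::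
            code w) (n := 5)
          (runs_case_main (n := 4) (runs_case_main (n := 3) (runs_case_main (n := 2)
            (runs_case_main (n := 1) (push2 (Option.some true))))))
  have h₁ := h w []
  have h₂ := runs_untake false [] [] w.reverse []
  rw [List.append_nil] at h₁
  rw [List.reverse_reverse, List.append_nil] at h₂
  exact (h₁.seq h₂).mono (by rw [List.length_reverse]; omega)

/-- A polynomial-time function of strings is computed by a Turing machine in polynomial time. -/
theorem tm2 {A B : Type} [Code A] {eA : A → List (Option Bool)} {eB : B → List (Option Bool)}
    {f : A → B} (hA : ∀ a, Code.enc a = Code.enc (eA a)) (hf : PTime fun a => eB (f a)) :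
    Nonempty (TM2ComputableInPolyTime eA eB f) := by
  obtain ⟨S, hS⟩ := hf.size_le
  obtain ⟨p, P, hp⟩ := hf
  obtain ⟨T, hT⟩ : ∃ T : Polynomial ℕ, ∀ a, size a ≤ T.eval (eA a).length := by
    refine ⟨6 * .X + 1, fun a => ?_⟩
    -- The longest code of a symbol has `5` symbols.
    have := size_le_of_forall (l := eA a) (n := 5) fun c _ => by
      rcases c with _ | _ | _ <;> decide
    have h : size a = size (eA a) := by simp only [size, code, hA]
    simp; omega
  have key : ∀ a, Nonempty (TM2OutputsInTime (toTM 0 (seq load (seq p unload)))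
      ((eA a).map (Equiv.refl (Option Bool)).invFun)
      (Option.some ((eB (f a)).map (Equiv.refl (Option Bool)).invFun))
      ((20 * .X + 5 + (P.comp T + (20 * S.comp T + 5)) + 1 : Polynomial ℕ).eval
        (eA a).length)) := by
    intro a
    have h₀ : ∀ l : List (Option Bool), l.map (Equiv.refl (Option Bool)).invFun = l :=
      fun l => List.map_id l
    refine (congrArg₂ (fun u v : List (Option Bool) => Nonempty (TM2OutputsInTime
      (toTM 0 (seq load (seq p unload))) u (Option.some v) _)) (h₀ (eA a)) (h₀ (eB (f a)))).mpr ?_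
    have h₁ := runs_load (eA a)
    have h₂ := hp a [] []
    have h₃ := runs_unload (eB (f a))
    have h₄ : code a = code (eA a) := by simp only [code, hA]
    rw [List.append_nil, List.append_nil, h₄] at h₂
    obtain ⟨n, hn, h⟩ := h₁.seq (h₂.seq h₃)
    have h₅ : ∀ w, mem false w [] [] [] = Function.update (fun _ => []) 0 w := by
      intro w
      funext k
      fin_cases k <;> rfl
    rw [h₅, h₅] at h
    refine h.stepsTo_toTM.outputsInTime ?_
    have h₆ := P.eval_nat_mono (hT a)
    have h₇ := (length_le_size _).trans ((hS a).trans (S.eval_nat_mono (hT a)))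
    simp [Polynomial.eval_comp]
    omega
  exact ⟨{ tm := toTM 0 (seq load (seq p unload))
           inputAlphabet := Equiv.refl _
           outputAlphabet := Equiv.refl _
           time := _
           outputsFun := fun a => (key a).some }⟩

end PTime

end StackProgram

/-! ### Graphs with labels as plain graphs -/

namespace SimpleGraph

variable {X : Type*} (R : SimpleGraph X) (m : ℕ) (L : Fin (m + 1) → X → Prop)

/-- A graph with labels `0, …, m` as a plain graph: attach a path whose vertices are alternately
`(j, false)` and `(j, true)` for `j = 0, …, m`, and join `(j, true)` to the vertices with
label `j`. -/
def labelGraph : SimpleGraph (X ⊕ Fin (m + 1) × Bool) where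
  Adj u v := match u, v with
    | .inl x, .inl y => R.Adj x y
    | .inl x, .inr (j, true) => L j x
    | .inr (j, true), .inl x => L j x
    | .inr (i, false), .inr (j, true) => i.val = j.val ∨ i.val = j.val + 1
    | .inr (j, true), .inr (i, false) => i.val = j.val ∨ i.val = j.val + 1
    | _, _ => False
  symm := ⟨by
    rintro (x | ⟨i, _ | _⟩) (y | ⟨j, _ | _⟩) h
    · exact R.adj_symm h
    all_goals exact h⟩
  loopless := ⟨by
    rintro (x | ⟨i, _ | _⟩) h
    · exact R.irrefl h
    all_goals exact h⟩

variable {R m L}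

theorem labelGraph_adj_inl {x y : X} :
    (R.labelGraph m L).Adj (.inl x) (.inl y) ↔ R.Adj x y := Iff.rfl

section Rigid

variable (hL : ∀ x, L (Fin.last m) x) (hR : ∀ x, ∃ y, R.Adj x y) [Nonempty X]
include hL hR

/-- All other vertices have two neighbours: those of `X` one in `R` and `(m, true)`, inner path
vertices two on the path, and the far end `(m, true)` one on the path and all of `X`. -/
theorem labelGraph_eq_zero {v : X ⊕ Fin (m + 1) × Bool}
    (h : ∀ p q, (R.labelGraph m L).Adj v p → (R.labelGraph m L).Adj v q → p = q) :
    v = .inr (0, false) := by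
  rcases v with x | ⟨j, _ | _⟩
  · obtain ⟨y, hy⟩ := hR x
    cases h (.inl y) (.inr (Fin.last m, true)) hy (hL x)
  · rcases Fin.eq_zero_or_eq_succ j with rfl | ⟨i, rfl⟩
    · rfl
    · have := h (.inr (i.castSucc, true)) (.inr (i.succ, true)) (Or.inr rfl) (Or.inl rfl)
      simp [Fin.ext_iff] at this
  · rcases Fin.eq_castSucc_or_eq_last j with ⟨i, rfl⟩ | rfl
    · have := h (.inr (i.castSucc, false)) (.inr (i.succ, false)) (Or.inl rfl) (Or.inr rfl)
      simp [Fin.ext_iff] at this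
    · have x : X := Classical.arbitrary X
      cases h (.inl x) (.inr (Fin.last m, false)) (hL x) (Or.inl rfl)

/-- Induction along the path from its free end, which is fixed because its degree characterizes it.
-/
theorem labelGraph_iso_path (σ : R.labelGraph m L ≃g R.labelGraph m L) (j : Fin (m + 1)) (b : Bool) :
    σ (.inr (j, b)) = .inr (j, b) := by
  have h₀ : σ (.inr (0, false)) = .inr (0, false) := by
    refine labelGraph_eq_zero hL hR fun p q hp hq => ?_
    have key : ∀ p, (R.labelGraph m L).Adj (σ (.inr (0, false))) p →
        σ.symm p = .inr (0, true) := by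
      intro p hp
      have hp : (R.labelGraph m L).Adj (.inr (0, false)) (σ.symm p) := by
        rw [← σ.map_adj_iff, σ.apply_symm_apply]
        exact hp
      rcases hσ : σ.symm p with x | ⟨i, _ | _⟩
      · rw [hσ] at hp; exact hp.elim
      · rw [hσ] at hp; exact hp.elim
      · rw [hσ] at hp
        rcases hp with h | h
        · rw [show i = 0 from Fin.ext h.symm]
        · simp at h
    exact σ.symm.injective ((key p hp).trans (key q hq).symm)
  -- `(j, false)` has only path neighbours, and the one before it is already fixed.
  have port : ∀ j : Fin (m + 1), σ (.inr (j, false)) = .inr (j, false) →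
      (∀ i : Fin (m + 1), i.val + 1 = j.val → σ (.inr (i, true)) = .inr (i, true)) →
      σ (.inr (j, true)) = .inr (j, true) := by
    intro j h₁ h₂
    have h : (R.labelGraph m L).Adj (σ (.inr (j, false))) (σ (.inr (j, true))) :=
      σ.map_adj_iff.2 (Or.inl rfl)
    rw [h₁] at h
    rcases hσ : σ (.inr (j, true)) with x | ⟨i, _ | _⟩
    · rw [hσ] at h; exact h.elim
    · rw [hσ] at h; exact h.elim
    · rw [hσ] at h
      rcases h with h | h
      · rw [show j = i from Fin.ext h]
      · have := σ.injective (hσ.trans (h₂ i h.symm).symm)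
        rw [Sum.inr.injEq, Prod.mk.injEq] at this
        omega
  -- The image of `(i + 1, false)` is a neighbour of the fixed vertex `(i, true)`. It cannot be some
  -- `x` in `X`: the neighbours of `x` would be `(i, true)` and the image of `(i + 1, true)`, but
  -- `x` has two distinct neighbours other than `(i, true)`, one in `X` and `(m, true)` with `m ≠
  -- i`.
  have trunk : ∀ i : Fin m, σ (.inr (i.castSucc, false)) = .inr (i.castSucc, false) →
      σ (.inr (i.castSucc, true)) = .inr (i.castSucc, true) →
      σ (.inr (i.succ, false)) = .inr (i.succ, false) := by
    intro i h₁ h₂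
    have h : (R.labelGraph m L).Adj (σ (.inr (i.castSucc, true))) (σ (.inr (i.succ, false))) :=
      σ.map_adj_iff.2 (Or.inr rfl)
    rw [h₂] at h
    rcases hσ : σ (.inr (i.succ, false)) with x | ⟨j, _ | _⟩
    · rw [hσ] at h
      have key : ∀ p, (R.labelGraph m L).Adj (.inl x) p →
          p = σ (.inr (i.castSucc, true)) ∨ p = σ (.inr (i.succ, true)) := by
        intro p hp
        rw [← hσ] at hp
        have hp : (R.labelGraph m L).Adj (.inr (i.succ, false)) (σ.symm p) := by
          rw [← σ.map_adj_iff, σ.apply_symm_apply]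
          exact hp
        rcases hτ : σ.symm p with y | ⟨j, _ | _⟩
        · rw [hτ] at hp; exact hp.elim
        · rw [hτ] at hp; exact hp.elim
        · rw [hτ] at hp
          rw [σ.symm_apply_eq] at hτ
          rcases hp with h | h
          · right; rw [hτ, show j = i.succ from Fin.ext h.symm]
          · left
            rw [hτ, show j = i.castSucc from Fin.ext (by simpa using h.symm)]
      obtain ⟨y, hy⟩ := hR x
      have k₁ := key (.inl y) hy
      have k₂ := key (.inr (Fin.last m, true)) (hL x)
      rw [h₂] at k₁ k₂
      rcases k₁ with k₁ | k₁
      · cases k₁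
      rcases k₂ with k₂ | k₂
      · rw [Sum.inr.injEq, Prod.mk.injEq] at k₂
        exact absurd k₂.1.symm (Fin.castSucc_lt_last i).ne
      · cases k₁.trans k₂.symm
    · rw [hσ] at h
      rcases h with h | h
      · have := σ.injective ((show j = i.castSucc from Fin.ext h) ▸ hσ |>.trans h₁.symm)
        rw [Sum.inr.injEq, Prod.mk.injEq] at this
        exact absurd this.1.symm (Fin.castSucc_lt_succ).ne
      · rw [show j = i.succ from Fin.ext (by simpa using h)]
    · rw [hσ] at h; exact h.elim
  have both : σ (.inr (j, false)) = .inr (j, false) ∧ σ (.inr (j, true)) = .inr (j, true) := by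
    induction j using Fin.induction with
    | zero => exact ⟨h₀, port 0 h₀ fun i hi => by simp at hi⟩
    | succ i ih =>
      have h := trunk i ih.1 ih.2
      refine ⟨h, port _ h fun k hk => ?_⟩
      rw [show k = i.castSucc from Fin.ext (by simpa using hk)]
      exact ih.2
  cases b
  · exact both.1
  · exact both.2

theorem labelGraph_iso_inl (σ : R.labelGraph m L ≃g R.labelGraph m L) (x : X) :
    ∃ y, σ (.inl x) = .inl y := by
  rcases h : σ (.inl x) with y | ⟨j, b⟩
  · exact ⟨y, rfl⟩
  · rw [← labelGraph_iso_path hL hR σ] at h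
    cases σ.injective h

/-- The automorphisms of `labelGraph` correspond to those that preserve the labels. -/
theorem exists_labelGraph_iso_iff :
    (∃ σ : R.labelGraph m L ≃g R.labelGraph m L, σ ≠ RelIso.refl _) ↔
      ∃ τ : R ≃g R, (∀ j x, L j (τ x) ↔ L j x) ∧ τ ≠ RelIso.refl _ := by
  constructor
  · rintro ⟨σ, hσ⟩
    choose f hf using labelGraph_iso_inl hL hR σ
    choose g hg using labelGraph_iso_inl hL hR σ.symm
    let τ : R ≃g R :=
      { toFun := f
        invFun := g
        left_inv := fun x => Sum.inl_injective (β := Fin (m + 1) × Bool) (by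
          rw [← hg, ← hf, σ.symm_apply_apply])
        right_inv := fun x => Sum.inl_injective (β := Fin (m + 1) × Bool) (by
          rw [← hf, ← hg, σ.apply_symm_apply])
        map_rel_iff' := by
          intro x y
          change R.Adj (f x) (f y) ↔ _
          rw [← labelGraph_adj_inl (m := m) (L := L), ← hf, ← hf, σ.map_adj_iff,
            labelGraph_adj_inl] }
    refine ⟨τ, fun j x => ?_, fun h => hσ ?_⟩
    · change L j (f x) ↔ _
      have : (R.labelGraph m L).Adj (σ (.inl x)) (σ (.inr (j, true))) ↔ L j x := σ.map_adj_iff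
      rwa [hf, labelGraph_iso_path hL hR σ] at this
    · refine RelIso.ext fun v => ?_
      rcases v with x | ⟨j, b⟩
      · have : τ x = x := by rw [h]; rfl
        change σ (.inl x) = .inl x
        rw [hf]
        exact congrArg _ this
      · exact labelGraph_iso_path hL hR σ j b
  · rintro ⟨τ, hτ, h⟩
    refine ⟨{ toEquiv := Equiv.sumCongr τ.toEquiv (Equiv.refl _), map_rel_iff' := ?_ },
      fun h' => h ?_⟩
    · rintro (x | ⟨i, _ | _⟩) (y | ⟨j, _ | _⟩)
      · exact τ.map_adj_iff
      · exact Iff.rfl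
      · exact hτ j x
      · exact Iff.rfl
      · exact Iff.rfl
      · exact Iff.rfl
      · exact hτ i y
      · exact Iff.rfl
      · exact Iff.rfl
    · refine RelIso.ext fun x => ?_
      exact Sum.inl_injective (DFunLike.congr_fun h' (Sum.inl x))

end Rigid

end SimpleGraph

/-! ### The graph of a game -/

namespace NormalFormGame

variable (Γ : NormalFormGame)

section MapProfile

variable {Γ} {φ : Equiv.Perm Γ.Action} {π : Equiv.Perm (Fin Γ.numPlayers)}
  {h : ∀ x : Γ.Action, (φ x).1 = π x.1}

/-- Equality in the disjoint union of the action sets absorbs the cast in `mapProfile`. -/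
theorem mk_mapProfile (a : Γ.Profile) (j : Fin Γ.numPlayers) :
    (⟨j, Γ.mapProfile φ π h a j⟩ : Γ.Action) = φ ⟨π.symm j, a (π.symm j)⟩ := by
  have hj : (φ ⟨π.symm j, a (π.symm j)⟩).1 = j := (h _).trans (π.apply_symm_apply j)
  refine Sigma.ext hj.symm ?_
  simp only [mapProfile]
  exact (Fin.heq_ext_iff (congrArg Γ.numActions hj.symm)).2 (by simp)

theorem mk_mapProfile_apply (a : Γ.Profile) (i : Fin Γ.numPlayers) :
    (⟨π i, Γ.mapProfile φ π h a (π i)⟩ : Γ.Action) = φ ⟨i, a i⟩ :=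
  (mk_mapProfile a (π i)).trans
    (congrArg (fun i => φ ⟨i, a i⟩) (π.symm_apply_apply i))

theorem mapProfile_eq {a b : Γ.Profile}
    (hb : ∀ i, (⟨π i, b (π i)⟩ : Γ.Action) = φ ⟨i, a i⟩) : Γ.mapProfile φ π h a = b := by
  funext j
  obtain ⟨i, rfl⟩ := π.surjective j
  have := (mk_mapProfile_apply (h := h) a i).trans (hb i).symm
  exact eq_of_heq (Sigma.mk.inj this).2

theorem mapProfile_injective : Function.Injective (Γ.mapProfile φ π h) := by
  intro a b hab
  funext i
  have h₁ := mk_mapProfile_apply (h := h) a i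
  rw [hab, mk_mapProfile_apply] at h₁
  exact (eq_of_heq (Sigma.mk.inj (φ.injective h₁)).2).symm

end MapProfile

theorem exists_profile (x : Γ.Action) : ∃ a : Γ.Profile, a x.1 = x.2 :=
  ⟨Function.update (fun i => ⟨0, Γ.numActions_pos i⟩) x.1 x.2, by simp⟩

/-- The graph whose vertices are the actions and the entries of the payoff table. The actions of
the same player are adjacent, as are the entries for the same profile, and the entry for a player
and a profile to the action of that player in the profile. -/
def tableGraph : SimpleGraph (Γ.Action ⊕ Fin Γ.numPlayers × Γ.Profile) where
  Adj u v := match u, v with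
    | .inl x, .inl y => x.1 = y.1 ∧ x ≠ y
    | .inl x, .inr e => x = ⟨e.1, e.2 e.1⟩
    | .inr e, .inl x => x = ⟨e.1, e.2 e.1⟩
    | .inr e, .inr f => e.2 = f.2 ∧ e ≠ f
  symm := ⟨by
    rintro (x | e) (y | f) h
    · exact ⟨h.1.symm, h.2.symm⟩
    · exact h
    · exact h
    · exact ⟨h.1.symm, h.2.symm⟩⟩
  loopless := ⟨by
    rintro (x | e) h
    · exact h.2 rfl
    · exact h.2 rfl⟩

/-- The payoff in an entry of the table. -/
def entryPayoff (e : Fin Γ.numPlayers × Γ.Profile) : ℚ := Γ.payoff e.1 e.2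

/-- The labels of actions and table entries: all have label `E`, and the entries that agree with
entry number `j` have label `j`. -/
def tableLabel {E : ℕ} (c : Fin E → Fin Γ.numPlayers × Γ.Profile) (j : Fin (E + 1)) :
    Γ.Action ⊕ Fin Γ.numPlayers × Γ.Profile → Prop
  | .inl _ => j.val = E
  | .inr e => j.val = E ∨ ∃ h : j.val < E, Γ.entryPayoff (c ⟨j, h⟩) = Γ.entryPayoff e

theorem tableGraph_exists_adj (v) : ∃ w, Γ.tableGraph.Adj v w := by
  rcases v with x | e
  · obtain ⟨a, ha⟩ := Γ.exists_profile x
    exact ⟨.inr (x.1, a), by change x = ⟨x.1, a x.1⟩; rw [ha]⟩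
  · exact ⟨.inl ⟨e.1, e.2 e.1⟩, rfl⟩

section

variable {E : ℕ} (c : Fin E → Fin Γ.numPlayers × Γ.Profile)

/-- Actions are the vertices with no label but `E`, so `τ` splits into a permutation `φ` of the
actions and a map `ψ` of the entries. Everything about `ψ` is then determined by `φ`, whence `φ = 1`
forces `τ` to be the identity. -/
theorem isSymmetry_of_tableGraph_iso (hc : Function.Surjective c)
    (τ : Γ.tableGraph ≃g Γ.tableGraph)
    (hτ : ∀ j v, Γ.tableLabel c j (τ v) ↔ Γ.tableLabel c j v) (hne : τ ≠ RelIso.refl _) :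
    ∃ φ : Equiv.Perm Γ.Action, Γ.IsSymmetry φ ∧ φ ≠ 1 := by
  have hv : ∀ v, (∃ x, v = .inl x) ↔ ∀ j, Γ.tableLabel c j v → j.val = E := by
    rintro (x | e)
    · simp [tableLabel]
    · obtain ⟨k, rfl⟩ := hc e
      simp only [reduceCtorEq, exists_false, false_iff, not_forall]
      exact ⟨k.castSucc, Or.inr ⟨k.2, rfl⟩, k.2.ne⟩
  have hx : ∀ v, (∃ x, τ v = .inl x) ↔ ∃ x, v = .inl x := by
    intro v
    rw [hv, hv]
    simp only [hτ]
  have hx' : ∀ v, (∃ x, τ.symm v = .inl x) ↔ ∃ x, v = .inl x := by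
    intro v
    rw [← hx, τ.apply_symm_apply]
  have he : ∀ e, ∃ f, τ (.inr e) = .inr f := by
    intro e
    rcases h : τ (.inr e) with x | f
    · obtain ⟨y, hy⟩ := (hx _).1 ⟨x, h⟩
      cases hy
    · exact ⟨f, rfl⟩
  choose f hf using fun x => (hx (.inl x)).2 ⟨x, rfl⟩
  choose g hg using fun x => (hx' (.inl x)).2 ⟨x, rfl⟩
  choose ψ hψ using he
  let φ : Equiv.Perm Γ.Action :=
    { toFun := f
      invFun := g
      left_inv := fun x => Sum.inl_injective (β := Fin Γ.numPlayers × Γ.Profile) (by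
        rw [← hg, ← hf, τ.symm_apply_apply])
      right_inv := fun x => Sum.inl_injective (β := Fin Γ.numPlayers × Γ.Profile) (by
        rw [← hf, ← hg, τ.apply_symm_apply]) }
  have hφ : ∀ x, τ (.inl x) = .inl (φ x) := hf
  have hplayer : ∀ x y : Γ.Action, (φ x).1 = (φ y).1 ↔ x.1 = y.1 := by
    intro x y
    by_cases hxy : x = y
    · simp [hxy]
    have : Γ.tableGraph.Adj (τ (.inl x)) (τ (.inl y)) ↔ Γ.tableGraph.Adj (.inl x) (.inl y) :=
      τ.map_adj_iff
    rw [hφ, hφ] at this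
    change (_ ∧ _) ↔ (_ ∧ _) at this
    simpa [hxy] using this
  -- Every player has an action, so the player cliques are nonempty and the permutation of the
  -- players can be read off representatives.
  let x₀ : ∀ i, Γ.Action := fun i => ⟨i, 0, Γ.numActions_pos i⟩
  let π₀ : Fin Γ.numPlayers → Fin Γ.numPlayers := fun i => (φ (x₀ i)).1
  have hπ₀ : Function.Injective π₀ := fun i j h => (hplayer _ _).1 h
  let π : Equiv.Perm (Fin Γ.numPlayers) := Equiv.ofBijective π₀ (Finite.injective_iff_bijective.1 hπ₀)
  have hπ : ∀ x, (φ x).1 = π x.1 := fun x => (hplayer x (x₀ x.1)).2 rfl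
  have hψ₁ : ∀ e, φ ⟨e.1, e.2 e.1⟩ = ⟨(ψ e).1, (ψ e).2 (ψ e).1⟩ := by
    intro e
    have : Γ.tableGraph.Adj (τ (.inl ⟨e.1, e.2 e.1⟩)) (τ (.inr e)) := τ.map_adj_iff.2 rfl
    rw [hφ, hψ] at this
    exact this
  have hψ₂ : ∀ e, (ψ e).1 = π e.1 := by
    intro e
    rw [← hπ ⟨e.1, e.2 e.1⟩, hψ₁]
  have hψ₃ : ∀ e f, e.2 = f.2 → (ψ e).2 = (ψ f).2 := by
    intro e f hef
    by_cases h : e = f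
    · rw [h]
    have : Γ.tableGraph.Adj (τ (.inr e)) (τ (.inr f)) := τ.map_adj_iff.2 ⟨hef, h⟩
    rw [hψ, hψ] at this
    exact this.1
  -- The entries of one profile stay together, and the one for player `i` goes to an entry at the
  -- action `φ ⟨i, e.2 i⟩`. This fixes every coordinate of the image profile.
  have hψ₄ : ∀ e, Γ.mapProfile φ π hπ e.2 = (ψ e).2 := by
    intro e
    refine mapProfile_eq fun i => ?_
    rw [hψ₃ e (i, e.2) rfl, hψ₁ (i, e.2), ← hψ₂ (i, e.2)]
  -- An entry has its own number as a label, and the image must share it.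
  have hψ₅ : ∀ e, Γ.entryPayoff (ψ e) = Γ.entryPayoff e := by
    intro e
    obtain ⟨k, hk⟩ := hc e
    have : Γ.tableLabel c k.castSucc (τ (.inr e)) :=
      (hτ _ _).2 (Or.inr ⟨k.2, congrArg Γ.entryPayoff hk⟩)
    rw [hψ] at this
    rcases this with h | ⟨_, h⟩
    · exact absurd h k.2.ne
    · exact (h.symm.trans (congrArg Γ.entryPayoff hk))
  refine ⟨φ, ⟨π, hπ, fun i a => ?_⟩, fun h => hne ?_⟩
  · have h₁ := hψ₅ (i, a)
    have h₂ := hψ₂ (i, a)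
    have h₃ := hψ₄ (i, a)
    simp only [entryPayoff] at h₁ h₂ h₃
    rw [← h₁, h₂, h₃]
  · refine RelIso.ext fun v => ?_
    rcases v with x | e
    · rw [hφ, h]; rfl
    · rw [hψ]
      have hπ' : ∀ i, π i = i := fun i => by rw [← hπ (x₀ i), h]; rfl
      have h₁ : (ψ e).2 = e.2 := by
        rw [← hψ₄]
        refine mapProfile_eq fun i => ?_
        rw [h, hπ']; rfl
      exact congrArg Sum.inr (Prod.ext ((hψ₂ e).trans (hπ' _)) h₁)

/-- A symmetry acts on entries by `π` on the player and `mapProfile` on the profile; invariance of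
payoffs is invariance of labels. -/
theorem tableGraph_iso_of_isSymmetry (φ : Equiv.Perm Γ.Action) (hφ : Γ.IsSymmetry φ)
    (hne : φ ≠ 1) : ∃ τ : Γ.tableGraph ≃g Γ.tableGraph,
      (∀ j v, Γ.tableLabel c j (τ v) ↔ Γ.tableLabel c j v) ∧ τ ≠ RelIso.refl _ := by
  obtain ⟨π, h, hu⟩ := hφ
  let μ : Equiv.Perm Γ.Profile := Equiv.ofBijective (Γ.mapProfile φ π h)
    (Finite.injective_iff_bijective.1 mapProfile_injective)
  let ψ : Equiv.Perm (Fin Γ.numPlayers × Γ.Profile) := Equiv.prodCongr π μ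
  have hψ : ∀ e, (⟨(ψ e).1, (ψ e).2 (ψ e).1⟩ : Γ.Action) = φ ⟨e.1, e.2 e.1⟩ :=
    fun e => mk_mapProfile_apply (h := h) e.2 e.1
  refine ⟨{ toEquiv := Equiv.sumCongr φ ψ, map_rel_iff' := ?_ }, ?_, fun h' => hne ?_⟩
  · rintro (x | e) (y | f)
    · change ((φ x).1 = (φ y).1 ∧ φ x ≠ φ y) ↔ (x.1 = y.1 ∧ x ≠ y)
      rw [h, h, π.injective.eq_iff, φ.injective.ne_iff]
    · change φ x = ⟨(ψ f).1, (ψ f).2 (ψ f).1⟩ ↔ x = _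
      rw [hψ, φ.injective.eq_iff]
    · change φ y = ⟨(ψ e).1, (ψ e).2 (ψ e).1⟩ ↔ y = _
      rw [hψ, φ.injective.eq_iff]
    · change (μ e.2 = μ f.2 ∧ ψ e ≠ ψ f) ↔ (e.2 = f.2 ∧ e ≠ f)
      rw [μ.injective.eq_iff, ψ.injective.ne_iff]
  · rintro j (x | e)
    · exact Iff.rfl
    · change (_ ∨ ∃ _, _ = Γ.entryPayoff (ψ e)) ↔ (_ ∨ ∃ _, _ = Γ.entryPayoff e)
      have : Γ.entryPayoff (ψ e) = Γ.entryPayoff e := (hu e.1 e.2).symm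
      rw [this]
  · refine Equiv.ext fun x => ?_
    exact Sum.inl_injective (DFunLike.congr_fun h' (Sum.inl x))

/-- The graph of a game. -/
def gameGraph : SimpleGraph ((Γ.Action ⊕ Fin Γ.numPlayers × Γ.Profile) ⊕ Fin (E + 1) × Bool) :=
  Γ.tableGraph.labelGraph E (Γ.tableLabel c)

theorem exists_gameGraph_iso_iff (hc : Function.Surjective c) :
    (∃ σ : Γ.gameGraph c ≃g Γ.gameGraph c, σ ≠ RelIso.refl _) ↔
      ∃ φ : Equiv.Perm Γ.Action, Γ.IsSymmetry φ ∧ φ ≠ 1 := by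
  have : Nonempty (Γ.Action ⊕ Fin Γ.numPlayers × Γ.Profile) :=
    ⟨.inl ⟨⟨0, Γ.numPlayers_pos⟩, 0, Γ.numActions_pos _⟩⟩
  rw [gameGraph, SimpleGraph.exists_labelGraph_iso_iff
    (by rintro (x | e); exacts [rfl, Or.inl rfl]) Γ.tableGraph_exists_adj]
  constructor
  · rintro ⟨τ, hτ, hne⟩
    exact Γ.isSymmetry_of_tableGraph_iso c hc τ hτ hne
  · rintro ⟨φ, hφ, hne⟩
    exact Γ.tableGraph_iso_of_isSymmetry c φ hφ hne

end

end NormalFormGame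

namespace StackProgram

variable {α β γ δ τ : Type} [Code α] [Code β] [Code γ] [Code δ] [Code τ]

/-! ### Words -/

/-- Prepend a symbol to a list of words, given as a string. -/
def consSymbol (c : Option Bool) (t : List (List Bool)) : List (List Bool) :=
  bif c.toList.isEmpty then [] :: t else (c.toList.headD false :: t.headD []) :: t.tail

/-- Parsing from the right: `#` opens a new empty word, and a bit is prepended to the current word.
-/
theorem foldr_consSymbol_encodeWords (L : List (List Bool)) :
    (encodeWords L).foldr consSymbol [] = L := by
  induction L with
  | nil => rfl
  | cons w L ih =>
    have h : ∀ w : List Bool, (w.map some ++ none :: encodeWords L).foldr consSymbol [] = w :: L := by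
      intro w
      induction w with
      | nil =>
        simp only [List.map_nil, List.nil_append, List.foldr_cons, ih]
        rfl
      | cons b w ihw =>
        simp only [List.map_cons, List.cons_append, List.foldr_cons, ihw]
        rfl
    have := h w
    simpa [encodeWords] using this

theorem size_consSymbol_le (c : Option Bool) (t : List (List Bool)) :
    size (consSymbol c t) ≤ size t + 7 := by
  rcases c with _ | b
  · simp [consSymbol, size_cons, size_nil]; omega
  · have := size_bool_le b
    cases t <;> simp [consSymbol, size_cons, size_nil] <;> omega

namespace PTime

/-- The words of an instance that is represented as a string. -/
theorem words {W : α → List (List Bool)}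
    (hW : ∀ a, Code.enc a = Code.enc (encodeWords (W a))) : PTime W := by
  have h₁ : PTime fun a => encodeWords (W a) := PTime.recode fun a => (hW a).symm
  have h₂ : PTime fun a => (encodeWords (W a)).reverse.foldl (fun t c => consSymbol c t) [] :=
    h₁.reverse.foldl_of_size_le
      (step := fun u : α × List (List Bool) × Option Bool => consSymbol u.2.2 u.2.1) (const [])
      (PTime.id.snd.snd.toList.isEmpty.cond ((const []).cons PTime.id.snd.fst)
        (((PTime.id.snd.snd.toList.headD (const false)).cons
          (PTime.id.snd.fst.headD (const []))).cons PTime.id.snd.fst.tail)) 7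
      fun a t c _ => by simpa using size_consSymbol_le c t
  simpa [List.foldl_reverse, foldr_consSymbol_encodeWords] using h₂

theorem encodeWords {W : α → List (List Bool)} (hW : PTime W) :
    PTime fun a => encodeWords (W a) := by
  have : PTime fun u : α × List Bool => u.2.map Option.some ++ [none] :=
    (PTime.id.snd.map (g := fun v : (α × List Bool) × Bool => Option.some v.2)
      PTime.id.snd.some).append (const [none])
  exact hW.flatMap this

theorem mul {m n : α → ℕ} (hm : PTime m) (hn : PTime n) : PTime fun a => m a * n a := by
  have := hm.units.flatMap (g := fun u : α × Unit => List.replicate (n u.1) ())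
    (hn.comp PTime.id.fst).units
  refine this.length.of_enc (fun a => a) (fun _ => rfl) fun a => ?_
  simp [List.length_flatMap]

end PTime

end StackProgram

open StackProgram in
/-- Graphs are represented by their encodings as strings. -/
noncomputable instance : Code (Σ n : ℕ, SimpleGraph (Fin n)) where
  enc G := Code.enc (encodeWords (graphWords G))
  enc_injective := Code.enc_injective.comp (encodeWords_injective.comp graphWords_injective)

open StackProgram in
/-- Games are represented by their encodings as strings. -/
instance : Code NormalFormGame where
  enc Γ := Code.enc (encodeWords Γ.words)
  enc_injective := Code.enc_injective.comp
    (encodeWords_injective.comp NormalFormGame.words_injective)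

/-! ### The two-player game of a graph -/

/-- A permutation of `{0, …, n - 1}` as one of `{0, …, n + k - 1}`. -/
def Equiv.Perm.finAdd {n : ℕ} (σ : Equiv.Perm (Fin n)) (k : ℕ) : Equiv.Perm (Fin (n + k)) :=
  finSumFinEquiv.permCongr (Equiv.sumCongr σ (Equiv.refl (Fin k)))

theorem Equiv.Perm.finAdd_castAdd {n : ℕ} (σ : Equiv.Perm (Fin n)) (k : ℕ) (i : Fin n) :
    σ.finAdd k (Fin.castAdd k i) = Fin.castAdd k (σ i) := by
  simp [finAdd, Equiv.permCongr_apply]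

theorem Equiv.Perm.finAdd_natAdd {n : ℕ} (σ : Equiv.Perm (Fin n)) (k : ℕ) (i : Fin k) :
    σ.finAdd k (Fin.natAdd n i) = Fin.natAdd n i := by
  simp [finAdd, Equiv.permCongr_apply]

theorem Equiv.Perm.finAdd_one (n k : ℕ) : (1 : Equiv.Perm (Fin n)).finAdd k = 1 := by
  refine Equiv.ext fun i => ?_
  induction i using Fin.addCases with
  | right i => rw [finAdd_natAdd]; rfl
  | left i => rw [finAdd_castAdd]; rfl

/-- `φ` restricts to an injection between the two action sets. This rules out that players with
different numbers of actions are swapped. -/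
theorem NormalFormGame.numActions_le {Γ : NormalFormGame} {φ : Equiv.Perm Γ.Action}
    {π : Equiv.Perm (Fin Γ.numPlayers)} (h : ∀ x : Γ.Action, (φ x).1 = π x.1)
    (i : Fin Γ.numPlayers) : Γ.numActions i ≤ Γ.numActions (π i) := by
  have : ∀ x : Fin (Γ.numActions i), ∃ y : Fin (Γ.numActions (π i)), φ ⟨i, x⟩ = ⟨π i, y⟩ := by
    intro x
    rcases hx : φ ⟨i, x⟩ with ⟨j, y⟩
    have := h ⟨i, x⟩
    rw [hx] at this
    cases this
    exact ⟨y, rfl⟩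
  choose f hf using this
  have hinj : Function.Injective f := fun x y hxy =>
    eq_of_heq (Sigma.mk.inj (φ.injective
      ((hf x).trans ((congrArg (fun y => (⟨π i, y⟩ : Γ.Action)) hxy).trans (hf y).symm)))).2
  simpa using Fintype.card_le_of_injective f hinj

namespace SimpleGraph

section

variable {n : ℕ} (G : SimpleGraph (Fin n))

open Classical in
/-- The payoff for row `r` and column `c` in the game of a graph. -/
noncomputable def gameEntry (r c : ℕ) : ℕ :=
  if c = n then 3 else if c = n + 1 then 4 else if r = n then 3 else if r = c then 2 else
    if ∃ (hr : r < n) (hc : c < n), G.Adj ⟨r, hr⟩ ⟨c, hc⟩ then 1 else 0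

/-- The two-player game of a graph: the rows are the vertices and one more, the columns are the
vertices and two more. -/
noncomputable def toGame (ε : ℚ) : NormalFormGame where
  numPlayers := 2
  numPlayers_pos := two_pos
  numActions i := n + (i.val + 1)
  numActions_pos i := by omega
  payoff i a := if i = 0 then (G.gameEntry (a 0) (a 1) : ℚ) else ε * G.gameEntry (a 0) (a 1)

theorem gameEntry_fst (r : ℕ) : G.gameEntry r n = 3 := if_pos rfl

theorem gameEntry_snd (r : ℕ) : G.gameEntry r (n + 1) = 4 := by simp [gameEntry]

theorem gameEntry_row {c : ℕ} (hc : c < n) : G.gameEntry n c = 3 := by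
  simp [gameEntry, hc.ne, (hc.trans n.lt_succ_self).ne]

theorem gameEntry_fin (i j : Fin n) [DecidableRel G.Adj] :
    G.gameEntry i j = if i = j then 2 else if G.Adj i j then 1 else 0 := by
  have h₁ := i.2
  have h₂ := j.2
  rw [gameEntry, if_neg h₂.ne, if_neg (h₂.trans n.lt_succ_self).ne, if_neg h₁.ne]
  simp [Fin.ext_iff]

theorem eq_of_gameEntry_eq_four {r c : ℕ} (h : G.gameEntry r c = 4) : c = n + 1 := by
  unfold gameEntry at h
  split_ifs at h <;> first | assumption | omega

theorem eq_of_gameEntry_eq_two {r c : ℕ} (h : G.gameEntry r c = 2) : r = c := by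
  unfold gameEntry at h
  split_ifs at h <;> first | assumption | omega

theorem eq_of_gameEntry_eq_three {r c : ℕ} (hc : c < n) (h : G.gameEntry r c = 3) : r = n := by
  unfold gameEntry at h
  split_ifs at h <;> omega

theorem gameEntry_eq_one_iff (i j : Fin n) : G.gameEntry i j = 1 ↔ G.Adj i j := by
  classical
  rw [gameEntry_fin]
  by_cases h : i = j
  · subst h; simp
  · simp [h]

theorem gameEntry_finAdd (σ : G ≃g G) (r : Fin (n + 1)) (c : Fin (n + 2)) :
    G.gameEntry (Equiv.Perm.finAdd σ.toEquiv 1 r) (Equiv.Perm.finAdd σ.toEquiv 2 c) =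
      G.gameEntry r c := by
  classical
  induction c using Fin.addCases with
  | right c =>
    rw [Equiv.Perm.finAdd_natAdd]
    fin_cases c
    · exact (G.gameEntry_fst _).trans (G.gameEntry_fst _).symm
    · exact (G.gameEntry_snd _).trans (G.gameEntry_snd _).symm
  | left c =>
    rw [Equiv.Perm.finAdd_castAdd]
    induction r using Fin.addCases with
    | right r =>
      rw [Equiv.Perm.finAdd_natAdd]
      have : ((Fin.natAdd n r : Fin (n + 1)) : ℕ) = n := by simp
      rw [this, Fin.val_castAdd, Fin.val_castAdd, gameEntry_row _ (Fin.is_lt _),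
        gameEntry_row _ (Fin.is_lt _)]
    | left r =>
      rw [Equiv.Perm.finAdd_castAdd]
      simp only [Fin.val_castAdd, gameEntry_fin]
      have h₁ : σ.toEquiv r = σ.toEquiv c ↔ r = c := σ.toEquiv.apply_eq_iff_eq
      have h₂ : G.Adj (σ.toEquiv r) (σ.toEquiv c) ↔ G.Adj r c := σ.map_adj_iff
      simp only [h₁, h₂]

/-- The entries identify everything: `4` occurs only in the last column; a column of `3`s is not a
vertex column, which has a `2`; and `2` occurs only on the diagonal, so rows and columns of vertices
move together. Then the entries `1` give adjacency. -/
theorem exists_iso_of_gameEntry (ρ : Equiv.Perm (Fin (n + 1))) (κ : Equiv.Perm (Fin (n + 2)))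
    (h : ∀ (r : Fin (n + 1)) (c : Fin (n + 2)), G.gameEntry r c = G.gameEntry (ρ r) (κ c)) :
    ∃ σ : G ≃g G, ρ = Equiv.Perm.finAdd σ.toEquiv 1 ∧ κ = Equiv.Perm.finAdd σ.toEquiv 2 := by
  classical
  have hκ₂ : κ (Fin.natAdd n 1) = Fin.natAdd n 1 :=
    Fin.ext (G.eq_of_gameEntry_eq_four ((h 0 (Fin.natAdd n 1)).symm.trans (G.gameEntry_snd _)))
  have hκ₁ : κ (Fin.natAdd n 0) = Fin.natAdd n 0 := by
    have key : ∀ r : Fin (n + 1), G.gameEntry r (κ (Fin.natAdd n 0)) = 3 := by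
      intro r
      rw [← ρ.apply_symm_apply r, ← h]
      exact G.gameEntry_fst _
    induction hc : κ (Fin.natAdd n 0) using Fin.addCases with
    | right c =>
      fin_cases c
      · rfl
      · cases κ.injective (hc.trans hκ₂.symm |>.trans rfl) |> Fin.natAdd_injective 2 n
    | left c =>
      have := key (Fin.castAdd 1 c)
      rw [hc, Fin.val_castAdd, Fin.val_castAdd, gameEntry_fin] at this
      simp at this
  have hκ : ∀ i : Fin n, ∃ j : Fin n, κ (Fin.castAdd 2 i) = Fin.castAdd 2 j := by
    intro i
    induction hc : κ (Fin.castAdd 2 i) using Fin.addCases with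
    | right c =>
      fin_cases c
      · have := congrArg Fin.val (κ.injective (hc.trans hκ₁.symm))
        simp at this
        omega
      · have := congrArg Fin.val (κ.injective (hc.trans hκ₂.symm))
        simp at this
        omega
    | left c => exact ⟨c, rfl⟩
  choose f hf using hκ
  have hρ : ∀ i : Fin n, ρ (Fin.castAdd 1 i) = Fin.castAdd 1 (f i) := by
    intro i
    refine Fin.ext ((G.eq_of_gameEntry_eq_two (c := κ (Fin.castAdd 2 i)) ?_).trans
      (congrArg Fin.val (hf i)))
    rw [← h, Fin.val_castAdd, Fin.val_castAdd, gameEntry_fin, if_pos rfl]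
  have hf' : Function.Injective f := fun i j hij =>
    Fin.castAdd_injective n 2 (κ.injective ((hf i).trans (by rw [hij, hf])))
  have hρ' : ρ (Fin.natAdd n 0) = Fin.natAdd n 0 := by
    induction hr : ρ (Fin.natAdd n 0) using Fin.addCases with
    | right r => rw [Subsingleton.elim r 0]
    | left r =>
      -- In a vertex column `3` occurs in the additional row only. The supposed image `r` serves as
      -- the vertex column.
      have h₁ := h (Fin.natAdd n 0) (Fin.castAdd 2 r)
      rw [hf, Fin.val_castAdd, Fin.val_castAdd] at h₁
      have h₂ := G.eq_of_gameEntry_eq_three (f r).2 (h₁.symm.trans (G.gameEntry_row r.2))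
      rw [hr] at h₂
      exact absurd h₂ r.2.ne
  refine ⟨{ toEquiv := Equiv.ofBijective f (Finite.injective_iff_bijective.1 hf')
            map_rel_iff' := ?_ }, ?_, ?_⟩
  · intro i j
    change G.Adj (f i) (f j) ↔ G.Adj i j
    rw [← gameEntry_eq_one_iff, ← gameEntry_eq_one_iff]
    have := h (Fin.castAdd 1 i) (Fin.castAdd 2 j)
    rw [hρ, hf] at this
    simp only [Fin.val_castAdd] at this
    rw [this]
  · refine Equiv.ext fun r => ?_
    induction r using Fin.addCases with
    | right r => rw [Equiv.Perm.finAdd_natAdd, Subsingleton.elim r 0, hρ']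
    | left r => rw [Equiv.Perm.finAdd_castAdd, hρ]; rfl
  · refine Equiv.ext fun c => ?_
    induction c using Fin.addCases with
    | right c => rw [Equiv.Perm.finAdd_natAdd]; fin_cases c; exacts [hκ₁, hκ₂]
    | left c => rw [Equiv.Perm.finAdd_castAdd, hf]; rfl

/-- The bijection of the actions in the game of a graph that an automorphism induces. -/
def toGamePerm (ε : ℚ) (σ : G ≃g G) : Equiv.Perm (G.toGame ε).Action :=
  Equiv.sigmaCongrRight fun i : Fin 2 => Equiv.Perm.finAdd σ.toEquiv (i.val + 1)

theorem toGame_isSymmetry (ε : ℚ) (σ : G ≃g G) :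
    (G.toGame ε).IsSymmetry (G.toGamePerm ε σ) := by
  refine ⟨1, fun _ => rfl, fun (i : Fin 2) a => ?_⟩
  have h₁ : ∀ j : Fin 2, (G.toGame ε).mapProfile (G.toGamePerm ε σ) 1 (fun _ => rfl) a j =
      Equiv.Perm.finAdd σ.toEquiv (j.val + 1) (a j) := fun j => rfl
  have h₂ := G.gameEntry_finAdd σ (a (0 : Fin 2)) (a (1 : Fin 2))
  change (if i = (0 : Fin 2) then _ else _) = (if i = (0 : Fin 2) then _ else _)
  rw [h₁, h₁]
  have h₃ := congrArg (Nat.cast : ℕ → ℚ) h₂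
  split_ifs
  · exact h₃.symm
  · exact congrArg (ε * ·) h₃.symm

/-- The second player has one action more, so the players are fixed and `φ` is a pair of a row and a
column permutation. The payoffs of the first player alone then suffice, so `ε` is arbitrary. -/
theorem exists_of_toGame_isSymmetry (ε : ℚ) {φ : Equiv.Perm (G.toGame ε).Action}
    (hφ : (G.toGame ε).IsSymmetry φ) : ∃ σ : G ≃g G, φ = G.toGamePerm ε σ := by
  obtain ⟨π, h, hu⟩ := hφ
  have hπ : π = 1 := by
    have h₁ : n + 2 ≤ n + ((π (1 : Fin 2) : Fin 2).val + 1) :=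
      NormalFormGame.numActions_le h (1 : Fin 2)
    have h₂ : π (1 : Fin 2) = (1 : Fin 2) := Fin.ext (by
      have := (π (1 : Fin 2)).2
      change _ < 2 at this
      change _ = 1
      omega)
    refine Equiv.ext fun (i : Fin 2) => ?_
    fin_cases i
    · by_contra h₀
      have h₀' : π (0 : Fin 2) = (1 : Fin 2) := by
        have : ∀ x : Fin 2, x ≠ 0 → x = 1 := by decide
        exact this _ h₀
      exact absurd (π.injective (h₀'.trans h₂.symm)) (by decide : (0 : Fin 2) ≠ 1)
    · exact h₂
  subst hπ
  have hF : ∀ i : Fin 2, ∃ F : Equiv.Perm (Fin (n + (i.val + 1))), ∀ x,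
      φ ⟨i, x⟩ = ⟨i, F x⟩ := by
    intro i
    have : ∀ x : Fin (n + (i.val + 1)), ∃ y : Fin (n + (i.val + 1)), φ ⟨i, x⟩ = ⟨i, y⟩ := by
      intro x
      rcases hx : φ ⟨i, x⟩ with ⟨j, y⟩
      have := h ⟨i, x⟩
      rw [hx] at this
      cases this
      exact ⟨y, rfl⟩
    choose F hF using this
    have hinj : Function.Injective F := fun x y hxy =>
      eq_of_heq (Sigma.mk.inj (φ.injective ((hF x).trans ((congrArg (Sigma.mk i) hxy).trans (hF y).symm)))).2
    exact ⟨Equiv.ofBijective F (Finite.injective_iff_bijective.1 hinj), hF⟩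
  choose F hF using hF
  have hmap : ∀ (a : (G.toGame ε).Profile) (j : Fin 2),
      (G.toGame ε).mapProfile φ 1 h a j = F j (a j) := fun a j =>
    eq_of_heq (Sigma.mk.inj ((NormalFormGame.mk_mapProfile_apply a j).trans (hF j (a j)))).2
  obtain ⟨σ, h₀, h₁⟩ := G.exists_iso_of_gameEntry (F 0) (F 1) (by
    intro r c
    let a : ∀ i : Fin 2, Fin (n + (i.val + 1)) := Fin.cons r (Fin.cons c finZeroElim)
    have := hu (0 : Fin 2) a
    change ((G.gameEntry (a 0) (a 1) : ℕ) : ℚ) = ((G.gameEntry _ _ : ℕ) : ℚ) at this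
    exact (Nat.cast_injective this).trans (congrArg₂ (fun (x : Fin (n + 1)) (y : Fin (n + 2)) =>
      G.gameEntry x y) (hmap a (0 : Fin 2)) (hmap a (1 : Fin 2))))
  refine ⟨σ, Equiv.ext fun ⟨(i : Fin 2), x⟩ => (hF i x).trans (congrArg (Sigma.mk i) ?_)⟩
  fin_cases i
  · exact DFunLike.congr_fun h₀ x
  · exact DFunLike.congr_fun h₁ x

theorem toGame_exists_symmetry_iff (ε : ℚ) :
    (∃ σ : G ≃g G, σ ≠ RelIso.refl G.Adj) ↔
      ∃ φ : Equiv.Perm (G.toGame ε).Action, (G.toGame ε).IsSymmetry φ ∧ φ ≠ 1 := by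
  constructor
  · rintro ⟨σ, hσ⟩
    refine ⟨_, G.toGame_isSymmetry ε σ, fun h => hσ ?_⟩
    refine RelIso.ext fun v => ?_
    have := DFunLike.congr_fun h (⟨(0 : Fin 2), Fin.castAdd 1 v⟩ : (G.toGame ε).Action)
    have := eq_of_heq (Sigma.mk.inj this).2
    exact Fin.castAdd_injective n 1 ((Equiv.Perm.finAdd_castAdd _ 1 v).symm.trans this)
  · rintro ⟨φ, hφ, hne⟩
    obtain ⟨σ, rfl⟩ := G.exists_of_toGame_isSymmetry ε hφ
    refine ⟨σ, fun h => hne ?_⟩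
    subst h
    refine Equiv.ext fun ⟨(i : Fin 2), x⟩ => congrArg (Sigma.mk i) ?_
    change Equiv.Perm.finAdd 1 (i.val + 1) x = x
    rw [Equiv.Perm.finAdd_one]
    rfl

end

end SimpleGraph

/-! ### The game of a graph is computable in polynomial time. -/

namespace StackProgram

/-- The words for the two payoffs in an entry. -/
def entryWords (ε : ℚ) (v : ℕ) : List (List Bool) := ratWords v ++ ratWords (ε * v)

theorem flatMap_finRange {β : Type} (n : ℕ) (f : ℕ → List β) :
    ((List.finRange n).flatMap fun k : Fin n => f k) = (List.range n).flatMap f := by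
  rw [← List.map_coe_finRange_eq_range, List.flatMap_map]

theorem words_toGame (ε : ℚ) (G : Σ n : ℕ, SimpleGraph (Fin n)) :
    (G.2.toGame ε).words =
      (List.replicate (G.1 + 1) true :: List.replicate (G.1 + 2) true :: [] ::
        (List.range ((G.1 + 1) * (G.1 + 2))).flatMap fun k =>
          entryWords ε (G.2.gameEntry (k % (G.1 + 1)) (k / (G.1 + 1)))) := by
  obtain ⟨n, G⟩ := G
  have hprod : ∏ i : Fin 2, (n + (i.val + 1)) = (n + 1) * (n + 2) := by
    rw [Fin.prod_univ_two]; rfl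
  have h : ∀ k : Fin (∏ i : Fin 2, (n + (i.val + 1))),
      ((List.finRange 2).flatMap fun i : Fin 2 =>
        ratWords ((G.toGame ε).payoff i (finPiFinEquiv.symm k))) =
      entryWords ε (G.gameEntry (k % (n + 1)) (k / (n + 1))) := by
    intro k
    -- The first player's action is the least significant digit of the profile number.
    have h₀ : ((finPiFinEquiv.symm k (0 : Fin 2) : Fin (n + ((0 : Fin 2).val + 1))) : ℕ) =
        k % (n + 1) := by
      change k.val / (∏ j : Fin 0, _) % (n + 1) = _
      simp
    have h₁ : ((finPiFinEquiv.symm k (1 : Fin 2) : Fin (n + ((1 : Fin 2).val + 1))) : ℕ) =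
        k / (n + 1) := by
      change k.val / (∏ j : Fin 1, (n + ((Fin.castLE _ j : Fin 2).val + 1))) % (n + 2) = _
      have : k.val < (n + 1) * (n + 2) := hprod ▸ k.2
      simp only [Finset.univ_unique, Finset.prod_singleton]
      exact Nat.mod_eq_of_lt (Nat.div_lt_of_lt_mul this)
    rw [entryWords, ← h₀, ← h₁]
    rfl
  have hw : (G.toGame ε).words = (List.replicate (n + 1) true :: List.replicate (n + 2) true :: [] ::
      (List.finRange (∏ i : Fin 2, (n + (i.val + 1)))).flatMap fun k =>
        (List.finRange 2).flatMap fun i : Fin 2 =>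
          ratWords ((G.toGame ε).payoff i (finPiFinEquiv.symm k))) := rfl
  rw [hw, ← hprod, ← flatMap_finRange]
  exact congrArg (fun f => List.replicate (n + 1) true :: List.replicate (n + 2) true :: [] ::
    (List.finRange (∏ i : Fin 2, (n + (i.val + 1)))).flatMap f) (funext h)

theorem getD_graphWords {n : ℕ} (G : SimpleGraph (Fin n)) (r c : ℕ) :
    ((graphWords ⟨n, G⟩).getD r []).getD c false = true ↔
      ∃ (hr : r < n) (hc : c < n), G.Adj ⟨r, hr⟩ ⟨c, hc⟩ := by
  classical
  by_cases hr : r < n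
  · by_cases hc : c < n
    · simp [graphWords, List.getD_eq_getElem?_getD, hr, hc]
    · simp [graphWords, List.getD_eq_getElem?_getD, hr, hc]
  · simp [graphWords, List.getD_eq_getElem?_getD, hr]

/-- Only five payoff values occur, so their words are constants and no binary arithmetic is needed.
-/
theorem PTime.words_toGame (ε : ℚ) :
    PTime fun G : Σ n : ℕ, SimpleGraph (Fin n) => (G.2.toGame ε).words := by
  have hW : PTime graphWords := PTime.words fun _ => rfl
  have hn : PTime fun G : Σ n : ℕ, SimpleGraph (Fin n) => G.1 :=
    hW.length.of_enc (fun a => a) (fun _ => rfl) fun G => by simp [graphWords]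
  have hk : PTime fun u : (Σ n : ℕ, SimpleGraph (Fin n)) × ℕ => u.2 := PTime.id.snd
  have hn' : PTime fun u : (Σ n : ℕ, SimpleGraph (Fin n)) × ℕ => u.1.1 := hn.comp PTime.id.fst
  have hr := hk.mod hn'.succ
  have hc := hk.div hn'.succ
  have hentry : PTime fun u : (Σ n : ℕ, SimpleGraph (Fin n)) × ℕ =>
      entryWords ε (u.1.2.gameEntry (u.2 % (u.1.1 + 1)) (u.2 / (u.1.1 + 1))) := by
    have := (hc.eq hn').ite (const (entryWords ε 3)) <|
      (hc.eq hn'.succ).ite (const (entryWords ε 4)) <|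
      (hr.eq hn').ite (const (entryWords ε 3)) <|
      (hr.eq hc).ite (const (entryWords ε 2)) <|
      ((((hW.comp PTime.id.fst).getD hr (const [])).getD hc (const false)).eq (const true)).ite
        (const (entryWords ε 1)) (const (entryWords ε 0))
    refine this.of_enc (fun a => a) (fun _ => rfl) fun ⟨⟨n, G⟩, k⟩ => ?_
    classical
    simp only [SimpleGraph.gameEntry, apply_ite (entryWords ε), getD_graphWords]
  have hones : ∀ {m : (Σ n : ℕ, SimpleGraph (Fin n)) → ℕ}, PTime m →
      PTime fun G => List.replicate (m G) true := fun {m} hm => by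
    simpa using hm.units.map (g := fun _ => true) (const true)
  have := (hones hn.succ).cons ((hones hn.succ.succ).cons ((const []).cons
    ((hn.succ.mul hn.succ.succ).range.flatMap hentry)))
  simpa only [StackProgram.words_toGame] using this

end StackProgram

/-! ### The entries of a payoff table -/

namespace List

theorem getElem?_flatMap_of_length {α β : Type*} {f : α → List β} {m : ℕ}
    (hf : ∀ a, (f a).length = m) (l : List α) (q : ℕ) {r : ℕ} (hr : r < m) :
    (l.flatMap f)[m * q + r]? = l[q]?.bind fun a => (f a)[r]? := by
  induction l generalizing q with
  | nil => simp
  | cons a l ih =>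
    rw [flatMap_cons]
    cases q with
    | zero => rw [Nat.mul_zero, Nat.zero_add, getElem?_append_left (by rw [hf]; exact hr)]; simp
    | succ q =>
      rw [getElem?_append_right (by rw [hf, Nat.mul_succ]; omega), hf, getElem?_cons_succ, ← ih]
      congr 1
      rw [Nat.mul_succ]
      omega

/-- The digits of a number in mixed radix. -/
def mixedDigits : ℕ → List ℕ → List ℕ
  | _, [] => []
  | e, n :: l => e % n :: mixedDigits (e / n) l

theorem getElem?_mixedDigits (e : ℕ) (l : List ℕ) (j : ℕ) :
    (mixedDigits e l)[j]? = l[j]?.map fun n => e / (l.take j).prod % n := by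
  induction l generalizing e j with
  | nil => simp [mixedDigits]
  | cons n l ih =>
    cases j with
    | zero => simp [mixedDigits]
    | succ j => simp [mixedDigits, ih, Nat.div_div_eq_div_mul]

theorem take_ofFn_castLE {α : Type*} {n : ℕ} (f : Fin n → α) (j : Fin n) :
    (ofFn f).take j = ofFn fun i : Fin j => f (Fin.castLE j.2.le i) := by
  refine ext_getElem (by simp [j.2.le]) fun i h₁ h₂ => ?_
  simp

end List

namespace NormalFormGame

variable (Γ : NormalFormGame)

/-- The number of profiles. -/
abbrev numProfiles : ℕ := ∏ i, Γ.numActions i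

/-- The number of entries of the payoff table. -/
abbrev numEntries : ℕ := Γ.numProfiles * Γ.numPlayers

/-- The words of the payoff table. -/
def tableWords : List (List Bool) :=
  (List.finRange Γ.numProfiles).flatMap fun k =>
    (List.finRange Γ.numPlayers).flatMap fun i => ratWords (Γ.payoff i (finPiFinEquiv.symm k))

/-- The player and the profile of an entry of the payoff table. -/
def entryEquiv : Fin Γ.numEntries ≃ Fin Γ.numPlayers × Γ.Profile :=
  finProdFinEquiv.symm.trans
    ((Equiv.prodCongr finPiFinEquiv.symm (Equiv.refl _)).trans (Equiv.prodComm _ _))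

theorem length_tableWords : Γ.tableWords.length = 2 * Γ.numEntries := by
  simp [tableWords, List.length_flatMap, ratWords, numEntries]
  ring

/-- Each payoff takes two words, and the player varies faster than the profile: entry `e` has
profile number `e / N` and player `e % N`, for `N` players. -/
theorem getElem?_tableWords (e : Fin Γ.numEntries) {s : ℕ} (hs : s < 2) :
    Γ.tableWords[2 * e.val + s]? = (ratWords (Γ.entryPayoff (Γ.entryEquiv e)))[s]? := by
  have hN := Γ.numPlayers_pos
  have h₁ : e.val / Γ.numPlayers < Γ.numProfiles := (finProdFinEquiv.symm e).1.2
  have h₂ : e.val % Γ.numPlayers < Γ.numPlayers := Nat.mod_lt _ hN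
  have h₃ : 2 * e.val + s =
      (Γ.numPlayers * 2) * (e.val / Γ.numPlayers) + (2 * (e.val % Γ.numPlayers) + s) := by
    have := Nat.mod_add_div e.val Γ.numPlayers
    nlinarith
  rw [h₃, tableWords, List.getElem?_flatMap_of_length (by simp [List.length_flatMap, ratWords]) _ _ (by omega)]
  rw [List.getElem?_eq_getElem (by simpa using h₁), Option.bind_some,
    List.getElem?_flatMap_of_length (by simp [ratWords]) _ _ hs,
    List.getElem?_eq_getElem (by simpa using h₂), Option.bind_some]
  simp only [List.getElem_finRange]
  rfl

/-- Since the player is the fastest index, the entry number is itself a mixed radix numeral with the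
player as first digit. -/
theorem mixedDigits_entry (e : Fin Γ.numEntries) :
    List.mixedDigits e (Γ.numPlayers :: List.ofFn Γ.numActions) =
      (Γ.entryEquiv e).1.val :: List.ofFn fun j => ((Γ.entryEquiv e).2 j).val := by
  rw [List.mixedDigits]
  congr 1
  refine List.ext_getElem? fun j => ?_
  rw [List.getElem?_mixedDigits]
  by_cases hj : j < Γ.numPlayers
  · have := List.take_ofFn_castLE Γ.numActions ⟨j, hj⟩
    simp only at this
    rw [this, List.prod_ofFn]
    simp [hj]
    rfl
  · simp [hj]

/-! ### The vertices of the graph of a game as data -/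

/-- The vertices of the graph of a game. -/
abbrev Vertex : Type :=
  (Γ.Action ⊕ Fin Γ.numPlayers × Γ.Profile) ⊕ Fin (Γ.numEntries + 1) × Bool

/-- Data for the vertices of graphs of games: a number for the kind of vertex, indices, and
words. -/
abbrev VertexData : Type := ℕ × List ℕ × List (List Bool)

/-- The data of a vertex. -/
def vertexData : Γ.Vertex → VertexData
  | .inl (.inl x) => (0, [x.1.val, x.2.val], [])
  | .inl (.inr e) => (1, e.1.val :: List.ofFn fun j => (e.2 j).val, ratWords (Γ.entryPayoff e))
  | .inr (j, false) => (2, [j.val], [])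
  | .inr (j, true) => (3, [j.val],
      if h : j.val < Γ.numEntries then ratWords (Γ.entryPayoff (Γ.entryEquiv ⟨j.val, h⟩)) else [])

/-- One half of the adjacency of vertices, in terms of their data. -/
def dataAdjAux (u v : VertexData) : Bool :=
  bif decide (u.1 = 0) then
    (decide (v.1 = 0) && (decide (u.2.1.headD 0 = v.2.1.headD 0) && !decide (u = v))) ||
    (decide (v.1 = 1) && (decide (v.2.1.headD 0 = u.2.1.headD 0) &&
      decide (v.2.1.tail.getD (u.2.1.headD 0) 0 = u.2.1.getD 1 0))) ||
    (decide (v.1 = 3) && decide (v.2.2 = []))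
  else bif decide (u.1 = 1) then
    (decide (v.1 = 1) && (decide (u.2.1.tail = v.2.1.tail) && !decide (u = v))) ||
    (decide (v.1 = 3) && (decide (v.2.2 = []) || decide (v.2.2 = u.2.2)))
  else decide (u.1 = 2) && (decide (v.1 = 3) &&
    (decide (u.2.1.headD 0 = v.2.1.headD 0) || decide (u.2.1.headD 0 = v.2.1.headD 0 + 1)))

/-- The adjacency of vertices, in terms of their data. -/
def dataAdj (u v : VertexData) : Bool := dataAdjAux u v || dataAdjAux v u

theorem vertexData_action_eq_iff (x y : Γ.Action) :
    ((0, [x.1.val, x.2.val], []) : VertexData) = (0, [y.1.val, y.2.val], []) ↔ x = y := by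
  obtain ⟨i, x⟩ := x
  obtain ⟨j, y⟩ := y
  constructor
  · intro h
    simp only [Prod.mk.injEq, List.cons.injEq, true_and, and_true] at h
    obtain ⟨h₁, h₂⟩ := h
    cases Fin.ext h₁
    rw [Fin.ext h₂]
  · intro h
    rw [h]

theorem ofFn_profile_eq_iff (a b : Γ.Profile) :
    (List.ofFn fun j => (a j).val) = (List.ofFn fun j => (b j).val) ↔ a = b := by
  constructor
  · intro h
    funext j
    exact Fin.ext (congrFun (List.ofFn_injective h) j)
  · intro h
    rw [h]

theorem action_eq_iff (x : Γ.Action) (e : Fin Γ.numPlayers × Γ.Profile) :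
    x = ⟨e.1, e.2 e.1⟩ ↔ e.1.val = x.1.val ∧
      (List.ofFn fun j => (e.2 j).val).getD x.1.val 0 = x.2.val := by
  obtain ⟨i, x⟩ := x
  obtain ⟨j, a⟩ := e
  have : (List.ofFn fun j => (a j).val).getD i.val 0 = (a i).val := by
    simp [List.getD_eq_getElem?_getD]
  simp only [this]
  constructor
  · intro h
    cases h
    exact ⟨rfl, rfl⟩
  · rintro ⟨h₁, h₂⟩
    cases Fin.ext h₁
    rw [Fin.ext h₂]

theorem ratWords_ne_nil (q : ℚ) : ratWords q ≠ [] := by simp [ratWords]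

/-- Rationals are written in lowest terms, so equal payoffs means equal words. No rational has the
empty list of words, which can thus stand for the label of all vertices. -/
theorem tableLabel_entry_iff (j : Fin (Γ.numEntries + 1)) (e : Fin Γ.numPlayers × Γ.Profile) :
    Γ.tableLabel Γ.entryEquiv j (.inr e) ↔
      (Γ.vertexData (.inr (j, true))).2.2 = [] ∨
        (Γ.vertexData (.inr (j, true))).2.2 = ratWords (Γ.entryPayoff e) := by
  have := j.2
  by_cases h : j.val < Γ.numEntries
  · simp only [tableLabel, vertexData, h, h.ne, dif_pos, ratWords_ne_nil, exists_true_left,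
      ratWords_injective.eq_iff]
  · simp only [tableLabel, vertexData, h, dif_neg, not_false_eq_true, true_or, iff_true]
    left
    omega

theorem dataAdj_vertexData (u v : Γ.Vertex) :
    dataAdj (Γ.vertexData u) (Γ.vertexData v) = true ↔ (Γ.gameGraph Γ.entryEquiv).Adj u v := by
  have hl : ∀ j : Fin (Γ.numEntries + 1), (Γ.vertexData (.inr (j, true))).2.2 = [] ↔
      j.val = Γ.numEntries := by
    intro j
    have := j.2
    by_cases h : j.val < Γ.numEntries
    · simp [vertexData, h, ratWords_ne_nil, h.ne]
    · simp [vertexData, h]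
      omega
  -- Both relations are symmetric, which halves the case distinction.
  have key : ∀ u v : Γ.Vertex, (dataAdj (Γ.vertexData u) (Γ.vertexData v) = true ↔
      (Γ.gameGraph Γ.entryEquiv).Adj u v) → (dataAdj (Γ.vertexData v) (Γ.vertexData u) = true ↔
      (Γ.gameGraph Γ.entryEquiv).Adj v u) := by
    intro u v h
    rw [dataAdj, Bool.or_comm, SimpleGraph.adj_comm]
    exact h
  have h₁ : ∀ (x : Γ.Action) e, dataAdj (Γ.vertexData (.inl (.inl x)))
      (Γ.vertexData (.inl (.inr e))) = true ↔ x = ⟨e.1, e.2 e.1⟩ := by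
    intro x e
    rw [action_eq_iff]
    simp [dataAdj, dataAdjAux, vertexData]
  have h₂ : ∀ (x : Γ.Action) j, dataAdj (Γ.vertexData (.inl (.inl x)))
      (Γ.vertexData (.inr (j, true))) = true ↔ j.val = Γ.numEntries := by
    intro x j
    rw [← hl]
    simp [dataAdj, dataAdjAux, vertexData]
  have h₃ : ∀ e j, dataAdj (Γ.vertexData (.inl (.inr e)))
      (Γ.vertexData (.inr (j, true))) = true ↔ Γ.tableLabel Γ.entryEquiv j (.inr e) := by
    intro e j
    have : ∀ a b r w, dataAdj (1, a, r) (3, b, w) = true ↔ w = [] ∨ w = r := by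
      intro a b r w
      simp [dataAdj, dataAdjAux]
    rw [tableLabel_entry_iff]
    exact this _ _ _ _
  have h₄ : ∀ i j, dataAdj (Γ.vertexData (.inr (i, false)))
      (Γ.vertexData (.inr (j, true))) = true ↔ i.val = j.val ∨ i.val = j.val + 1 := by
    intro i j
    simp [dataAdj, dataAdjAux, vertexData]
  rcases u with (x | e) | ⟨i, _ | _⟩ <;> rcases v with (y | f) | ⟨j, _ | _⟩
  · change _ ↔ x.1 = y.1 ∧ x ≠ y
    have := Γ.vertexData_action_eq_iff x y
    have := Γ.vertexData_action_eq_iff y x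
    simp [dataAdj, dataAdjAux, vertexData, *]
    rw [Fin.val_inj, Fin.val_inj, eq_comm (a := y.1), eq_comm (a := y), or_self]
  · exact h₁ x f
  · change _ ↔ False
    simp [dataAdj, dataAdjAux, vertexData]
  · exact h₂ x j
  · exact key _ _ (h₁ y e)
  · change _ ↔ e.2 = f.2 ∧ e ≠ f
    have h : ∀ e f : Fin Γ.numPlayers × Γ.Profile,
        ((1, e.1.val :: List.ofFn fun j => (e.2 j).val, ratWords (Γ.entryPayoff e)) : VertexData) =
          (1, f.1.val :: List.ofFn fun j => (f.2 j).val, ratWords (Γ.entryPayoff f)) ↔ e = f := by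
      refine fun e f => ⟨fun h => ?_, fun h => by rw [h]⟩
      simp only [Prod.mk.injEq, List.cons.injEq, ofFn_profile_eq_iff, true_and] at h
      exact Prod.ext (Fin.ext h.1.1) h.1.2
    simp only [dataAdj, dataAdjAux, vertexData, List.tail_cons, ofFn_profile_eq_iff, h]
    simp [eq_comm (a := f), eq_comm (a := f.2)]
  · change _ ↔ False
    simp [dataAdj, dataAdjAux, vertexData]
  · exact h₃ e j
  · change _ ↔ False
    simp [dataAdj, dataAdjAux, vertexData]
  · change _ ↔ False
    simp [dataAdj, dataAdjAux, vertexData]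
  · change _ ↔ False
    simp [dataAdj, dataAdjAux, vertexData]
  · exact h₄ i j
  · exact key _ _ (h₂ y i)
  · exact key _ _ (h₃ f i)
  · exact key _ _ (h₄ j i)
  · change _ ↔ False
    simp [dataAdj, dataAdjAux, vertexData]

/-- All vertices of the graph of a game. -/
def vertices : List Γ.Vertex :=
  ((List.finRange Γ.numPlayers).flatMap fun i =>
      (List.finRange (Γ.numActions i)).map fun x => .inl (.inl ⟨i, x⟩)) ++
    ((List.finRange Γ.numEntries).map fun e => .inl (.inr (Γ.entryEquiv e))) ++
    ((List.finRange (Γ.numEntries + 1)).map fun j => .inr (j, false)) ++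
    ((List.finRange (Γ.numEntries + 1)).map fun j => .inr (j, true))

theorem mem_vertices (v : Γ.Vertex) : v ∈ Γ.vertices := by
  rcases v with (⟨i, x⟩ | e) | ⟨j, _ | _⟩
  · simp [vertices]
  · obtain ⟨k, rfl⟩ := Γ.entryEquiv.surjective e
    simp [vertices]
  · simp [vertices]
  · simp [vertices]

theorem nodup_vertices : Γ.vertices.Nodup := by
  have h := fun n => List.nodup_finRange n
  refine .append (.append (.append (List.nodup_flatMap.2 ⟨fun i _ => (h _).map ?_, ?_⟩)
    ((h _).map ?_) ?_) ((h _).map ?_) ?_) ((h _).map ?_) ?_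
  · intro x y h
    simpa using h
  · refine (h _).imp fun {i j} hij => ?_
    simp [Function.onFun, List.disjoint_left, hij.symm]
  · intro e f h
    simpa using h
  · simp [List.disjoint_left]
  · intro i j h
    simpa using h
  · simp [List.disjoint_left]
  · intro i j h
    simpa using h
  · simp [List.disjoint_left]

/-- The data of all vertices. -/
def vertexDataList : List VertexData :=
  ((List.range Γ.numPlayers).flatMap fun i =>
      (List.range ((List.ofFn Γ.numActions).getD i 0)).map fun x => (0, [i, x], [])) ++
    ((List.range Γ.numEntries).map fun e =>
      (1, List.mixedDigits e (Γ.numPlayers :: List.ofFn Γ.numActions),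
        [Γ.tableWords.getD (2 * e) [], Γ.tableWords.getD (2 * e + 1) []])) ++
    ((List.range (Γ.numEntries + 1)).map fun j => (2, [j], [])) ++
    ((List.range (Γ.numEntries + 1)).map fun j => (3, [j],
      if j = Γ.numEntries then [] else
        [Γ.tableWords.getD (2 * j) [], Γ.tableWords.getD (2 * j + 1) []]))

/-- This trades the dependent types of the vertices for arithmetic on indices and lookups in the
input words, which programs can do. -/
theorem map_vertexData_vertices : Γ.vertices.map Γ.vertexData = Γ.vertexDataList := by
  have hw : ∀ e : Fin Γ.numEntries, [Γ.tableWords.getD (2 * e) [], Γ.tableWords.getD (2 * e + 1) []] =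
      ratWords (Γ.entryPayoff (Γ.entryEquiv e)) := by
    intro e
    have h₁ := Γ.getElem?_tableWords e (s := 0) (by omega)
    have h₂ := Γ.getElem?_tableWords e (s := 1) (by omega)
    rw [Nat.add_zero] at h₁
    rw [List.getD_eq_getElem?_getD, List.getD_eq_getElem?_getD, h₁, h₂]
    rfl
  simp only [vertices, vertexDataList, List.map_append, List.map_flatMap, List.map_map,
    ← List.map_coe_finRange_eq_range, List.flatMap_map]
  congr 1
  · congr 1
    · congr 1
      · refine List.flatMap_congr fun i _ => ?_
        have : (List.ofFn Γ.numActions).getD i.val 0 = Γ.numActions i := by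
          simp [List.getD_eq_getElem?_getD]
        rw [this]
        rfl
      · refine List.map_congr_left fun e _ => ?_
        simp only [Function.comp_apply, vertexData, mixedDigits_entry, hw]
  · refine List.map_congr_left fun j _ => ?_
    have := j.2
    simp only [Function.comp_apply, vertexData]
    by_cases h : j.val < Γ.numEntries
    · rw [dif_pos h, if_neg h.ne, ← hw ⟨j, h⟩]
    · rw [dif_neg h, if_pos (by omega)]

end NormalFormGame

/-! ### Numbering the vertices of the graph of a game. -/

theorem SimpleGraph.graphWords_comap {V : Type*} (G : SimpleGraph V) [DecidableRel G.Adj] (l : List V) :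
    graphWords ⟨l.length, G.comap l.get⟩ = l.map fun u => l.map fun v => decide (G.Adj u v) := by
  refine List.ext_getElem (by simp [graphWords]) fun i h₁ h₂ => ?_
  refine List.ext_getElem (by simp [graphWords]) fun j h₃ h₄ => ?_
  simp [graphWords]

theorem SimpleGraph.Iso.exists_ne_refl_iff.{u} {V W : Type u} {G : SimpleGraph V} {H : SimpleGraph W}
    (e : G ≃g H) :
    (∃ σ : G ≃g G, σ ≠ RelIso.refl G.Adj) ↔ ∃ σ : H ≃g H, σ ≠ RelIso.refl H.Adj := by
  have key : ∀ {V W : Type u} {G : SimpleGraph V} {H : SimpleGraph W} (_ : G ≃g H),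
      (∃ σ : G ≃g G, σ ≠ RelIso.refl G.Adj) → ∃ σ : H ≃g H, σ ≠ RelIso.refl H.Adj := by
    rintro V W G H e ⟨σ, hσ⟩
    refine ⟨(e.symm.trans σ).trans e, fun h => hσ (RelIso.ext fun v => ?_)⟩
    have := DFunLike.congr_fun h (e v)
    simpa using this
  exact ⟨key e, key e.symm⟩

namespace NormalFormGame

/-- Every game has a graph, with vertices numbered from `0`, that has nontrivial automorphisms if
and only if the game has nontrivial symmetries. -/
theorem exists_graph (Γ : NormalFormGame) : ∃ G : Σ n : ℕ, SimpleGraph (Fin n),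
    graphWords G = (Γ.vertexDataList.map fun u => Γ.vertexDataList.map fun v => dataAdj u v) ∧
      ((∃ σ : G.2 ≃g G.2, σ ≠ RelIso.refl G.2.Adj) ↔
        ∃ φ : Equiv.Perm Γ.Action, Γ.IsSymmetry φ ∧ φ ≠ 1) := by
  classical
  let f : Fin Γ.vertices.length ≃ Γ.Vertex :=
    Γ.nodup_vertices.getEquivOfForallMemList _ Γ.mem_vertices
  refine ⟨⟨Γ.vertices.length, (Γ.gameGraph Γ.entryEquiv).comap Γ.vertices.get⟩, ?_, ?_⟩
  · rw [SimpleGraph.graphWords_comap, ← map_vertexData_vertices]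
    simp only [List.map_map, Function.comp_def]
    refine List.map_congr_left fun u _ => List.map_congr_left fun v _ => ?_
    rw [Bool.eq_iff_iff, dataAdj_vertexData, decide_eq_true_iff]
  · have e : (Γ.gameGraph Γ.entryEquiv).comap Γ.vertices.get ≃g Γ.gameGraph Γ.entryEquiv :=
      SimpleGraph.Iso.comap f _
    exact e.exists_ne_refl_iff.trans (Γ.exists_gameGraph_iso_iff _ Γ.entryEquiv.surjective)

end NormalFormGame

/-! ### The graph of a game is computable in polynomial time. -/

namespace StackProgram

open NormalFormGame

variable {α : Type} [Code α]

/-- One step of splitting the words of a game at the empty word. -/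
def splitStep (s : Bool × List ℕ × List (List Bool)) (w : List Bool) :
    Bool × List ℕ × List (List Bool) :=
  bif s.1 then (true, s.2.1, w :: s.2.2) else
    bif w.isEmpty then (true, s.2.1, s.2.2) else (false, w.length :: s.2.1, s.2.2)

/-- Numbers of actions are positive, so the first empty word is the separator. -/
theorem foldl_splitStep_words (Γ : NormalFormGame) :
    Γ.words.foldl splitStep (false, [], []) =
      (true, (List.ofFn Γ.numActions).reverse, Γ.tableWords.reverse) := by
  have h₁ : ∀ (R : List (List Bool)) A B,
      R.foldl splitStep (true, A, B) = (true, A, R.reverse ++ B) := by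
    intro R
    induction R with
    | nil => simp
    | cons w R ih => intro A B; simp [splitStep, ih]
  have h₂ : ∀ (l : List ℕ) (R : List (List Bool)) A B, (∀ n ∈ l, 0 < n) →
      ((l.map fun n => List.replicate n true) ++ [] :: R).foldl splitStep (false, A, B) =
        (true, l.reverse ++ A, R.reverse ++ B) := by
    intro l R
    induction l with
    | nil => intro A B _; simp [splitStep, h₁]
    | cons n l ih =>
      intro A B hl
      have hn : n ≠ 0 := (hl n (by simp)).ne'
      have := ih (n :: A) B fun m hm => hl m (by simp [hm])
      simpa [splitStep, List.isEmpty_replicate, hn] using this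
  have := h₂ (List.ofFn Γ.numActions) Γ.tableWords [] [] (by
    simp only [List.mem_ofFn, forall_exists_index, forall_apply_eq_imp_iff]
    exact Γ.numActions_pos)
  rw [List.append_nil, List.append_nil, List.map_ofFn] at this
  exact this

namespace PTime

theorem split_words : PTime fun Γ : NormalFormGame => (List.ofFn Γ.numActions, Γ.tableWords) := by
  have hW : PTime NormalFormGame.words := PTime.words fun _ => rfl
  have : PTime fun Γ : NormalFormGame => Γ.words.foldl splitStep (false, [], []) := by
    refine hW.foldl_of_size_le (step := fun u : NormalFormGame ×
        (Bool × List ℕ × List (List Bool)) × List Bool => splitStep u.2.1 u.2.2)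
      (const (false, [], [])) ?_ (2 * .X + 10) fun Γ s w _ => ?_
    · have hs := (PTime.id (α := NormalFormGame ×
        (Bool × List ℕ × List (List Bool)) × List Bool)).snd.fst
      have hw := (PTime.id (α := NormalFormGame ×
        (Bool × List ℕ × List (List Bool)) × List Bool)).snd.snd
      exact hs.fst.cond ((const true).pair (hs.snd.fst.pair (hw.cons hs.snd.snd)))
        (hw.isEmpty.cond ((const true).pair (hs.snd.fst.pair hs.snd.snd))
          ((const false).pair ((hw.length.cons hs.snd.fst).pair hs.snd.snd)))
    · obtain ⟨b, A, B⟩ := s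
      have h₁ := size_bool_le b
      have h₂ := size_pos b
      have h₃ := length_le_size w
      have h₄ : size true = 3 := rfl
      have h₅ : size false = 1 := rfl
      cases b <;> cases hw : w.isEmpty <;>
        simp [splitStep, hw, size_mk, size_cons, size_nat] <;> omega
  have := this.snd.fst.reverse.pair this.snd.snd.reverse
  simpa [foldl_splitStep_words] using this

theorem mixedDigits {e : α → ℕ} {l : α → List ℕ} (he : PTime e) (hl : PTime l) :
    PTime fun a => List.mixedDigits (e a) (l a) := by
  have h : ∀ (l : List ℕ) (A : List ℕ) (e : ℕ),
      (l.foldl (fun t n => (t.2 % n :: t.1, t.2 / n)) (A, e)).1 =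
        (List.mixedDigits e l).reverse ++ A := by
    intro l
    induction l with
    | nil => simp [List.mixedDigits]
    | cons n l ih => intro A e; simp [List.mixedDigits, ih]
  have : PTime fun a => (l a).foldl (fun t n => (t.2 % n :: t.1, t.2 / n)) ([], e a) := by
    refine hl.foldl_of_size_le
      (step := fun u : α × (List ℕ × ℕ) × ℕ => (u.2.1.2 % u.2.2 :: u.2.1.1, u.2.1.2 / u.2.2))
      ((const []).pair he) ?_ 2 fun a t n _ => ?_
    · have ht := (PTime.id (α := α × (List ℕ × ℕ) × ℕ)).snd
      exact ((ht.fst.snd.mod ht.snd).cons ht.fst.fst).pair (ht.fst.snd.div ht.snd)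
    · obtain ⟨A, e⟩ := t
      -- In unary, splitting a number into remainder and quotient does not increase the total, so a
      -- step adds only a constant.
      have : e % n + e / n ≤ e := by
        rcases Nat.eq_zero_or_pos n with rfl | hn
        · simp
        · have h₁ := Nat.mod_add_div e n
          have h₂ := Nat.le_mul_of_pos_left (e / n) hn
          omega
      simp [size_mk, size_cons, size_nat]
      omega
  have := this.fst.reverse
  simpa [h] using this

theorem dataAdjAux : PTime fun u : VertexData × VertexData => dataAdjAux u.1 u.2 := by
  have hu := (PTime.id (α := VertexData × VertexData)).fst
  have hv := (PTime.id (α := VertexData × VertexData)).snd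
  have k : ∀ n : ℕ, PTime fun _ : VertexData × VertexData => n := fun n => const n
  have hhu := hu.snd.fst.headD (k 0)
  have hhv := hv.snd.fst.headD (k 0)
  exact (hu.fst.eq (k 0)).cond
    ((((hv.fst.eq (k 0)).and ((hhu.eq hhv).and (hu.eq hv).not)).or
      ((hv.fst.eq (k 1)).and ((hhv.eq hhu).and
        ((hv.snd.fst.tail.getD hhu (k 0)).eq (hu.snd.fst.getD (k 1) (k 0)))))).or
      ((hv.fst.eq (k 3)).and (hv.snd.snd.eq (const []))))
    ((hu.fst.eq (k 1)).cond
      (((hv.fst.eq (k 1)).and ((hu.snd.fst.tail.eq hv.snd.fst.tail).and (hu.eq hv).not)).or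
        ((hv.fst.eq (k 3)).and ((hv.snd.snd.eq (const [])).or (hv.snd.snd.eq hu.snd.snd))))
      ((hu.fst.eq (k 2)).and ((hv.fst.eq (k 3)).and ((hhu.eq hhv).or (hhu.eq hhv.succ)))))

theorem dataAdj : PTime fun u : VertexData × VertexData => dataAdj u.1 u.2 := by
  have h : PTime fun u : VertexData × VertexData => (u.2, u.1) := PTime.id.snd.pair PTime.id.fst
  have := dataAdjAux.comp h
  exact dataAdjAux.or this

theorem vertexDataList : PTime fun Γ : NormalFormGame => Γ.vertexDataList := by
  have hc := split_words.fst
  have hT := split_words.snd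
  have hN : PTime fun Γ : NormalFormGame => Γ.numPlayers := by simpa using hc.length
  have hE : PTime fun Γ : NormalFormGame => Γ.numEntries := by
    simpa [length_tableWords] using hT.length.div (const 2)
  have hi : PTime fun u : NormalFormGame × ℕ => u.2 := PTime.id.snd
  have hΓ : PTime fun u : NormalFormGame × ℕ => u.1 := PTime.id.fst
  have hd : PTime fun u : NormalFormGame × ℕ => 2 * u.2 := by
    simpa [two_mul] using hi.add hi
  have hw : PTime fun u : NormalFormGame × ℕ =>
      [u.1.tableWords.getD (2 * u.2) [], u.1.tableWords.getD (2 * u.2 + 1) []] :=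
    ((hT.comp hΓ).getD hd (const [])).cons
      (((hT.comp hΓ).getD hd.succ (const [])).cons (const []))
  have h₀ : PTime fun u : NormalFormGame × ℕ =>
      (List.range ((List.ofFn u.1.numActions).getD u.2 0)).map fun x =>
        ((0, [u.2, x], []) : VertexData) :=
    ((hc.comp hΓ).getD hi (const 0)).range.map
      (g := fun v : (NormalFormGame × ℕ) × ℕ => (0, [v.1.2, v.2], []))
      ((const 0).pair ((PTime.id.fst.snd.cons (PTime.id.snd.cons (const []))).pair (const [])))
  have h₁ : PTime fun u : NormalFormGame × ℕ =>
      ((1, List.mixedDigits u.2 (u.1.numPlayers :: List.ofFn u.1.numActions),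
        [u.1.tableWords.getD (2 * u.2) [], u.1.tableWords.getD (2 * u.2 + 1) []]) : VertexData) :=
    (const 1).pair ((hi.mixedDigits ((hN.comp hΓ).cons (hc.comp hΓ))).pair hw)
  have h₂ : PTime fun u : NormalFormGame × ℕ => ((2, [u.2], []) : VertexData) :=
    (const 2).pair ((hi.cons (const [])).pair (const []))
  have h₃ : PTime fun u : NormalFormGame × ℕ => ((3, [u.2],
      if u.2 = u.1.numEntries then [] else
        [u.1.tableWords.getD (2 * u.2) [], u.1.tableWords.getD (2 * u.2 + 1) []]) : VertexData) :=
    (const 3).pair ((hi.cons (const [])).pair ((hi.eq (hE.comp hΓ)).ite (const []) hw))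
  exact (((hN.range.flatMap h₀).append (hE.range.map h₁)).append (hE.succ.range.map h₂)).append
    (hE.succ.range.map h₃)

theorem map_map {β γ : Type} [Code β] [Code γ] {l : α → List β} {g : β × β → γ} (hl : PTime l)
    (hg : PTime g) : PTime fun a => (l a).map fun u => (l a).map fun v => g (u, v) := by
  have h₁ : PTime fun v : (α × β) × β => (v.1.2, v.2) := PTime.id.fst.snd.pair PTime.id.snd
  exact hl.map ((hl.comp PTime.id.fst).map (hg.comp h₁))

theorem graph_words : PTime fun Γ : NormalFormGame =>
    Γ.vertexDataList.map fun u => Γ.vertexDataList.map fun v => NormalFormGame.dataAdj u v := by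
  have := PTime.vertexDataList.map_map PTime.dataAdj
  exact this

end PTime

end StackProgram

/-! ### Completeness -/

theorem gameSymmetry_polyReducible : gameSymmetry.PolyReducible graphAutomorphism := by
  -- `f` comes from an existence statement; computability concerns only the words of its values, and
  -- these are given explicitly by `hf`.
  choose f hf hiff using NormalFormGame.exists_graph
  have h : StackProgram.PTime fun Γ => encodeWords (graphWords (f Γ)) := by
    simpa only [hf] using StackProgram.PTime.graph_words.encodeWords
  exact ⟨f, StackProgram.PTime.tm2 (A := NormalFormGame) (B := Σ n, SimpleGraph (Fin n))
    (fun _ => rfl) h, fun Γ => (hiff Γ).symm⟩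

theorem polyReducible_gameSymmetry_restrict (ε : ℚ) {p : NormalFormGame → Prop}
    (hp : ∀ (n : ℕ) (G : SimpleGraph (Fin n)), p (G.toGame ε)) :
    graphAutomorphism.PolyReducible (gameSymmetry.restrict p) :=
  ⟨fun G => ⟨G.2.toGame ε, hp G.1 G.2⟩,
    StackProgram.PTime.tm2 (A := Σ n, SimpleGraph (Fin n)) (B := {Γ // p Γ})
      (eB := fun Γ => encodeWords Γ.1.words) (fun _ => rfl)
      (StackProgram.PTime.words_toGame ε).encodeWords,
    fun G => G.2.toGame_exists_symmetry_iff ε⟩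

theorem polyReducible_gameSymmetry : graphAutomorphism.PolyReducible gameSymmetry :=
  ⟨fun G => G.2.toGame 1,
    StackProgram.PTime.tm2 (A := Σ n, SimpleGraph (Fin n)) (B := NormalFormGame)
      (fun _ => rfl) (StackProgram.PTime.words_toGame 1).encodeWords,
    fun G => G.2.toGame_exists_symmetry_iff 1⟩

/-- The class consists of the problems below graph automorphism, so transitivity reduces hardness to
a single reduction. -/
theorem DecisionProblem.isHardFor_classGA {P : DecisionProblem}
    (h : graphAutomorphism.PolyReducible P) : IsHardFor classGA P :=
  have : Nonempty graphAutomorphism.Alphabet := ⟨(none : Option Bool)⟩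
  fun _ hQ => hQ.trans h

theorem mainTheorem1 :
    DecisionProblem.IsCompleteFor classGA gameSymmetry ∧
      DecisionProblem.IsHardFor classGA twoPlayerTeamGameSymmetry ∧
      DecisionProblem.IsHardFor classGA twoPlayerZeroSumGameSymmetry := by
  refine ⟨⟨gameSymmetry_polyReducible, DecisionProblem.isHardFor_classGA polyReducible_gameSymmetry⟩,
    DecisionProblem.isHardFor_classGA (polyReducible_gameSymmetry_restrict 1 fun n G => ⟨rfl, ?_⟩),
    DecisionProblem.isHardFor_classGA (polyReducible_gameSymmetry_restrict (-1) fun n G => ⟨rfl, ?_⟩)⟩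
  · intro i j a
    simp [SimpleGraph.toGame]
  · intro a
    change ∑ i : Fin 2, _ = (0 : ℚ)
    simp [Fin.sum_univ_two, SimpleGraph.toGame]
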